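/- Let $\mathbb D$ be the open unit disc, $dA$ its normalized area measure, and let $\mu_1,\mu_2$ be finite positive Borel measures on $\overline{\mathbb D}$. For a finite positive Borel measure $\mu$ on $\overline{\mathbb D}$ and $w\in\mathbb D$ put $$U_\mu(w)=\int_{\mathbb D}\log\left|\frac{1-\overline{\zeta}w}{w-\zeta}\right|^2\frac{d\mu(\zeta)}{1-|\zeta|^2}+\int_{\partial\mathbb D}\frac{1-|w|^2}{|\zeta-w|^2}\,d\mu(\zeta)\in[0,\infty],$$ and for $f$ holomorphic on $\mathbb D^2$ put $$\mathcal D_{\mu_1,\mu_2}(f)=\sup_{0<r<1}\int_0^{2\pi}\!\!\int_{\mathbb D}|\partial_1f(z_1,re^{i\theta})|^2U_{\mu_1}(z_1)\,dA(z_1)\frac{d\theta}{2\pi}+\sup_{0<r<1}\int_0^{2\pi}\!\!\int_{\mathbb D}|\partial_2f(re^{i\theta},z_2)|^2U_{\mu_2}(z_2)\,dA(z_2)\frac{d\theta}{2\pi}.$$ Let $\mathcal D(\mu_1,\mu_2)$ be the space of all $f$ in the Hardy space $H^2(\mathbb D^2)$ with $\mathcal D_{\mu_1,\mu_2}(f)<\infty$,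 normed by $\|f\|^2=\|f\|^2_{H^2(\mathbb D^2)}+\mathcal D_{\mu_1,\mu_2}(f)$. Then $\mathcal D(\mu_1,\mu_2)$ is a Hilbert space with a reproducing kernel $\kappa$ (so $\kappa(\cdot,w)\in\mathcal D(\mu_1,\mu_2)$ and $\langle f,\kappa(\cdot,w)\rangle=f(w)$ for all $f\in\mathcal D(\mu_1,\mu_2)$ and $w\in\mathbb D^2$), the multiplications $\mathscr M_{z_1},\mathscr M_{z_2}$ by the coordinate functions are bounded operators on it, and for every $w=(w_1,w_2)\in\mathbb D^2$: 1. the joint kernel $\ker(\mathscr M_z-w)=\ker(\mathscr M_{z_1}-w_1)\cap\ker(\mathscr M_{z_2}-w_2)$ is $\{0\}$; 2. the joint kernel $\ker(\mathscr M_z^*-w)=\ker(\mathscr M_{z_1}^*-w_1)\cap\ker(\mathscr M_{z_2}^*-w_2)$ is one-dimensional and is spanned by $\kappa(\cdot,\overline w)$, where $\overline w=(\overline{w_1},\overline{w_2})$. -/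

import Mathlib

noncomputable section

namespace Bidisc

open MeasureTheory Metric Set Filter Topology
open scoped ENNReal NNReal ComplexConjugate

/-- The open unit bidisc in `ℂ²`. -/
def bidisc : Set (ℂ × ℂ) := {z | ‖z.1‖ < 1 ∧ ‖z.2‖ < 1}

/-- The measure `dθ / 2π` on `(0, 2π]`. -/
def angle : Measure ℝ :=
  (ENNReal.ofReal (2 * Real.pi))⁻¹ • volume.restrict (Ioc 0 (2 * Real.pi))

/-- The normalized Lebesgue area measure `dA` on the open unit disc. -/
def area : Measure ℂ :=
  (ENNReal.ofReal Real.pi)⁻¹ • volume.restrict (ball 0 1)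

/-- The density at `ζ` (in the closed unit disc) of the representing integral of a positive
superharmonic function at the point `w` of the open disc: the weighted Green function
`log |(1 - conj ζ * w) / (w - ζ)|² / (1 - |ζ|²)` (with value `∞` at `w = ζ`) for `|ζ| < 1`,
and the Poisson kernel `(1 - |w|²) / |ζ - w|²` for `|ζ| = 1`. -/
def potentialKernel (ζ w : ℂ) : ℝ≥0∞ :=
  open Classical in
  if ‖ζ‖ < 1 then
    if w = ζ then ⊤
    else ENNReal.ofReal (Real.log (‖(1 - conj ζ * w) / (w - ζ)‖ ^ 2) / (1 - ‖ζ‖ ^ 2))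
  else ENNReal.ofReal ((1 - ‖w‖ ^ 2) / ‖ζ - w‖ ^ 2)

/-- The positive superharmonic weight `U_μ` of a measure `μ` on the closed unit disc. -/
def potential (μ : Measure (closedBall (0 : ℂ) 1)) (w : ℂ) : ℝ≥0∞ :=
  ∫⁻ ζ, potentialKernel ζ w ∂μ

/-- The square mean of `f` over the torus of radius `r`. -/
def hardyMean (f : ℂ × ℂ → ℂ) (r : ℝ) : ℝ≥0∞ :=
  ∫⁻ θ₁, ∫⁻ θ₂, ‖f (circleMap 0 r θ₁, circleMap 0 r θ₂)‖ₑ ^ 2 ∂angle ∂angle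

/-- The square of the Hardy norm of `f` on the bidisc. -/
def hardyNormSq (f : ℂ × ℂ → ℂ) : ℝ≥0∞ :=
  ⨆ r : Ioo (0 : ℝ) 1, hardyMean f r

/-- `∫ ∫_𝔻 |∂F/∂z (z, r e^{iθ})|² U_μ(z) dA(z) dθ/2π`. -/
def dirichletMean (μ : Measure (closedBall (0 : ℂ) 1)) (F : ℂ → ℂ → ℂ) (r : ℝ) : ℝ≥0∞ :=
  ∫⁻ θ, ∫⁻ z, ‖deriv (fun w => F w (circleMap 0 r θ)) z‖ₑ ^ 2 * potential μ z ∂area ∂angle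

/-- The Dirichlet integral `𝓓_{μ₁, μ₂}(f)`. -/
def dirichletIntegral (μ₁ μ₂ : Measure (closedBall (0 : ℂ) 1)) (f : ℂ × ℂ → ℂ) : ℝ≥0∞ :=
  (⨆ r : Ioo (0 : ℝ) 1, dirichletMean μ₁ (fun z e => f (z, e)) r) +
    ⨆ r : Ioo (0 : ℝ) 1, dirichletMean μ₂ (fun z e => f (e, z)) r

/-- `‖f‖²_{H²} + 𝓓_{μ₁, μ₂}(f)`. -/
def normSq (μ₁ μ₂ : Measure (closedBall (0 : ℂ) 1)) (f : ℂ × ℂ → ℂ) : ℝ≥0∞ :=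
  hardyNormSq f + dirichletIntegral μ₁ μ₂ f

/-! ### Elementary facts showing that the norm is a Hilbert norm -/

instance : IsFiniteMeasure angle := by
  unfold angle
  refine ⟨?_⟩
  simp only [Measure.smul_apply, smul_eq_mul]
  refine ENNReal.mul_lt_top ?_ ?_
  · simp [Real.pi_pos]
  · simpa using ENNReal.mul_lt_top ENNReal.ofNat_lt_top ENNReal.ofReal_lt_top

instance : IsFiniteMeasure area := by
  unfold area
  refine ⟨?_⟩
  simp only [Measure.smul_apply, smul_eq_mul]
  refine ENNReal.mul_lt_top ?_ ?_
  · simp [Real.pi_pos]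
  · simp

lemma measurable_potential (μ : Measure (closedBall (0 : ℂ) 1)) [IsFiniteMeasure μ] :
    Measurable (potential μ) := by
  have h : Measurable fun p : ℂ × closedBall (0 : ℂ) 1 => potentialKernel p.2 p.1 := by
    unfold potentialKernel
    have h2 : Measurable fun p : ℂ × closedBall (0 : ℂ) 1 => (p.2 : ℂ) :=
      measurable_subtype_coe.comp measurable_snd
    refine Measurable.ite (measurableSet_lt h2.norm measurable_const)
      (Measurable.ite (measurableSet_eq_fun measurable_fst h2) measurable_const ?_) ?_
    · refine Measurable.ennreal_ofReal ?_
      have h3 : Measurable fun p : ℂ × closedBall (0 : ℂ) 1 => conj (p.2 : ℂ) :=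
        Complex.continuous_conj.measurable.comp h2
      exact (Real.measurable_log.comp ((((measurable_const.sub (h3.mul measurable_fst)).div
        (measurable_fst.sub h2)).norm).pow_const 2)).div
        (measurable_const.sub (h2.norm.pow_const 2))
    · exact Measurable.ennreal_ofReal ((measurable_const.sub (measurable_fst.norm.pow_const 2)).div
        ((h2.sub measurable_fst).norm.pow_const 2))
  exact h.lintegral_prod_right'

lemma isOpen_bidisc : IsOpen bidisc :=
  (isOpen_lt continuous_fst.norm continuous_const).inter
    (isOpen_lt continuous_snd.norm continuous_const)

lemma enorm_parallelogram (a b : ℂ) :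
    ‖a + b‖ₑ ^ 2 + ‖a - b‖ₑ ^ 2 = 2 * ‖a‖ₑ ^ 2 + 2 * ‖b‖ₑ ^ 2 := by
  have h := parallelogram_law_with_norm ℝ a b
  simp only [enorm_eq_nnnorm]
  norm_cast
  ext
  push_cast
  linarith

lemma enorm_add_sq_le (a b : ℂ) (t : ℝ≥0) (ht : t ≠ 0) :
    ‖a + b‖ₑ ^ 2 ≤ ↑(1 + t) * ‖a‖ₑ ^ 2 + ↑(1 + t⁻¹) * ‖b‖ₑ ^ 2 := by
  simp only [enorm_eq_nnnorm]
  norm_cast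
  rw [← NNReal.coe_le_coe]
  push_cast
  have h := norm_add_le a b
  have ht' : (0 : ℝ) < t := by positivity
  have h1 : ‖a + b‖ ^ 2 ≤ (‖a‖ + ‖b‖) ^ 2 := by gcongr
  have h2 : 0 ≤ (t : ℝ)⁻¹ * (t * ‖a‖ - ‖b‖) ^ 2 := by positivity
  have h3 : (t : ℝ)⁻¹ * (t * ‖a‖ - ‖b‖) ^ 2 = t * ‖a‖ ^ 2 - 2 * ‖a‖ * ‖b‖ + (t : ℝ)⁻¹ * ‖b‖ ^ 2 := by
    field_simp
    ring
  nlinarith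

section Weighted

variable {X : Type*} [MeasurableSpace X] {ν : Measure X} {u : X → ℝ≥0∞} {A B : X → ℂ}

lemma lintegral_parallelogram (hu : AEMeasurable u ν) (hA : AEMeasurable A ν)
    (hB : AEMeasurable B ν) :
    ∫⁻ x, ‖A x + B x‖ₑ ^ 2 * u x ∂ν + ∫⁻ x, ‖A x - B x‖ₑ ^ 2 * u x ∂ν =
      2 * ∫⁻ x, ‖A x‖ₑ ^ 2 * u x ∂ν + 2 * ∫⁻ x, ‖B x‖ₑ ^ 2 * u x ∂ν := by
  have mAB : AEMeasurable (fun x => ‖A x + B x‖ₑ ^ 2 * u x) ν :=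
    ((hA.add hB).enorm.pow_const 2).mul hu
  have mA : AEMeasurable (fun x => ‖A x‖ₑ ^ 2 * u x) ν := (hA.enorm.pow_const 2).mul hu
  have mB : AEMeasurable (fun x => ‖B x‖ₑ ^ 2 * u x) ν := (hB.enorm.pow_const 2).mul hu
  rw [← lintegral_add_left' mAB, ← lintegral_const_mul'' _ mA, ← lintegral_const_mul'' _ mB,
    ← lintegral_add_left' (mA.const_mul 2)]
  refine lintegral_congr fun x => ?_
  rw [← add_mul, enorm_parallelogram]
  ring

lemma lintegral_add_sq_le (hu : AEMeasurable u ν) (hA : AEMeasurable A ν)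
    (hB : AEMeasurable B ν) (t : ℝ≥0) (ht : t ≠ 0) :
    ∫⁻ x, ‖A x + B x‖ₑ ^ 2 * u x ∂ν ≤
      ↑(1 + t) * ∫⁻ x, ‖A x‖ₑ ^ 2 * u x ∂ν + ↑(1 + t⁻¹) * ∫⁻ x, ‖B x‖ₑ ^ 2 * u x ∂ν := by
  have mA : AEMeasurable (fun x => ‖A x‖ₑ ^ 2 * u x) ν := (hA.enorm.pow_const 2).mul hu
  have mB : AEMeasurable (fun x => ‖B x‖ₑ ^ 2 * u x) ν := (hB.enorm.pow_const 2).mul hu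
  rw [← lintegral_const_mul'' _ mA, ← lintegral_const_mul'' _ mB,
    ← lintegral_add_left' (mA.const_mul _)]
  refine lintegral_mono fun x => ?_
  calc ‖A x + B x‖ₑ ^ 2 * u x
      ≤ (↑(1 + t) * ‖A x‖ₑ ^ 2 + ↑(1 + t⁻¹) * ‖B x‖ₑ ^ 2) * u x := by
        gcongr
        exact enorm_add_sq_le _ _ t ht
    _ = _ := by ring

lemma lintegral_smul_sq (hu : AEMeasurable u ν) (hA : AEMeasurable A ν) (c : ℂ) :
    ∫⁻ x, ‖c * A x‖ₑ ^ 2 * u x ∂ν = ‖c‖ₑ ^ 2 * ∫⁻ x, ‖A x‖ₑ ^ 2 * u x ∂ν := by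
  have mA : AEMeasurable (fun x => ‖A x‖ₑ ^ 2 * u x) ν := (hA.enorm.pow_const 2).mul hu
  rw [← lintegral_const_mul'' _ mA]
  refine lintegral_congr fun x => ?_
  rw [enorm_mul]
  ring

end Weighted

/-- The square means of a holomorphic function of one variable increase with the radius. -/
lemma circle_mean_mono {h : ℂ → ℂ} (hh : DifferentiableOn ℂ h (ball 0 1)) {r s : ℝ} (hr : 0 < r)
    (hrs : r ≤ s) (hs : s < 1) :
    ∫⁻ θ, ‖h (circleMap 0 r θ)‖ₑ ^ 2 ∂angle ≤ ∫⁻ θ, ‖h (circleMap 0 s θ)‖ₑ ^ 2 ∂angle := by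
  have pp : (0 : ℝ) < 2 * Real.pi := by positivity
  -- continuity on circles
  have hcont : ∀ ρ : ℝ, 0 < ρ → ρ < 1 → Continuous fun θ : ℝ => h (circleMap 0 ρ θ) := by
    intro ρ h0 h1
    refine hh.continuousOn.comp_continuous (continuous_circleMap 0 ρ) fun θ => ?_
    simp [abs_of_pos h0, h1]
  have hL2 : ∀ ρ : ℝ, 0 < ρ → ρ < 1 →
      MemLp (fun θ : ℝ => h (circleMap 0 ρ θ)) 2 (volume.restrict (Ioc 0 (2 * Real.pi))) := by
    intro ρ h0 h1
    obtain ⟨C, hC⟩ := (isCompact_Icc (a := (0 : ℝ)) (b := 2 * Real.pi)).exists_bound_of_continuousOn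
      (hcont ρ h0 h1).continuousOn
    refine MemLp.of_bound (hcont ρ h0 h1).aestronglyMeasurable C ?_
    refine (ae_restrict_mem measurableSet_Ioc).mono fun x hx => hC x (Ioc_subset_Icc_self hx)
  -- reduction to Bochner integrals
  have hconv : ∀ ρ : ℝ, 0 < ρ → ρ < 1 → ∫⁻ θ, ‖h (circleMap 0 ρ θ)‖ₑ ^ 2 ∂angle =
      (ENNReal.ofReal (2 * Real.pi))⁻¹ *
        ENNReal.ofReal (∫ θ in (0 : ℝ)..2 * Real.pi, ‖h (circleMap 0 ρ θ)‖ ^ 2) := by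
    intro ρ h0 h1
    rw [angle, lintegral_smul_measure, smul_eq_mul, intervalIntegral.integral_of_le pp.le,
      ofReal_integral_eq_lintegral_ofReal]
    · congr 1
      refine lintegral_congr fun θ => ?_
      rw [ENNReal.ofReal_pow (norm_nonneg _), ofReal_norm]
    · exact (hL2 ρ h0 h1).integrable_norm_pow (by norm_num)
    · exact Eventually.of_forall fun θ => by positivity
  have hr1 : r < 1 := hrs.trans_lt hs
  have hs0 : 0 < s := hr.trans_le hrs
  rw [hconv r hr hr1, hconv s hs0 hs]
  gcongr
  have e1 := hasSum_sq_fourierCoeffOn pp (hL2 r hr hr1)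
  have e2 := hasSum_sq_fourierCoeffOn pp (hL2 s hs0 hs)
  suffices H : ∀ n : ℤ, ‖fourierCoeffOn pp (fun θ : ℝ => h (circleMap 0 r θ)) n‖ ≤
      ‖fourierCoeffOn pp (fun θ : ℝ => h (circleMap 0 s θ)) n‖ by
    have := hasSum_le (fun n => by have := H n; gcongr) e1 e2
    simp only [smul_eq_mul, sub_zero] at this
    exact le_of_mul_le_mul_left this (by positivity)
  -- the coefficients through circle integrals
  have hcoef : ∀ ρ : ℝ, 0 < ρ → ∀ n : ℤ,
      fourierCoeffOn pp (fun θ : ℝ => h (circleMap 0 ρ θ)) n =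
        (1 / (2 * Real.pi) : ℝ) • ((ρ : ℂ) ^ n *
          (Complex.I⁻¹ * ∮ z in C(0, ρ), z ^ (-n - 1) * h z)) := by
    intro ρ h0 n
    rw [fourierCoeffOn_eq_integral, circleIntegral, sub_zero]
    congr 1
    rw [← intervalIntegral.integral_const_mul, ← intervalIntegral.integral_const_mul]
    refine intervalIntegral.integral_congr fun θ _ => ?_
    have hρ : (ρ : ℂ) ≠ 0 := by exact_mod_cast h0.ne'
    have hz : circleMap 0 ρ θ ≠ 0 := by simp [circleMap, hρ]
    simp only [deriv_circleMap, smul_eq_mul]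
    rw [fourier_coe_apply]
    have : Complex.exp (2 * Real.pi * Complex.I * ((-n : ℤ) : ℂ) * θ / ((2 * Real.pi : ℝ) : ℂ)) =
        (ρ : ℂ) ^ n * circleMap 0 ρ θ ^ (-n) := by
      have hp : (Real.pi : ℂ) ≠ 0 := by exact_mod_cast Real.pi_ne_zero
      rw [circleMap, zero_add, mul_zpow, ← mul_assoc, ← zpow_add₀ hρ, add_neg_cancel, zpow_zero,
        one_mul, ← Complex.exp_int_mul]
      congr 1
      push_cast
      field_simp
    rw [this, sub_eq_add_neg, zpow_add₀ hz, zpow_neg_one]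
    field_simp
  have hind : ∀ n : ℤ, (∮ z in C(0, s), z ^ (-n - 1) * h z) =
      ∮ z in C(0, r), z ^ (-n - 1) * h z := by
    intro n
    have hd : ∀ z ∈ closedBall (0 : ℂ) s \ ball 0 r,
        DifferentiableAt ℂ (fun z => z ^ (-n - 1) * h z) z := by
      intro z hz
      have hz0 : z ≠ 0 := by
        rintro rfl
        exact hz.2 (by simpa using hr)
      refine (differentiableAt_zpow.2 (Or.inl hz0)).mul (hh.differentiableAt ?_)
      exact isOpen_ball.mem_nhds (closedBall_subset_ball hs hz.1)
    refine Complex.circleIntegral_eq_of_differentiable_on_annulus_off_countable hr hrs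
      countable_empty (fun z hz => (hd z hz).continuousAt.continuousWithinAt) fun z hz => ?_
    exact hd z ⟨ball_subset_closedBall hz.1.1, fun hh => hz.1.2 (ball_subset_closedBall hh)⟩
  intro n
  rw [hcoef r hr, hcoef s hs0, hind n]
  simp only [norm_smul, norm_mul, norm_zpow, Complex.norm_real, Real.norm_of_nonneg hr.le,
    Real.norm_of_nonneg hs0.le]
  rcases le_or_gt 0 n with hn | hn
  · have : r ^ n ≤ s ^ n := zpow_le_zpow_left₀ hn hr.le hrs
    gcongr
  · have hz : (∮ z in C(0, r), z ^ (-n - 1) * h z) = 0 := by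
      obtain ⟨k, hk⟩ := Int.eq_ofNat_of_zero_le (a := -n - 1) (by omega)
      rw [hk]
      simp only [zpow_natCast]
      have hd : ∀ z ∈ closedBall (0 : ℂ) r, DifferentiableAt ℂ (fun z => z ^ k * h z) z := by
        intro z hz
        exact (differentiableAt_pow k).mul
          (hh.differentiableAt (isOpen_ball.mem_nhds (closedBall_subset_ball hr1 hz)))
      exact Complex.circleIntegral_eq_zero_of_differentiable_on_off_countable hr.le countable_empty
        (fun z hz => (hd z hz).continuousAt.continuousWithinAt)
        fun z hz => hd z (ball_subset_closedBall hz.1)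
    rw [hz]
    simp

section Slices

variable {F H : ℂ → ℂ → ℂ}

lemma differentiableOn_slice (hF : DifferentiableOn ℂ (fun p : ℂ × ℂ => F p.1 p.2) bidisc) {e : ℂ}
    (he : ‖e‖ < 1) : DifferentiableOn ℂ (fun w => F w e) (ball 0 1) := by
  have : DifferentiableOn ℂ (fun w : ℂ => ((w, e) : ℂ × ℂ)) (ball 0 1) := by fun_prop
  exact hF.comp this fun w hw => ⟨by simpa using hw, he⟩

lemma differentiableOn_slice' (hF : DifferentiableOn ℂ (fun p : ℂ × ℂ => F p.1 p.2) bidisc) {e : ℂ}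
    (he : ‖e‖ < 1) : DifferentiableOn ℂ (fun w => F e w) (ball 0 1) := by
  have : DifferentiableOn ℂ (fun w : ℂ => ((e, w) : ℂ × ℂ)) (ball 0 1) := by fun_prop
  exact hF.comp this fun w hw => ⟨he, by simpa using hw⟩

/-- The first partial derivative of a holomorphic function on the bidisc is continuous. -/
lemma continuousOn_partial (hF : DifferentiableOn ℂ (fun p : ℂ × ℂ => F p.1 p.2) bidisc) :
    ContinuousOn (fun p : ℂ × ℂ => deriv (fun w => F w p.2) p.1) bidisc := by
  intro p hp
  refine ContinuousAt.continuousWithinAt ?_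
  have hb : ball (0 : ℂ) 1 ∈ 𝓝 p.2 := isOpen_ball.mem_nhds (by simpa using hp.2)
  have h1 : TendstoLocallyUniformlyOn (fun (e : ℂ) (w : ℂ) => F w e) (fun w => F w p.2) (𝓝 p.2)
      (ball 0 1) := by
    rw [tendstoLocallyUniformlyOn_iff_forall_isCompact isOpen_ball]
    intro K hK hKc
    have hc : ContinuousOn (Function.uncurry fun (e : ℂ) (w : ℂ) => F w e) (ball 0 1 ×ˢ K) := by
      refine hF.continuousOn.comp (f := Prod.swap) continuous_swap.continuousOn ?_
      rintro ⟨e, w⟩ ⟨he, hw⟩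
      exact ⟨by simpa using hK hw, by simpa using he⟩
    intro u hu
    obtain ⟨v, hv, hvu⟩ := hKc.mem_uniformity_of_prod hc (mem_of_mem_nhds hb) (symm_le_uniformity hu)
    rw [nhdsWithin_eq_nhds.2 hb] at hv
    filter_upwards [hv] with e he w hw using hvu e he w hw
  have h2 := h1.deriv (by
    filter_upwards [hb] with e he
    exact differentiableOn_slice hF (by simpa using he)) isOpen_ball
  have h3 : TendstoLocallyUniformlyOn (fun (q : ℂ × ℂ) => deriv fun w => F w q.2)
      (deriv fun w => F w p.2) (𝓝 p) (ball 0 1) := by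
    intro u hu x hx
    obtain ⟨t, ht, h⟩ := h2 u hu x hx
    exact ⟨t, ht, continuous_snd.continuousAt.eventually h⟩
  have hz : ball (0 : ℂ) 1 ∈ 𝓝 p.1 := isOpen_ball.mem_nhds (by simpa using hp.1)
  have h4 := tendsto_comp_of_locally_uniform_limit_within (g := fun q : ℂ × ℂ => q.1)
    (x := p.1) (s := ball 0 1)
    (((differentiableOn_slice hF hp.2).deriv isOpen_ball).continuousOn p.1 (mem_of_mem_nhds hz))
    (by rw [nhdsWithin_eq_nhds.2 hz]; exact continuous_fst.continuousAt)
    (fun u hu => by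
      obtain ⟨t, ht, h⟩ := h3 u hu p.1 (mem_of_mem_nhds hz)
      exact ⟨t, ht, h⟩)
  exact h4

/-- The first partial derivative of a holomorphic function on the bidisc is holomorphic in the
second variable. -/
lemma differentiableOn_partial (hF : DifferentiableOn ℂ (fun p : ℂ × ℂ => F p.1 p.2) bidisc)
    {z : ℂ} (hz : ‖z‖ < 1) :
    DifferentiableOn ℂ (fun e => deriv (fun w => F w e) z) (ball 0 1) := by
  have hb : ball (0 : ℂ) 1 ∈ 𝓝 z := isOpen_ball.mem_nhds (by simpa using hz)
  have h1 : TendstoLocallyUniformlyOn (fun (t : ℂ) (e : ℂ) => t⁻¹ * (F (z + t) e - F z e))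
      (fun e => deriv (fun w => F w e) z) (𝓝[≠] 0) (ball 0 1) := by
    rw [tendstoLocallyUniformlyOn_iff_forall_isCompact isOpen_ball]
    intro K hK hKc
    have hc : ContinuousOn (Function.uncurry fun (w : ℂ) (e : ℂ) => deriv (fun w => F w e) w)
        (ball 0 1 ×ˢ K) := by
      refine (continuousOn_partial hF).mono ?_
      rintro ⟨w, e⟩ ⟨hw, he⟩
      exact ⟨by simpa using hw, by simpa using hK he⟩
    rw [Metric.tendstoUniformlyOn_iff]
    intro ε hε
    obtain ⟨v, hv, hvu⟩ := hKc.mem_uniformity_of_prod hc (mem_of_mem_nhds hb)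
      (Metric.dist_mem_uniformity (half_pos hε))
    rw [nhdsWithin_eq_nhds.2 hb] at hv
    obtain ⟨δ, hδ, hsub⟩ := Metric.mem_nhds_iff.1 (inter_mem hv hb)
    have hnear : ball (0 : ℂ) δ ∈ 𝓝[≠] (0 : ℂ) := mem_nhdsWithin_of_mem_nhds (ball_mem_nhds _ hδ)
    filter_upwards [hnear, self_mem_nhdsWithin] with t ht1 ht2 e he
    have ht : t ∈ ball (0 : ℂ) δ ∧ t ≠ 0 := ⟨ht1, ht2⟩
    have hF1 := differentiableOn_slice hF (e := e) (by simpa using hK he)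
    have hdF : ∀ x ∈ ball z δ, DifferentiableAt ℂ (fun w => F w e) x := fun x hx =>
      hF1.differentiableAt (isOpen_ball.mem_nhds (hsub hx).2)
    have key := Convex.norm_image_sub_le_of_norm_deriv_le (𝕜 := ℂ) (s := ball z δ)
      (f := fun w => F w e - w * deriv (fun w => F w e) z) (x := z) (y := z + t) (C := ε / 2)
      (fun x hx => (hdF x hx).sub (differentiableAt_id.mul_const _))
      (fun x hx => by
        have hd : HasDerivAt (fun w => F w e - w * deriv (fun w => F w e) z)
            (deriv (fun w => F w e) x - 1 * deriv (fun w => F w e) z) x :=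
          (hdF x hx).hasDerivAt.sub ((hasDerivAt_id x).mul_const _)
        rw [hd.deriv, one_mul, ← dist_eq_norm]
        exact (hvu x (hsub hx).1 e he).le)
      (convex_ball z δ) (mem_ball_self hδ) (by simpa using ht.1)
    rw [dist_comm, dist_eq_norm]
    have e1 : t⁻¹ * (F (z + t) e - F z e) - deriv (fun w => F w e) z =
        t⁻¹ * (F (z + t) e - (z + t) * deriv (fun w => F w e) z -
          (F z e - z * deriv (fun w => F w e) z)) := by
      have := ht.2
      field_simp
      ring
    rw [e1, norm_mul, norm_inv]
    have ht0 : 0 < ‖t‖ := norm_pos_iff.2 ht.2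
    rw [add_sub_cancel_left] at key
    calc ‖t‖⁻¹ * _ ≤ ‖t‖⁻¹ * (ε / 2 * ‖t‖) := by gcongr
      _ = ε / 2 := by field_simp
      _ < ε := half_lt_self hε
  refine h1.differentiableOn ?_ isOpen_ball
  have hnear : ∀ᶠ t : ℂ in 𝓝[≠] 0, z + t ∈ ball (0 : ℂ) 1 := by
    have : Tendsto (fun t : ℂ => z + t) (𝓝 0) (𝓝 z) := by
      have : ContinuousAt (fun t : ℂ => z + t) 0 := by fun_prop
      simpa [ContinuousAt] using this
    exact (this.eventually hb).filter_mono nhdsWithin_le_nhds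
  filter_upwards [hnear] with t ht
  exact ((differentiableOn_slice' hF (by simpa using ht)).sub
    (differentiableOn_slice' hF hz)).const_mul _

/-- The first partial derivative, extended by zero. -/
def partialExt (F : ℂ → ℂ → ℂ) : ℂ × ℂ → ℂ :=
  bidisc.indicator fun p => deriv (fun w => F w p.2) p.1

lemma measurable_partialExt (hF : DifferentiableOn ℂ (fun p : ℂ × ℂ => F p.1 p.2) bidisc) :
    Measurable (partialExt F) := by
  classical
  unfold partialExt
  rw [← piecewise_eq_indicator]
  exact (continuousOn_partial hF).measurable_piecewise continuousOn_const
    isOpen_bidisc.measurableSet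

lemma ae_area : ∀ᵐ z ∂area, z ∈ ball (0 : ℂ) 1 :=
  Measure.ae_smul_measure (ae_restrict_mem measurableSet_ball) _

lemma circleMap_mem {r : ℝ} (hr : r ∈ Ioo (0 : ℝ) 1) (θ : ℝ) : ‖circleMap 0 r θ‖ < 1 := by
  simpa [abs_of_pos hr.1] using hr.2

lemma measurable_circle (r : ℝ) : Measurable (circleMap 0 r) := (continuous_circleMap 0 r).measurable

lemma measurable_energy (μ : Measure (closedBall (0 : ℂ) 1)) [IsFiniteMeasure μ]
    (hF : DifferentiableOn ℂ (fun p : ℂ × ℂ => F p.1 p.2) bidisc) (r : ℝ) :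
    Measurable fun p : ℝ × ℂ => partialExt F (p.2, circleMap 0 r p.1) :=
  (measurable_partialExt hF).comp
    (measurable_snd.prodMk ((measurable_circle r).comp measurable_fst))

lemma dirichletMean_eq_iterated (μ : Measure (closedBall (0 : ℂ) 1)) {r : ℝ}
    (hr : r ∈ Ioo (0 : ℝ) 1) :
    dirichletMean μ F r =
      ∫⁻ θ, ∫⁻ z, ‖partialExt F (z, circleMap 0 r θ)‖ₑ ^ 2 * potential μ z ∂area ∂angle := by
  refine lintegral_congr fun θ => lintegral_congr_ae ?_
  filter_upwards [ae_area] with z hz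
  have : (z, circleMap 0 r θ) ∈ bidisc := ⟨by simpa using hz, circleMap_mem hr θ⟩
  rw [partialExt, indicator_of_mem this]

lemma dirichletMean_eq (μ : Measure (closedBall (0 : ℂ) 1)) [IsFiniteMeasure μ]
    (hF : DifferentiableOn ℂ (fun p : ℂ × ℂ => F p.1 p.2) bidisc) {r : ℝ}
    (hr : r ∈ Ioo (0 : ℝ) 1) :
    dirichletMean μ F r =
      ∫⁻ p, ‖partialExt F (p.2, circleMap 0 r p.1)‖ₑ ^ 2 * potential μ p.2 ∂(angle.prod area) := by
  rw [dirichletMean_eq_iterated μ hr, lintegral_prod]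
  exact (((measurable_energy μ hF r).enorm.pow_const 2).mul
    ((measurable_potential μ).comp measurable_snd)).aemeasurable

lemma dirichletMean_mono (μ : Measure (closedBall (0 : ℂ) 1)) [IsFiniteMeasure μ]
    (hF : DifferentiableOn ℂ (fun p : ℂ × ℂ => F p.1 p.2) bidisc) :
    Monotone fun r : Ioo (0 : ℝ) 1 => dirichletMean μ F r := by
  have hswap : ∀ r : Ioo (0 : ℝ) 1, dirichletMean μ F r =
      ∫⁻ z, (∫⁻ θ, ‖partialExt F (z, circleMap 0 r θ)‖ₑ ^ 2 ∂angle) * potential μ z ∂area := by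
    intro r
    rw [dirichletMean_eq_iterated μ r.2, lintegral_lintegral_swap]
    · refine lintegral_congr fun z => ?_
      rw [lintegral_mul_const]
      exact ((measurable_partialExt hF).comp
        (measurable_const.prodMk (measurable_circle r))).enorm.pow_const 2
    · exact (((measurable_energy μ hF r).enorm.pow_const 2).mul
        ((measurable_potential μ).comp measurable_snd)).aemeasurable
  intro r s hrs
  simp only [hswap]
  refine lintegral_mono_ae ?_
  filter_upwards [ae_area] with z hz
  have hz1 : ‖z‖ < 1 := by simpa using hz
  have hv : ∀ t : Ioo (0 : ℝ) 1, ∀ θ : ℝ, partialExt F (z, circleMap 0 t θ) =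
      deriv (fun w => F w (circleMap 0 t θ)) z := fun t θ => by
    have : (z, circleMap 0 t θ) ∈ bidisc := ⟨hz1, circleMap_mem t.2 θ⟩
    rw [partialExt, indicator_of_mem this]
  simp only [hv]
  gcongr ?_ * _
  exact circle_mean_mono (differentiableOn_partial hF hz1) r.2.1 hrs s.2.2

lemma partialExt_add (hF : DifferentiableOn ℂ (fun p : ℂ × ℂ => F p.1 p.2) bidisc)
    (hH : DifferentiableOn ℂ (fun p : ℂ × ℂ => H p.1 p.2) bidisc) (p : ℂ × ℂ) :
    partialExt (fun z e => F z e + H z e) p = partialExt F p + partialExt H p := by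
  by_cases hp : p ∈ bidisc
  · have hb : ball (0 : ℂ) 1 ∈ 𝓝 p.1 := isOpen_ball.mem_nhds (by simpa using hp.1)
    simp only [partialExt, indicator_of_mem hp]
    exact deriv_fun_add ((differentiableOn_slice hF hp.2).differentiableAt hb)
      ((differentiableOn_slice hH hp.2).differentiableAt hb)
  · simp [partialExt, indicator_of_notMem hp]

lemma partialExt_const_mul (c : ℂ) (F : ℂ → ℂ → ℂ) (p : ℂ × ℂ) :
    partialExt (fun z e => c * F z e) p = c * partialExt F p := by
  by_cases hp : p ∈ bidisc
  · simp only [partialExt, indicator_of_mem hp]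
    exact deriv_const_mul_field c
  · simp [partialExt, indicator_of_notMem hp]

lemma partialExt_sub (hF : DifferentiableOn ℂ (fun p : ℂ × ℂ => F p.1 p.2) bidisc)
    (hH : DifferentiableOn ℂ (fun p : ℂ × ℂ => H p.1 p.2) bidisc) (p : ℂ × ℂ) :
    partialExt (fun z e => F z e - H z e) p = partialExt F p - partialExt H p := by
  by_cases hp : p ∈ bidisc
  · have hb : ball (0 : ℂ) 1 ∈ 𝓝 p.1 := isOpen_ball.mem_nhds (by simpa using hp.1)
    simp only [partialExt, indicator_of_mem hp]
    exact deriv_fun_sub ((differentiableOn_slice hF hp.2).differentiableAt hb)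
      ((differentiableOn_slice hH hp.2).differentiableAt hb)
  · simp [partialExt, indicator_of_notMem hp]

lemma dirichletMean_parallelogram (μ : Measure (closedBall (0 : ℂ) 1)) [IsFiniteMeasure μ]
    (hF : DifferentiableOn ℂ (fun p : ℂ × ℂ => F p.1 p.2) bidisc)
    (hH : DifferentiableOn ℂ (fun p : ℂ × ℂ => H p.1 p.2) bidisc) {r : ℝ}
    (hr : r ∈ Ioo (0 : ℝ) 1) :
    dirichletMean μ (fun z e => F z e + H z e) r + dirichletMean μ (fun z e => F z e - H z e) r =
      2 * dirichletMean μ F r + 2 * dirichletMean μ H r := by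
  rw [dirichletMean_eq μ hF hr, dirichletMean_eq μ hH hr, dirichletMean_eq μ (hF.add hH) hr,
    dirichletMean_eq μ (hF.sub hH) hr]
  simp only [partialExt_add hF hH, partialExt_sub hF hH]
  exact lintegral_parallelogram ((measurable_potential μ).comp measurable_snd).aemeasurable
    (measurable_energy μ hF r).aemeasurable (measurable_energy μ hH r).aemeasurable

lemma dirichletMean_add_le (μ : Measure (closedBall (0 : ℂ) 1)) [IsFiniteMeasure μ]
    (hF : DifferentiableOn ℂ (fun p : ℂ × ℂ => F p.1 p.2) bidisc)
    (hH : DifferentiableOn ℂ (fun p : ℂ × ℂ => H p.1 p.2) bidisc) {r : ℝ}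
    (hr : r ∈ Ioo (0 : ℝ) 1) (t : ℝ≥0) (ht : t ≠ 0) :
    dirichletMean μ (fun z e => F z e + H z e) r ≤
      ↑(1 + t) * dirichletMean μ F r + ↑(1 + t⁻¹) * dirichletMean μ H r := by
  rw [dirichletMean_eq μ hF hr, dirichletMean_eq μ hH hr, dirichletMean_eq μ (hF.add hH) hr]
  simp only [partialExt_add hF hH]
  exact lintegral_add_sq_le ((measurable_potential μ).comp measurable_snd).aemeasurable
    (measurable_energy μ hF r).aemeasurable (measurable_energy μ hH r).aemeasurable t ht

lemma dirichletMean_const_mul (μ : Measure (closedBall (0 : ℂ) 1)) [IsFiniteMeasure μ]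
    (hF : DifferentiableOn ℂ (fun p : ℂ × ℂ => F p.1 p.2) bidisc) {r : ℝ}
    (hr : r ∈ Ioo (0 : ℝ) 1) (c : ℂ) :
    dirichletMean μ (fun z e => c * F z e) r = ‖c‖ₑ ^ 2 * dirichletMean μ F r := by
  rw [dirichletMean_eq μ hF hr, dirichletMean_eq μ (hF.const_mul c) hr]
  simp only [partialExt_const_mul]
  exact lintegral_smul_sq ((measurable_potential μ).comp measurable_snd).aemeasurable
    (measurable_energy μ hF r).aemeasurable c

end Slices

section Hardy

variable {f g : ℂ × ℂ → ℂ}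

lemma continuous_torus (hf : DifferentiableOn ℂ f bidisc) {r s : ℝ} (hr : r ∈ Ioo (0 : ℝ) 1)
    (hs : s ∈ Ioo (0 : ℝ) 1) :
    Continuous fun p : ℝ × ℝ => f (circleMap 0 r p.1, circleMap 0 s p.2) :=
  hf.continuousOn.comp_continuous (((continuous_circleMap 0 r).comp continuous_fst).prodMk
    ((continuous_circleMap 0 s).comp continuous_snd))
    fun p => ⟨circleMap_mem hr p.1, circleMap_mem hs p.2⟩

lemma hardyMean_eq (hf : DifferentiableOn ℂ f bidisc) {r : ℝ} (hr : r ∈ Ioo (0 : ℝ) 1) :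
    hardyMean f r =
      ∫⁻ p, ‖f (circleMap 0 r p.1, circleMap 0 r p.2)‖ₑ ^ 2 * 1 ∂(angle.prod angle) := by
  simp only [mul_one]
  rw [lintegral_prod]
  · rfl
  · exact ((continuous_torus hf hr hr).measurable.enorm.pow_const 2).aemeasurable

lemma hardyMean_mono (hf : DifferentiableOn ℂ f bidisc) :
    Monotone fun r : Ioo (0 : ℝ) 1 => hardyMean f r := by
  intro r s hrs
  have h1 : hardyMean f r ≤
      ∫⁻ θ₁, ∫⁻ θ₂, ‖f (circleMap 0 r θ₁, circleMap 0 s θ₂)‖ₑ ^ 2 ∂angle ∂angle :=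
    lintegral_mono fun θ₁ => circle_mean_mono
      (differentiableOn_slice' (F := fun a b => f (a, b)) hf (circleMap_mem r.2 θ₁)) r.2.1 hrs s.2.2
  refine h1.trans ?_
  have hs : ∀ t : Ioo (0 : ℝ) 1,
      ∫⁻ θ₁, ∫⁻ θ₂, ‖f (circleMap 0 t θ₁, circleMap 0 s θ₂)‖ₑ ^ 2 ∂angle ∂angle =
        ∫⁻ θ₂, ∫⁻ θ₁, ‖f (circleMap 0 t θ₁, circleMap 0 s θ₂)‖ₑ ^ 2 ∂angle ∂angle := fun t =>
    lintegral_lintegral_swap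
      ((continuous_torus hf t.2 s.2).measurable.enorm.pow_const 2).aemeasurable
  rw [hs r]
  refine le_of_le_of_eq ?_ (hs s).symm
  exact lintegral_mono fun θ₂ => circle_mean_mono
    (differentiableOn_slice (F := fun a b => f (a, b)) hf (circleMap_mem s.2 θ₂)) r.2.1 hrs s.2.2

lemma eq_zero_of_circle {h : ℂ → ℂ} (hh : DifferentiableOn ℂ h (ball 0 1)) {r : ℝ}
    (hr : r ∈ Ioo (0 : ℝ) 1) (h0 : ∀ θ ∈ Ioo (0 : ℝ) (2 * Real.pi), h (circleMap 0 r θ) = 0) :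
    EqOn h 0 (ball 0 1) := by
  have pp := Real.pi_pos
  refine (hh.analyticOnNhd isOpen_ball).eqOn_zero_of_preconnected_of_frequently_eq_zero
    (convex_ball _ _).isPreconnected (z₀ := circleMap 0 r Real.pi)
    (by simpa using circleMap_mem hr Real.pi) ?_
  have hd : HasDerivAt (circleMap 0 r) (circleMap 0 r Real.pi * Complex.I) Real.pi :=
    hasDerivAt_circleMap 0 r Real.pi
  have ht := hd.tendsto_nhdsNE (by
    have : r ≠ 0 := hr.1.ne'
    simp [circleMap, this])
  refine ht.frequently (Eventually.frequently ?_)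
  have : Ioo (0 : ℝ) (2 * Real.pi) ∈ 𝓝[≠] Real.pi :=
    mem_nhdsWithin_of_mem_nhds (Ioo_mem_nhds pp (by linarith))
  filter_upwards [this] with θ hθ using h0 θ hθ

/-- A holomorphic function with zero Hardy norm vanishes on the bidisc. -/
lemma eq_zero_of_hardyNormSq (hf : DifferentiableOn ℂ f bidisc) (h0 : hardyNormSq f = 0) :
    ∀ z ∈ bidisc, f z = 0 := by
  have pp : (0 : ℝ) < 2 * Real.pi := by positivity
  -- vanishing on the tori
  have htor : ∀ r ∈ Ioo (0 : ℝ) 1, ∀ p ∈ Ioo (0 : ℝ) (2 * Real.pi) ×ˢ Ioo (0 : ℝ) (2 * Real.pi),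
      f (circleMap 0 r p.1, circleMap 0 r p.2) = 0 := by
    intro r hr p hp
    have hm : hardyMean f r = 0 := by
      have := le_iSup (fun r : Ioo (0 : ℝ) 1 => hardyMean f r) ⟨r, hr⟩
      exact le_antisymm (this.trans h0.le) bot_le
    rw [hardyMean_eq hf hr] at hm
    simp only [mul_one] at hm
    rw [lintegral_eq_zero_iff ((continuous_torus hf hr hr).measurable.enorm.pow_const 2)] at hm
    have hc0 : (ENNReal.ofReal (2 * Real.pi))⁻¹ ≠ 0 := ENNReal.inv_ne_zero.2 ENNReal.ofReal_ne_top
    have hac : (volume : Measure ℝ).restrict (Ioo 0 (2 * Real.pi)) ≪ angle :=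
      (Measure.absolutelyContinuous_of_le (Measure.restrict_mono Ioo_subset_Ioc_self le_rfl)).trans
        (Measure.absolutelyContinuous_smul hc0)
    have hm2 := (hac.prod hac).ae_eq hm
    rw [Measure.prod_restrict] at hm2
    have hm3 : (fun p : ℝ × ℝ => f (circleMap 0 r p.1, circleMap 0 r p.2)) =ᵐ[
        (volume : Measure (ℝ × ℝ)).restrict (Ioo 0 (2 * Real.pi) ×ˢ Ioo 0 (2 * Real.pi))] 0 := by
      filter_upwards [hm2] with q hq
      simpa using hq
    exact Measure.eqOn_open_of_ae_eq hm3 (isOpen_Ioo.prod isOpen_Ioo)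
      (continuous_torus hf hr hr).continuousOn continuousOn_const hp
  rintro ⟨a, b⟩ ⟨ha, hb⟩
  have hr : (1 / 2 : ℝ) ∈ Ioo (0 : ℝ) 1 := by norm_num
  refine eq_zero_of_circle (differentiableOn_slice' (F := fun a b => f (a, b)) hf ha) hr
    (fun θ₂ h₂ => ?_) (show b ∈ ball (0 : ℂ) 1 by simpa using hb)
  exact eq_zero_of_circle (differentiableOn_slice (F := fun a b => f (a, b)) hf
    (circleMap_mem hr θ₂)) hr (fun θ₁ h₁ => htor _ hr (θ₁, θ₂) ⟨h₁, h₂⟩)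
    (show a ∈ ball (0 : ℂ) 1 by simpa using ha)

end Hardy

lemma iSup_parallelogram {a b c d : Ioo (0 : ℝ) 1 → ℝ≥0∞} (ha : Monotone a) (hb : Monotone b)
    (hc : Monotone c) (hd : Monotone d) (h : ∀ r, a r + b r = 2 * c r + 2 * d r) :
    iSup a + iSup b = 2 * iSup c + 2 * iSup d := by
  rw [ENNReal.iSup_add_iSup_of_monotone ha hb, ENNReal.mul_iSup, ENNReal.mul_iSup,
    ENNReal.iSup_add_iSup_of_monotone (hc.const_mul' 2) (hd.const_mul' 2)]
  exact iSup_congr h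

lemma iSup_add_sq_le {a c d : Ioo (0 : ℝ) 1 → ℝ≥0∞} {k l : ℝ≥0∞}
    (h : ∀ r, a r ≤ k * c r + l * d r) : iSup a ≤ k * iSup c + l * iSup d :=
  iSup_le fun r => (h r).trans (by gcongr <;> exact le_iSup _ r)

section Norm

variable (μ₁ μ₂ : Measure (closedBall (0 : ℂ) 1)) [IsFiniteMeasure μ₁] [IsFiniteMeasure μ₂]
variable {f g : ℂ × ℂ → ℂ}

lemma differentiableOn_swap (hf : DifferentiableOn ℂ f bidisc) :
    DifferentiableOn ℂ (fun p : ℂ × ℂ => f (p.2, p.1)) bidisc := by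
  have : DifferentiableOn ℂ (fun p : ℂ × ℂ => (p.2, p.1)) bidisc := by fun_prop
  exact hf.comp this fun p hp => ⟨hp.2, hp.1⟩

lemma normSq_parallelogram (hf : DifferentiableOn ℂ f bidisc) (hg : DifferentiableOn ℂ g bidisc) :
    normSq μ₁ μ₂ (f + g) + normSq μ₁ μ₂ (f - g) = 2 * normSq μ₁ μ₂ f + 2 * normSq μ₁ μ₂ g := by
  have h1 : hardyNormSq (f + g) + hardyNormSq (f - g) = 2 * hardyNormSq f + 2 * hardyNormSq g := by
    refine iSup_parallelogram (hardyMean_mono (hf.add hg)) (hardyMean_mono (hf.sub hg))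
      (hardyMean_mono hf) (hardyMean_mono hg) fun r => ?_
    rw [hardyMean_eq hf r.2, hardyMean_eq hg r.2, hardyMean_eq (hf.add hg) r.2,
      hardyMean_eq (hf.sub hg) r.2]
    exact lintegral_parallelogram aemeasurable_const
      (continuous_torus hf r.2 r.2).measurable.aemeasurable
      (continuous_torus hg r.2 r.2).measurable.aemeasurable
  have key : ∀ (μ : Measure (closedBall (0 : ℂ) 1)) [IsFiniteMeasure μ] (F H : ℂ → ℂ → ℂ),
      DifferentiableOn ℂ (fun p : ℂ × ℂ => F p.1 p.2) bidisc →
      DifferentiableOn ℂ (fun p : ℂ × ℂ => H p.1 p.2) bidisc →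
      (⨆ r : Ioo (0 : ℝ) 1, dirichletMean μ (fun z e => F z e + H z e) r) +
        (⨆ r : Ioo (0 : ℝ) 1, dirichletMean μ (fun z e => F z e - H z e) r) =
      2 * (⨆ r : Ioo (0 : ℝ) 1, dirichletMean μ F r) +
        2 * ⨆ r : Ioo (0 : ℝ) 1, dirichletMean μ H r := fun μ _ F H hF hH =>
    iSup_parallelogram (dirichletMean_mono μ (hF.add hH)) (dirichletMean_mono μ (hF.sub hH))
      (dirichletMean_mono μ hF) (dirichletMean_mono μ hH)
      fun r => dirichletMean_parallelogram μ hF hH r.2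
  have h2 := key μ₁ (fun z e => f (z, e)) (fun z e => g (z, e)) hf hg
  have h3 := key μ₂ (fun z e => f (e, z)) (fun z e => g (e, z)) (differentiableOn_swap hf)
    (differentiableOn_swap hg)
  have e : ∀ a b c d e' f' : ℝ≥0∞, a + (b + c) + (d + (e' + f')) = (a + d) + (b + e') + (c + f') := by
    intros; ring
  unfold normSq dirichletIntegral
  rw [e]
  refine (congrArg₂ (· + ·) (congrArg₂ (· + ·) h1 h2) h3).trans ?_
  ring

lemma normSq_add_le (hf : DifferentiableOn ℂ f bidisc) (hg : DifferentiableOn ℂ g bidisc)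
    (t : ℝ≥0) (ht : t ≠ 0) :
    normSq μ₁ μ₂ (f + g) ≤ ↑(1 + t) * normSq μ₁ μ₂ f + ↑(1 + t⁻¹) * normSq μ₁ μ₂ g := by
  have h1 : hardyNormSq (f + g) ≤ ↑(1 + t) * hardyNormSq f + ↑(1 + t⁻¹) * hardyNormSq g := by
    refine iSup_add_sq_le fun r => ?_
    rw [hardyMean_eq hf r.2, hardyMean_eq hg r.2, hardyMean_eq (hf.add hg) r.2]
    exact lintegral_add_sq_le aemeasurable_const
      (continuous_torus hf r.2 r.2).measurable.aemeasurable
      (continuous_torus hg r.2 r.2).measurable.aemeasurable t ht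
  have h2 := iSup_add_sq_le fun r : Ioo (0 : ℝ) 1 =>
    dirichletMean_add_le μ₁ (F := fun z e => f (z, e)) (H := fun z e => g (z, e)) hf hg r.2 t ht
  have h3 := iSup_add_sq_le fun r : Ioo (0 : ℝ) 1 =>
    dirichletMean_add_le μ₂ (F := fun z e => f (e, z)) (H := fun z e => g (e, z))
      (differentiableOn_swap hf) (differentiableOn_swap hg) r.2 t ht
  unfold normSq dirichletIntegral
  refine (add_le_add h1 (add_le_add h2 h3)).trans (le_of_eq ?_)
  ring

lemma normSq_smul (hf : DifferentiableOn ℂ f bidisc) (c : ℂ) :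
    normSq μ₁ μ₂ (c • f) = ‖c‖ₑ ^ 2 * normSq μ₁ μ₂ f := by
  have h1 : hardyNormSq (c • f) = ‖c‖ₑ ^ 2 * hardyNormSq f := by
    unfold hardyNormSq
    rw [ENNReal.mul_iSup]
    refine iSup_congr fun r => ?_
    rw [hardyMean_eq hf r.2, hardyMean_eq (hf.const_smul c) r.2]
    exact lintegral_smul_sq aemeasurable_const
      (continuous_torus hf r.2 r.2).measurable.aemeasurable c
  have key : ∀ (μ : Measure (closedBall (0 : ℂ) 1)) [IsFiniteMeasure μ] (F : ℂ → ℂ → ℂ),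
      DifferentiableOn ℂ (fun p : ℂ × ℂ => F p.1 p.2) bidisc →
      (⨆ r : Ioo (0 : ℝ) 1, dirichletMean μ (fun z e => c * F z e) r) =
        ‖c‖ₑ ^ 2 * ⨆ r : Ioo (0 : ℝ) 1, dirichletMean μ F r := fun μ _ F hF => by
    rw [ENNReal.mul_iSup]
    exact iSup_congr fun r => dirichletMean_const_mul μ hF r.2 c
  have h2 := key μ₁ (fun z e => f (z, e)) hf
  have h3 := key μ₂ (fun z e => f (e, z)) (differentiableOn_swap hf)
  unfold normSq dirichletIntegral
  refine (congrArg₂ (· + ·) h1 (congrArg₂ (· + ·) h2 h3)).trans ?_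
  ring

/-- The functions in the Dirichlet-type space: holomorphic functions on the bidisc (extended by
zero to `ℂ²`, so that two of them are equal if and only if they agree on the bidisc) which lie in
the Hardy space and have a finite Dirichlet integral. -/
def dirichletSubmodule : Submodule ℂ (ℂ × ℂ → ℂ) where
  carrier := {f | DifferentiableOn ℂ f bidisc ∧ (∀ z ∉ bidisc, f z = 0) ∧
    hardyNormSq f < ⊤ ∧ dirichletIntegral μ₁ μ₂ f < ⊤}
  add_mem' := by
    rintro f g ⟨hf, hf0, hf1, hf2⟩ ⟨hg, hg0, hg1, hg2⟩
    have h := normSq_add_le μ₁ μ₂ hf hg 1 one_ne_zero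
    have hlt : normSq μ₁ μ₂ (f + g) < ⊤ := h.trans_lt (ENNReal.add_lt_top.2
      ⟨ENNReal.mul_lt_top ENNReal.coe_lt_top (ENNReal.add_lt_top.2 ⟨hf1, hf2⟩),
        ENNReal.mul_lt_top ENNReal.coe_lt_top (ENNReal.add_lt_top.2 ⟨hg1, hg2⟩)⟩)
    have := ENNReal.add_lt_top.1 hlt
    exact ⟨hf.add hg, fun z hz => by simp [hf0 z hz, hg0 z hz], this.1, this.2⟩
  zero_mem' := by
    have h := normSq_smul μ₁ μ₂ (f := 0) (differentiableOn_const 0) 0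
    rw [zero_smul, enorm_zero, zero_pow two_ne_zero, zero_mul] at h
    have := ENNReal.add_lt_top.1 (h.trans_lt ENNReal.zero_lt_top)
    exact ⟨differentiableOn_const 0, fun _ _ => rfl, this.1, this.2⟩
  smul_mem' := by
    rintro c f ⟨hf, hf0, hf1, hf2⟩
    have hlt : normSq μ₁ μ₂ (c • f) < ⊤ := by
      rw [normSq_smul μ₁ μ₂ hf]
      exact ENNReal.mul_lt_top (by simp) (ENNReal.add_lt_top.2 ⟨hf1, hf2⟩)
    have := ENNReal.add_lt_top.1 hlt
    exact ⟨hf.const_smul c, fun z hz => by simp [hf0 z hz], this.1, this.2⟩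

/-- The Dirichlet-type space `𝓓(μ₁, μ₂)`, as a type. -/
def DirichletSpace : Type := dirichletSubmodule μ₁ μ₂

namespace DirichletSpace

instance : AddCommGroup (DirichletSpace μ₁ μ₂) :=
  inferInstanceAs (AddCommGroup (dirichletSubmodule μ₁ μ₂))

instance : Module ℂ (DirichletSpace μ₁ μ₂) :=
  inferInstanceAs (Module ℂ (dirichletSubmodule μ₁ μ₂))

instance : CoeFun (DirichletSpace μ₁ μ₂) fun _ => ℂ × ℂ → ℂ where
  coe f := f.1

/-- `‖f‖ = (‖f‖²_{H²} + 𝓓_{μ₁, μ₂}(f)) ^ (1 / 2)`. -/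
instance : Norm (DirichletSpace μ₁ μ₂) where
  norm f := Real.sqrt (normSq μ₁ μ₂ f).toReal

variable {μ₁ μ₂}

lemma normSq_ne_top (f : DirichletSpace μ₁ μ₂) : normSq μ₁ μ₂ f ≠ ⊤ :=
  (ENNReal.add_lt_top.2 ⟨f.2.2.2.1, f.2.2.2.2⟩).ne

lemma norm_sq (f : DirichletSpace μ₁ μ₂) : ‖f‖ ^ 2 = (normSq μ₁ μ₂ f).toReal :=
  Real.sq_sqrt ENNReal.toReal_nonneg

lemma norm_def_nonneg (f : DirichletSpace μ₁ μ₂) : 0 ≤ ‖f‖ := Real.sqrt_nonneg _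

lemma norm_add_sq_le (f g : DirichletSpace μ₁ μ₂) {t : ℝ} (ht : 0 < t) :
    ‖f + g‖ ^ 2 ≤ (1 + t) * ‖f‖ ^ 2 + (1 + t⁻¹) * ‖g‖ ^ 2 := by
  have h := normSq_add_le μ₁ μ₂ f.2.1 g.2.1 ⟨t, ht.le⟩
    (fun h => ht.ne' (congrArg NNReal.toReal h))
  have h' := ENNReal.toReal_mono (ENNReal.add_ne_top.2
    ⟨ENNReal.mul_ne_top ENNReal.coe_ne_top (normSq_ne_top f),
      ENNReal.mul_ne_top ENNReal.coe_ne_top (normSq_ne_top g)⟩) h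
  rw [ENNReal.toReal_add (ENNReal.mul_ne_top ENNReal.coe_ne_top (normSq_ne_top f))
    (ENNReal.mul_ne_top ENNReal.coe_ne_top (normSq_ne_top g)), ENNReal.toReal_mul,
    ENNReal.toReal_mul] at h'
  rw [norm_sq, norm_sq, norm_sq]
  exact h'

lemma normCore : NormedSpace.Core ℂ (DirichletSpace μ₁ μ₂) where
  norm_nonneg := norm_def_nonneg
  norm_smul c f := by
    have h : ‖c • f‖ ^ 2 = (‖c‖ * ‖f‖) ^ 2 := by
      rw [mul_pow, norm_sq, norm_sq]
      have := congrArg ENNReal.toReal (normSq_smul μ₁ μ₂ f.2.1 c)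
      rw [ENNReal.toReal_mul, ENNReal.toReal_pow, toReal_enorm] at this
      exact this
    exact (pow_left_inj₀ (norm_def_nonneg _)
      (mul_nonneg (norm_nonneg c) (norm_def_nonneg f)) two_ne_zero).1 h
  norm_triangle f g := by
    have hf := norm_def_nonneg f
    have hg := norm_def_nonneg g
    -- optimize over `t`
    refine le_of_forall_pos_le_add fun ε hε => ?_
    have ha : 0 < ‖f‖ + ε / 2 := by positivity
    have hb : 0 < ‖g‖ + ε / 2 := by positivity
    have h := norm_add_sq_le f g (div_pos hb ha)
    refine (pow_le_pow_iff_left₀ (norm_def_nonneg _) (by positivity) two_ne_zero).1 (h.trans ?_)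
    have h1 : (1 + (‖g‖ + ε / 2) / (‖f‖ + ε / 2)) * ‖f‖ ^ 2 ≤
        (1 + (‖g‖ + ε / 2) / (‖f‖ + ε / 2)) * (‖f‖ + ε / 2) ^ 2 := by
      gcongr
      linarith
    have h2 : (1 + ((‖g‖ + ε / 2) / (‖f‖ + ε / 2))⁻¹) * ‖g‖ ^ 2 ≤
        (1 + ((‖g‖ + ε / 2) / (‖f‖ + ε / 2))⁻¹) * (‖g‖ + ε / 2) ^ 2 := by
      gcongr
      linarith
    refine (add_le_add h1 h2).trans (le_of_eq ?_)
    field_simp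
    ring
  norm_eq_zero_iff f := by
    constructor
    · intro h
      have h0 : normSq μ₁ μ₂ f = 0 := by
        have := norm_sq f
        rw [h, zero_pow two_ne_zero] at this
        exact ((ENNReal.toReal_eq_zero_iff _).1 this.symm).resolve_right (normSq_ne_top f)
      have hz := eq_zero_of_hardyNormSq f.2.1 (add_eq_zero.1 h0).1
      refine Subtype.ext (funext fun z => ?_)
      by_cases hb : z ∈ bidisc
      · exact hz z hb
      · exact f.2.2.1 z hb
    · rintro rfl
      have h := normSq_smul μ₁ μ₂ (f := 0) (differentiableOn_const 0) 0
      rw [zero_smul, enorm_zero, zero_pow two_ne_zero, zero_mul] at h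
      have : ‖(0 : DirichletSpace μ₁ μ₂)‖ ^ 2 = 0 := by
        rw [norm_sq]
        exact (congrArg ENNReal.toReal h).trans ENNReal.toReal_zero
      exact pow_eq_zero_iff two_ne_zero |>.1 this

instance : NormedAddCommGroup (DirichletSpace μ₁ μ₂) := NormedAddCommGroup.ofCore normCore

instance : NormedSpace ℂ (DirichletSpace μ₁ μ₂) := NormedSpace.ofCore normCore

/-- The inner product of `𝓓(μ₁, μ₂)`, conjugate-linear in the first variable, determined by the
norm through polarization. -/
instance : InnerProductSpace ℂ (DirichletSpace μ₁ μ₂) :=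
  InnerProductSpace.ofNorm ℂ fun f g => by
    have h : (normSq μ₁ μ₂ (f + g : DirichletSpace μ₁ μ₂) +
        normSq μ₁ μ₂ (f - g : DirichletSpace μ₁ μ₂)).toReal =
        (2 * normSq μ₁ μ₂ f + 2 * normSq μ₁ μ₂ g).toReal :=
      congrArg ENNReal.toReal (normSq_parallelogram μ₁ μ₂ f.2.1 g.2.1)
    rw [ENNReal.toReal_add (normSq_ne_top (f + g)) (normSq_ne_top (f - g)),
      ENNReal.toReal_add (ENNReal.mul_ne_top ENNReal.ofNat_ne_top (normSq_ne_top f))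
        (ENNReal.mul_ne_top ENNReal.ofNat_ne_top (normSq_ne_top g)),
      ENNReal.toReal_mul, ENNReal.toReal_mul] at h
    have h' : ‖f + g‖ ^ 2 + ‖f - g‖ ^ 2 = 2 * ‖f‖ ^ 2 + 2 * ‖g‖ ^ 2 := by
      rw [norm_sq, norm_sq, norm_sq, norm_sq]
      exact h
    linarith

end DirichletSpace

end Norm

/-- The joint kernel `ker (T - w) = ker (T₁ - w₁) ∩ ker (T₂ - w₂)` of a pair of bounded operators
`T = (T₁, T₂)` at a point `w = (w₁, w₂)`. -/
def jointKer {E : Type*} [NormedAddCommGroup E] [InnerProductSpace ℂ E] (T₁ T₂ : E →L[ℂ] E)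
    (w : ℂ × ℂ) : Submodule ℂ E :=
  (T₁ - w.1 • ContinuousLinearMap.id ℂ E).ker ⊓ (T₂ - w.2 • ContinuousLinearMap.id ℂ E).ker

end Bidisc

end

noncomputable section

namespace Bidisc

open MeasureTheory Metric Set Filter Topology
open scoped ENNReal NNReal ComplexConjugate

/-! The analytic core is that `U_μ dA` is a Carleson measure: `∫ |h|² U_μ dA ≤ 24 μ(closed disc)
‖h‖²` for `h` in the Hardy space of the disc (`lintegral_potential_le`). By Tonelli it suffices to
bound each kernel uniformly in its pole `ζ`. Up to a factor 4 the kernel is at most `(1 - |z|²) / |1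
- conj ζ z|²`, plus a term of order `(1 - |z|²) / (d |z - ζ|)` supported in the ball of radius `d =
1 - |ζ|²` about `ζ` (`potentialKernel_le`). For the first term the denominator is absorbed into `h`;
the Taylor coefficients of `h / (1 - conj ζ z)` are dominated by partial sums of those of `h`, and
Hardy's inequality applies. For the second, the growth bound `|h(z)|² ≤ ‖h‖² / (1 - |z|²)` leaves `∫
1/|z - ζ|`, which is proportional to `d`.

With this embedding, the term `f` in `∂₁(z₁ f) = f + z₁ ∂₁f` is harmless, so the coordinate
multiplications are bounded. The same embedding gives division: if `f` vanishes on `z₁ = ξ`, then `f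
/ (z₁ - ξ)` stays in the space, by the quotient rule away from `ξ` and by Cauchy's estimate near `ξ`
(`normSq_quotientFst_lt_top`). Completeness comes from locally uniform bounds on point evaluations,
Osgood's lemma and Fatou's lemma; the kernel is then given by Riesz representation.

The joint kernel of the multiplications is zero because `(z₁ - w₁) f = 0` forces `f = 0`. For the
adjoints put `l = conj w`. Freezing the first variable and dividing twice solves Gleason's problem:
`f = f(l) + (z₁ - l₁) p + (z₂ - l₂) q` (`exists_gleason`). A joint eigenvector of the adjoints is
orthogonal to the ranges of `M₁ - l₁` and `M₂ - l₂`, so its pairing with `f` depends only on `f(l)`;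
hence it is a multiple of `κ(·, l)`. -/

/-! ### Parseval's identity and the Hardy space of the disc. -/

/-- Pythagoras for finite sums passes to the limit by continuity of the norm. -/
lemma _root_.Orthonormal.hasSum_norm_sq {ι E : Type*} [NormedAddCommGroup E] [InnerProductSpace ℂ E]
    {e : ι → E} (he : Orthonormal ℂ e) {c : ι → ℂ} {x : E} (hx : HasSum (fun i => c i • e i) x) :
    HasSum (fun i => ‖c i‖ ^ 2) (‖x‖ ^ 2) := by
  have h : Tendsto (fun s : Finset ι => ‖∑ i ∈ s, c i • e i‖ ^ 2) atTop (𝓝 (‖x‖ ^ 2)) :=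
    (Tendsto.norm hx).pow 2
  refine h.congr fun s => ?_
  have h1 := he.inner_sum c c s
  rw [inner_self_eq_norm_sq_to_K] at h1
  simp only [Complex.conj_mul'] at h1
  exact Complex.ofReal_injective (by push_cast at h1 ⊢; exact h1)

instance : Fact (0 < 2 * Real.pi) := ⟨by positivity⟩

lemma lintegral_angle (F : AddCircle (2 * Real.pi) → ℝ≥0∞) :
    ∫⁻ θ : ℝ, F θ ∂angle = ∫⁻ x, F x ∂AddCircle.haarAddCircle := by
  have h := AddCircle.lintegral_preimage (2 * Real.pi) 0 F
  rw [zero_add] at h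
  have h0 : ENNReal.ofReal (2 * Real.pi) ≠ 0 := by simp [Real.pi_pos]
  rw [angle, lintegral_smul_measure, h, AddCircle.volume_eq_smul_haarAddCircle,
    lintegral_smul_measure, smul_eq_mul, smul_eq_mul, ← mul_assoc,
    ENNReal.inv_mul_cancel h0 ENNReal.ofReal_ne_top, one_mul]

/-- The square mean of `h` over the circle of radius `r`. -/
def circleMean (h : ℂ → ℂ) (r : ℝ) : ℝ≥0∞ := ∫⁻ θ, ‖h (circleMap 0 r θ)‖ₑ ^ 2 ∂angle

/-- Parseval's identity for a power series on a circle. -/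
lemma circleMean_eq_tsum {h : ℂ → ℂ} {a : ℕ → ℂ} {r : ℝ} (hr : 0 ≤ r)
    (hs : Summable fun n => ‖a n‖ * r ^ n)
    (hh : ∀ θ : ℝ, HasSum (fun n => a n * circleMap 0 r θ ^ n) (h (circleMap 0 r θ))) :
    circleMean h r = ∑' n, ‖a n‖ₑ ^ 2 * ENNReal.ofReal r ^ (2 * n) := by
  -- Absolute convergence makes the Fourier series converge uniformly. Its continuous sum `H` is the
  -- restriction of `h` to the circle, and its image in `L²` is an orthonormal expansion.
  have hsum : Summable fun n : ℕ => (a n * (r : ℂ) ^ n) • (fourier (n : ℤ) :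
      C(AddCircle (2 * Real.pi), ℂ)) := by
    refine Summable.of_norm ?_
    simpa [norm_smul, fourier_norm, abs_of_nonneg hr] using hs
  obtain ⟨H, hH⟩ := hsum
  have hval : ∀ θ : ℝ, H (θ : AddCircle (2 * Real.pi)) = h (circleMap 0 r θ) := by
    intro θ
    have h1 := (ContinuousMap.evalCLM ℂ (θ : AddCircle (2 * Real.pi))).hasSum hH
    refine h1.unique ((hh θ).congr_fun fun n => ?_)
    simp only [ContinuousMap.evalCLM_apply, ContinuousMap.smul_apply, smul_eq_mul, fourier_coe_apply,
      circleMap, zero_add, mul_pow, ← Complex.exp_nat_mul, mul_assoc]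
    congr 3
    have hp : (Real.pi : ℂ) ≠ 0 := by exact_mod_cast Real.pi_ne_zero
    push_cast
    field_simp
  have h2 := (ContinuousMap.toLp (E := ℂ) 2 (@AddCircle.haarAddCircle (2 * Real.pi) _) ℂ).hasSum hH
  simp only [map_smul] at h2
  have h3 : HasSum (fun n : ℕ => ‖a n * (r : ℂ) ^ n‖ ^ 2) _ :=
    (orthonormal_fourier.comp (fun n : ℕ => (n : ℤ)) Nat.cast_injective).hasSum_norm_sq h2
  have h4 : circleMean h r = ENNReal.ofReal (‖ContinuousMap.toLp (E := ℂ) 2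
      (@AddCircle.haarAddCircle (2 * Real.pi) _) ℂ H‖ ^ 2) := by
    rw [ENNReal.ofReal_pow (norm_nonneg _), ofReal_norm, Lp.enorm_def,
      eLpNorm_congr_ae (ContinuousMap.coeFn_toLp _ H),
      eLpNorm_eq_lintegral_rpow_enorm_toReal two_ne_zero ENNReal.ofNat_ne_top]
    simp only [ENNReal.toReal_ofNat, ENNReal.rpow_ofNat, one_div]
    rw [← ENNReal.rpow_natCast, ← ENNReal.rpow_mul]
    simp only [Nat.cast_ofNat, ne_eq, OfNat.ofNat_ne_zero, not_false_eq_true, inv_mul_cancel₀,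
      ENNReal.rpow_one]
    rw [← lintegral_angle fun x => ‖H x‖ₑ ^ 2]
    simp only [hval, circleMean]
  rw [h4, ← h3.tsum_eq, ENNReal.ofReal_tsum_of_nonneg (fun n => by positivity) h3.summable]
  refine tsum_congr fun n => ?_
  rw [norm_mul, mul_pow, norm_pow, Complex.norm_real, Real.norm_of_nonneg hr, ← pow_mul,
    mul_comm n 2, ENNReal.ofReal_mul (by positivity), ENNReal.ofReal_pow (norm_nonneg _),
    ofReal_norm, ENNReal.ofReal_pow hr]

/-- `a` is the sequence of Taylor coefficients at `0` of the function `h` on the unit disc. -/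
def HasCoeff (h : ℂ → ℂ) (a : ℕ → ℂ) : Prop :=
  ∀ z ∈ ball (0 : ℂ) 1, HasSum (fun n => a n * z ^ n) (h z)

lemma exists_hasCoeff {h : ℂ → ℂ} (hh : DifferentiableOn ℂ h (ball 0 1)) : ∃ a, HasCoeff h a := by
  refine ⟨fun n => (n.factorial : ℂ)⁻¹ * iteratedDeriv n h 0, fun z hz => ?_⟩
  refine (Complex.hasSum_taylorSeries_on_ball hh hz).congr_fun fun n => ?_
  simp only [sub_zero, smul_eq_mul]
  ring

lemma HasCoeff.summable_norm {h : ℂ → ℂ} {a : ℕ → ℂ} (ha : HasCoeff h a) {z : ℂ} (hz : ‖z‖ < 1) :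
    Summable fun n => ‖a n * z ^ n‖ := (ha z (by simpa using hz)).summable.norm

lemma HasCoeff.circleMean_eq {h : ℂ → ℂ} {a : ℕ → ℂ} (ha : HasCoeff h a) {r : ℝ}
    (hr : r ∈ Ioo (0 : ℝ) 1) :
    circleMean h r = ∑' n, ‖a n‖ₑ ^ 2 * ENNReal.ofReal r ^ (2 * n) := by
  refine circleMean_eq_tsum hr.1.le ?_ fun θ => ha _ (by simpa using circleMap_mem hr θ)
  simpa [abs_of_pos hr.1] using ha.summable_norm (z := r) (by simpa [abs_of_pos hr.1] using hr.2)

/-- A sequence of radii increasing to `1`. -/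
def radius (n : ℕ) : ℝ := 1 - 1 / (n + 2)

lemma radius_mem (n : ℕ) : radius n ∈ Ioo (0 : ℝ) 1 := by
  have h : (1 : ℝ) / (n + 2) < 1 := by rw [div_lt_one (by positivity)]; linarith [n.cast_nonneg (α := ℝ)]
  have h' : (0 : ℝ) < 1 / (n + 2) := by positivity
  exact ⟨by unfold radius; linarith, by unfold radius; linarith⟩

lemma monotone_radius : Monotone radius := by
  intro m n h
  unfold radius
  gcongr

lemma tendsto_radius : Tendsto radius atTop (𝓝 1) := by
  have h : Tendsto (fun n : ℕ => 1 / ((n : ℝ) + 2)) atTop (𝓝 0) := by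
    refine (tendsto_const_nhds (x := (1 : ℝ))).div_atTop ?_
    exact tendsto_atTop_add_const_right _ _ tendsto_natCast_atTop_atTop
  have h1 := h.const_sub (1 : ℝ)
  rw [sub_zero] at h1
  exact h1

/-- The square of the Hardy norm on the disc. -/
def discNormSq (h : ℂ → ℂ) : ℝ≥0∞ := ⨆ n, circleMean h (radius n)

lemma circleMean_mono {h : ℂ → ℂ} (hh : DifferentiableOn ℂ h (ball 0 1)) {r s : ℝ} (hr : 0 < r)
    (hrs : r ≤ s) (hs : s < 1) : circleMean h r ≤ circleMean h s := circle_mean_mono hh hr hrs hs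

/-- Parseval on the circles of radius `radius m`; on a finite partial sum the radius can tend to 1
term by term. -/
lemma HasCoeff.tsum_le {h : ℂ → ℂ} {a : ℕ → ℂ} (ha : HasCoeff h a) :
    ∑' n, ‖a n‖ₑ ^ 2 ≤ discNormSq h := by
  rw [ENNReal.tsum_eq_iSup_sum]
  refine iSup_le fun s => ?_
  have h1 : Tendsto (fun m => ∑ n ∈ s, ‖a n‖ₑ ^ 2 * ENNReal.ofReal (radius m) ^ (2 * n)) atTop
      (𝓝 (∑ n ∈ s, ‖a n‖ₑ ^ 2 * ENNReal.ofReal 1 ^ (2 * n))) := by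
    refine tendsto_finsetSum _ fun n _ => ENNReal.Tendsto.const_mul
      (ENNReal.Tendsto.pow (ENNReal.tendsto_ofReal tendsto_radius)) (Or.inr ?_)
    simp
  simp only [ENNReal.ofReal_one, one_pow, mul_one] at h1
  refine le_of_tendsto' h1 fun m => ?_
  calc _ ≤ ∑' n, ‖a n‖ₑ ^ 2 * ENNReal.ofReal (radius m) ^ (2 * n) := ENNReal.sum_le_tsum _
    _ = circleMean h (radius m) := (ha.circleMean_eq (radius_mem m)).symm
    _ ≤ discNormSq h := le_iSup (fun m => circleMean h (radius m)) m

/-- The growth estimate for functions in the Hardy space of the disc. -/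
lemma enorm_sq_le_discNormSq {h : ℂ → ℂ} (hh : DifferentiableOn ℂ h (ball 0 1)) {z : ℂ}
    (hz : ‖z‖ < 1) : ‖h z‖ₑ ^ 2 ≤ ENNReal.ofReal (1 - ‖z‖ ^ 2)⁻¹ * discNormSq h := by
  obtain ⟨a, ha⟩ := exists_hasCoeff hh
  have hz2 : ‖z‖ ^ 2 < 1 := by nlinarith [norm_nonneg z]
  rcases eq_or_ne (discNormSq h) ⊤ with ht | ht
  · rw [ht, ENNReal.mul_top]
    · exact le_top
    · simpa using hz2
  have hsE : ∑' n, ‖a n‖ₑ ^ 2 ≠ ⊤ := ne_top_of_le_ne_top ht ha.tsum_le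
  have hs2 : Summable fun n => ‖a n‖ ^ 2 := by
    have := ENNReal.summable_toReal hsE
    simpa using this
  have hg2 : HasSum (fun n => (‖z‖ ^ n) ^ 2) (1 - ‖z‖ ^ 2)⁻¹ := by
    have := hasSum_geometric_of_lt_one (by positivity) hz2
    simpa only [← pow_mul, mul_comm 2] using this
  -- Cauchy–Schwarz against the geometric sequence, whose squares sum to `(1 - ‖z‖²)⁻¹`.
  have hcs : ∑' n, ‖a n * z ^ n‖ ≤ √(∑' n, ‖a n‖ ^ 2) * √(∑' n, (‖z‖ ^ n) ^ 2) := by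
    simp only [norm_mul, norm_pow]
    have := Real.inner_le_Lp_mul_Lq_tsum_of_nonneg (p := 2) (q := 2)
      (f := fun n => ‖a n‖) (g := fun n => ‖z‖ ^ n) Real.HolderConjugate.two_two
      (fun n => norm_nonneg _) (fun n => by positivity) (by simpa using hs2)
      (by simpa using hg2.summable)
    simpa [Real.sqrt_eq_rpow] using this
  have h1 : ‖h z‖ ^ 2 ≤ (1 - ‖z‖ ^ 2)⁻¹ * ∑' n, ‖a n‖ ^ 2 := by
    have h2 : ‖h z‖ ≤ √(∑' n, ‖a n‖ ^ 2) * √(∑' n, (‖z‖ ^ n) ^ 2) := by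
      rw [← (ha z (by simpa using hz)).tsum_eq]
      exact (norm_tsum_le_tsum_norm (ha.summable_norm hz)).trans hcs
    calc ‖h z‖ ^ 2 ≤ (√(∑' n, ‖a n‖ ^ 2) * √(∑' n, (‖z‖ ^ n) ^ 2)) ^ 2 := by gcongr
      _ = _ := by
        rw [mul_pow, Real.sq_sqrt (tsum_nonneg fun n => by positivity),
          Real.sq_sqrt (tsum_nonneg fun n => by positivity), hg2.tsum_eq, mul_comm]
  calc ‖h z‖ₑ ^ 2 = ENNReal.ofReal (‖h z‖ ^ 2) := by
        rw [ENNReal.ofReal_pow (norm_nonneg _), ofReal_norm]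
    _ ≤ ENNReal.ofReal ((1 - ‖z‖ ^ 2)⁻¹ * ∑' n, ‖a n‖ ^ 2) := ENNReal.ofReal_le_ofReal h1
    _ = ENNReal.ofReal (1 - ‖z‖ ^ 2)⁻¹ * ∑' n, ‖a n‖ₑ ^ 2 := by
      rw [ENNReal.ofReal_mul (inv_nonneg.2 (by linarith)),
        ENNReal.ofReal_tsum_of_nonneg (fun n => by positivity) hs2]
      simp only [ENNReal.ofReal_pow (norm_nonneg _), ofReal_norm]
    _ ≤ _ := by gcongr; exact ha.tsum_le

/-! ### Hardy's inequality. -/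

/-- Hardy's inequality for finite sums. -/
lemma sum_sq_average_le (a : ℕ → ℝ) (N : ℕ) :
    ∑ n ∈ Finset.range N, ((∑ k ∈ Finset.range (n + 1), a k) / (n + 1)) ^ 2 +
      2 * ((∑ k ∈ Finset.range N, a k) ^ 2 / N) ≤ 4 * ∑ n ∈ Finset.range N, a n ^ 2 := by
  induction N with
  | zero => simp
  | succ N ih =>
    rw [Finset.sum_range_succ, Finset.sum_range_succ (fun n => a n ^ 2)]
    set A := ∑ k ∈ Finset.range N, a k with hA
    have hA' : ∑ k ∈ Finset.range (N + 1), a k = A + a N := Finset.sum_range_succ _ _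
    rw [hA']
    -- The extra term `2 A² / N` in the statement is what lets the induction close. With `s`, `t`
    -- the averages of the first `N + 1` and the first `N` terms, the right side minus the left is
    -- `(2 a N - s)² + 2 N (s - t)²`.
    have key : ((A + a N) / (N + 1)) ^ 2 + 2 * ((A + a N) ^ 2 / (N + 1 : ℕ)) ≤
        2 * (A ^ 2 / N) + 4 * a N ^ 2 := by
      -- For `N = 0` the quotient by `N` is zero and the claim reads `3 (a 0)² ≤ 4 (a 0)²`.
      rcases Nat.eq_zero_or_pos N with rfl | hN
      · have : A = 0 := by simp [hA]
        simp [this]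
        nlinarith [sq_nonneg (a 0)]
      · have hn : (0 : ℝ) < N := by exact_mod_cast hN
        push_cast
        obtain ⟨s, hs⟩ : ∃ s : ℝ, A + a N = s * (N + 1) := ⟨(A + a N) / (N + 1), by field_simp⟩
        obtain ⟨t, ht⟩ : ∃ t : ℝ, A = t * N := ⟨A / N, by field_simp⟩
        have hx : a N = s * (N + 1) - t * N := by linarith
        rw [hs, hx, ht]
        have e1 : s * ((N : ℝ) + 1) / (N + 1) = s := by field_simp
        have e2 : (s * ((N : ℝ) + 1)) ^ 2 / (N + 1) = s ^ 2 * (N + 1) := by field_simp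
        have e3 : (t * (N : ℝ)) ^ 2 / N = t ^ 2 * N := by field_simp
        rw [e1, e2, e3]
        nlinarith [sq_nonneg (2 * (s * (N + 1) - t * N) - s), mul_nonneg hn.le (sq_nonneg (s - t))]
    linarith

/-- Hardy's inequality. -/
lemma tsum_sq_average_le (a : ℕ → ℝ≥0∞) :
    ∑' n : ℕ, ((∑ k ∈ Finset.range (n + 1), a k) / (n + 1)) ^ 2 ≤ 4 * ∑' n, a n ^ 2 := by
  rcases eq_or_ne (∑' n, a n ^ 2) ⊤ with ht | ht
  · rw [ht, ENNReal.mul_top (by norm_num)]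
    exact le_top
  have hfin : ∀ n, a n ≠ ⊤ := fun n hn => by
    have := ENNReal.ne_top_of_tsum_ne_top ht n
    simp [hn] at this
  lift a to ℕ → ℝ≥0 using hfin
  refine ENNReal.tsum_le_of_sum_range_le fun N => ?_
  have h := (le_add_of_nonneg_right (by positivity)).trans (sum_sq_average_le (fun n => a n) N)
  have h' : (∑ n ∈ Finset.range N, ((∑ k ∈ Finset.range (n + 1), a k) / (n + 1)) ^ 2 : ℝ≥0) ≤
      4 * ∑ n ∈ Finset.range N, a n ^ 2 := by exact_mod_cast h
  calc ∑ n ∈ Finset.range N, ((∑ k ∈ Finset.range (n + 1), (a k : ℝ≥0∞)) / (n + 1)) ^ 2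
      = ((∑ n ∈ Finset.range N, ((∑ k ∈ Finset.range (n + 1), a k) / (n + 1)) ^ 2 : ℝ≥0) : ℝ≥0∞) := by
        push_cast
        refine Finset.sum_congr rfl fun n _ => ?_
        rw [ENNReal.coe_div (by positivity)]
        push_cast
        rfl
    _ ≤ ((4 * ∑ n ∈ Finset.range N, a n ^ 2 : ℝ≥0) : ℝ≥0∞) := by exact_mod_cast h'
    _ ≤ 4 * ∑' n, (a n : ℝ≥0∞) ^ 2 := by
      push_cast
      gcongr
      exact ENNReal.sum_le_tsum _

/-! ### Polar coordinates and the Poisson weights. -/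

/-- The angle in `polarCoord` runs over `(-π, π)`, while `angle` lives on `(0, 2π]`; both integrals
equal the one over the circle group. -/
lemma lintegral_angle_periodic {F : ℝ → ℝ≥0∞} (hF : Function.Periodic F (2 * Real.pi)) :
    ∫⁻ θ, F θ ∂angle =
      (ENNReal.ofReal (2 * Real.pi))⁻¹ * ∫⁻ θ in Ioo (-Real.pi) Real.pi, F θ := by
  have h1 := AddCircle.lintegral_preimage (2 * Real.pi) (-Real.pi) hF.lift
  have h0 := AddCircle.lintegral_preimage (2 * Real.pi) 0 hF.lift
  simp only [Function.Periodic.lift_coe] at h0 h1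
  rw [zero_add] at h0
  rw [show -Real.pi + 2 * Real.pi = Real.pi by ring] at h1
  rw [angle, lintegral_smul_measure, smul_eq_mul, h0, ← h1, restrict_Ioo_eq_restrict_Ioc]

/-- Integration over the disc in polar coordinates. -/
lemma lintegral_area {φ : ℂ → ℝ≥0∞} (hφ : Measurable ((ball (0 : ℂ) 1).indicator φ)) :
    ∫⁻ z, φ z ∂area =
      ∫⁻ r in Ioo (0 : ℝ) 1, ENNReal.ofReal (2 * r) * ∫⁻ θ, φ (circleMap 0 r θ) ∂angle := by
  have hsymm : ∀ p : ℝ × ℝ, Complex.polarCoord.symm p = circleMap 0 p.1 p.2 := fun p => by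
    rw [Complex.polarCoord_symm_apply, circleMap, zero_add, Complex.exp_mul_I,
      Complex.ofReal_cos, Complex.ofReal_sin]
  have hm : Measurable fun p : ℝ × ℝ => (ball (0 : ℂ) 1).indicator φ (circleMap 0 p.1 p.2) :=
    hφ.comp (by unfold circleMap; fun_prop)
  rw [area, lintegral_smul_measure, smul_eq_mul, ← lintegral_indicator measurableSet_ball,
    ← Complex.lintegral_comp_polarCoord_symm]
  simp only [hsymm, polarCoord_target, smul_eq_mul]
  rw [Measure.volume_eq_prod, ← Measure.prod_restrict, lintegral_prod _ (by fun_prop),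
    ← lintegral_const_mul _ (by fun_prop), ← lintegral_indicator measurableSet_Ioo,
    ← lintegral_indicator measurableSet_Ioi]
  refine lintegral_congr fun r => ?_
  by_cases hr : r ∈ Ioi (0 : ℝ)
  · rw [indicator_of_mem hr]
    have hr0 : (0 : ℝ) < r := hr
    by_cases hr1 : r < 1
    · rw [indicator_of_mem (show r ∈ Ioo (0 : ℝ) 1 from ⟨hr, hr1⟩)]
      have hmem : ∀ θ, circleMap 0 r θ ∈ ball (0 : ℂ) 1 := fun θ => by
        simpa using circleMap_mem ⟨hr, hr1⟩ θ
      simp only [indicator_of_mem (hmem _)]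
      rw [lintegral_angle_periodic (fun θ => by rw [periodic_circleMap])]
      have hm1 : Measurable fun θ => φ (circleMap 0 r θ) := by
        have := hm.comp (measurable_const.prodMk measurable_id : Measurable fun θ : ℝ => (r, θ))
        simpa only [Function.comp_def, indicator_of_mem (hmem _)] using this
      rw [lintegral_const_mul _ hm1, ← mul_assoc, ← mul_assoc]
      congr 1
      -- The normalizations match: `π⁻¹ r = 2 r / (2π)`.
      rw [← ENNReal.ofReal_inv_of_pos Real.pi_pos, ← ENNReal.ofReal_inv_of_pos (by positivity),
        ← ENNReal.ofReal_mul (by positivity), ← ENNReal.ofReal_mul (by positivity)]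
      congr 1
      field_simp
    · rw [indicator_of_notMem fun h => hr1 h.2]
      have hmem : ∀ θ, circleMap 0 r θ ∉ ball (0 : ℂ) 1 := fun θ => by
        simpa [abs_of_pos hr0] using not_lt.1 hr1
      simp [indicator_of_notMem (hmem _)]
  · rw [indicator_of_notMem hr, indicator_of_notMem fun h => hr h.1]

lemma measurable_indicator_ball {G : ℂ → ℂ} {w : ℂ → ℝ≥0∞} (hG : ContinuousOn G (ball 0 1))
    (hw : Measurable w) : Measurable ((ball (0 : ℂ) 1).indicator fun z => ‖G z‖ₑ ^ 2 * w z) := by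
  classical
  have h : (ball (0 : ℂ) 1).indicator (fun z => ‖G z‖ₑ ^ 2 * w z) =
      fun z => ‖(ball (0 : ℂ) 1).indicator G z‖ₑ ^ 2 * w z := by
    ext z
    by_cases hz : z ∈ ball (0 : ℂ) 1
    · simp only [indicator_of_mem hz]
    · simp [indicator_of_notMem hz]
  have h1 : Measurable ((ball (0 : ℂ) 1).indicator G) := by
    rw [← piecewise_eq_indicator]
    exact hG.measurable_piecewise continuousOn_const measurableSet_ball
  rw [h]
  exact (h1.enorm.pow_const 2).mul hw

/-- The exact value is `1 / ((n + 1)(n + 2))`. The slightly larger square is the form in which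
Hardy's inequality can be applied. -/
lemma lintegral_radial_le (n : ℕ) :
    ∫⁻ r in Ioo (0 : ℝ) 1, ENNReal.ofReal (2 * r) * ENNReal.ofReal (1 - r ^ 2) *
      ENNReal.ofReal r ^ (2 * n) ≤ ((n + 1 : ℝ≥0∞)⁻¹) ^ 2 := by
  have h1 : ∫⁻ r in Ioo (0 : ℝ) 1, ENNReal.ofReal (2 * r) * ENNReal.ofReal (1 - r ^ 2) *
      ENNReal.ofReal r ^ (2 * n) =
      ∫⁻ r in Ioo (0 : ℝ) 1, ENNReal.ofReal (2 * r ^ (2 * n + 1) - 2 * r ^ (2 * n + 3)) := by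
    refine setLIntegral_congr_fun measurableSet_Ioo fun r hr => ?_
    have h2 : (0 : ℝ) ≤ 1 - r ^ 2 := by nlinarith [hr.1, hr.2]
    rw [← ENNReal.ofReal_pow hr.1.le, ← ENNReal.ofReal_mul (by linarith [hr.1]),
      ← ENNReal.ofReal_mul (mul_nonneg (by linarith [hr.1]) h2)]
    congr 1
    ring
  have hint : IntervalIntegrable (fun r : ℝ => 2 * r ^ (2 * n + 1) - 2 * r ^ (2 * n + 3)) volume 0 1 :=
    Continuous.intervalIntegrable (by fun_prop) _ _
  rw [h1, ← ofReal_integral_eq_lintegral_ofReal]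
  · rw [← integral_Ioc_eq_integral_Ioo, ← intervalIntegral.integral_of_le zero_le_one,
      intervalIntegral.integral_sub (Continuous.intervalIntegrable (by fun_prop) _ _)
        (Continuous.intervalIntegrable (by fun_prop) _ _),
      intervalIntegral.integral_const_mul, intervalIntegral.integral_const_mul, integral_pow,
      integral_pow]
    have e : ((n + 1 : ℝ≥0∞)⁻¹) ^ 2 = ENNReal.ofReal (((n + 1 : ℝ)⁻¹) ^ 2) := by
      rw [ENNReal.ofReal_pow (by positivity), ENNReal.ofReal_inv_of_pos (by positivity),
        ENNReal.ofReal_add (by positivity) zero_le_one]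
      simp
    rw [e]
    refine ENNReal.ofReal_le_ofReal ?_
    push_cast
    have hn : (0 : ℝ) ≤ n := n.cast_nonneg
    rw [← sub_nonneg]
    have : ((n : ℝ) + 1)⁻¹ ^ 2 - (2 * ((1 ^ (2 * n + 1 + 1) - 0 ^ (2 * n + 1 + 1)) / (2 * n + 1 + 1)) -
        2 * ((1 ^ (2 * n + 3 + 1) - 0 ^ (2 * n + 3 + 1)) / (2 * n + 3 + 1))) =
        1 / ((n + 1) ^ 2 * (n + 2)) := by
      simp
      field_simp
      ring
    rw [this]
    positivity
  · exact (hint.1.mono_set Ioo_subset_Ioc_self)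
  · refine (ae_restrict_mem measurableSet_Ioo).mono fun r hr => ?_
    have : r ^ (2 * n + 3) = r ^ (2 * n + 1) * r ^ 2 := by ring
    have h3 : 0 < r ^ (2 * n + 1) := pow_pos hr.1 _
    have h2 : (0 : ℝ) ≤ 1 - r ^ 2 := by nlinarith [hr.1, hr.2]
    simp only [Pi.zero_apply]
    rw [this]
    nlinarith [mul_nonneg h3.le h2]

/-- Parseval on each circle, then integration in the radius term by term. The factor `1 - |z|²`
supplies the second power of `1 / (n + 1)`. -/
lemma HasCoeff.lintegral_le {G : ℂ → ℂ} {c : ℕ → ℂ} (hG : HasCoeff G c)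
    (hd : ContinuousOn G (ball 0 1)) :
    ∫⁻ z, ‖G z‖ₑ ^ 2 * ENNReal.ofReal (1 - ‖z‖ ^ 2) ∂area ≤ ∑' n : ℕ, (‖c n‖ₑ / (n + 1)) ^ 2 := by
  have h1 : ∀ r ∈ Ioo (0 : ℝ) 1, ENNReal.ofReal (2 * r) * ∫⁻ θ, ‖G (circleMap 0 r θ)‖ₑ ^ 2 *
      ENNReal.ofReal (1 - ‖circleMap 0 r θ‖ ^ 2) ∂angle =
      ∑' n, ‖c n‖ₑ ^ 2 * (ENNReal.ofReal (2 * r) * ENNReal.ofReal (1 - r ^ 2) *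
        ENNReal.ofReal r ^ (2 * n)) := by
    intro r hr
    simp only [norm_circleMap_zero, abs_of_pos hr.1]
    rw [lintegral_mul_const' _ _ ENNReal.ofReal_ne_top]
    have := hG.circleMean_eq hr
    unfold circleMean at this
    rw [this, mul_comm _ (ENNReal.ofReal (1 - r ^ 2)), ← mul_assoc, ← ENNReal.tsum_mul_left]
    refine tsum_congr fun n => ?_
    ring
  rw [lintegral_area (measurable_indicator_ball hd (by fun_prop)),
    setLIntegral_congr_fun measurableSet_Ioo h1, lintegral_tsum fun n => by fun_prop]
  refine ENNReal.tsum_le_tsum fun n => ?_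
  rw [lintegral_const_mul _ (by fun_prop), ENNReal.div_eq_inv_mul, mul_pow, mul_comm]
  gcongr
  exact lintegral_radial_le n

/-- A Cauchy product with the geometric series. Since `‖ξ‖ ≤ 1`, the new coefficients are dominated
by the partial sums of `‖a k‖`, the numerators in Hardy's inequality. -/
lemma HasCoeff.mul_geometric {h : ℂ → ℂ} {a : ℕ → ℂ} (ha : HasCoeff h a) {ξ : ℂ} (hξ : ‖ξ‖ ≤ 1) :
    HasCoeff (fun z => h z * (1 - ξ * z)⁻¹)
      fun n => ∑ kl ∈ Finset.HasAntidiagonal.antidiagonal n, a kl.1 * ξ ^ kl.2 := by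
  intro z hz
  have hz1 : ‖z‖ < 1 := by simpa using hz
  have hξz : ‖ξ * z‖ < 1 := by
    rw [norm_mul]
    exact (mul_le_of_le_one_left (norm_nonneg z) hξ).trans_lt hz1
  have h1 := ha.summable_norm hz1
  have h2 : Summable fun n => ‖(ξ * z) ^ n‖ := (hasSum_geometric_of_norm_lt_one hξz).summable.norm
  have h3 := tsum_mul_tsum_eq_tsum_sum_antidiagonal_of_summable_norm h1 h2
  rw [(ha z hz).tsum_eq, (hasSum_geometric_of_norm_lt_one hξz).tsum_eq] at h3
  have h4 := (summable_norm_sum_mul_antidiagonal_of_summable_norm h1 h2).of_norm.hasSum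
  rw [← h3] at h4
  refine h4.congr_fun fun n => ?_
  rw [Finset.sum_mul]
  refine Finset.sum_congr rfl fun kl hkl => ?_
  rw [← Finset.HasAntidiagonal.mem_antidiagonal.1 hkl]
  ring

lemma one_sub_conj_mul_ne_zero {ζ z : ℂ} (hζ : ‖ζ‖ ≤ 1) (hz : ‖z‖ < 1) : 1 - conj ζ * z ≠ 0 := by
  intro h
  have h1 : ‖conj ζ * z‖ = 1 := by rw [← sub_eq_zero.1 h, norm_one]
  rw [norm_mul, RCLike.norm_conj] at h1
  have := mul_le_of_le_one_left (norm_nonneg z) hζ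
  linarith

/-- The Poisson kernels are uniformly Carleson weights. -/
lemma lintegral_poisson_le {h : ℂ → ℂ} (hh : DifferentiableOn ℂ h (ball 0 1)) {ζ : ℂ}
    (hζ : ‖ζ‖ ≤ 1) :
    ∫⁻ z, ‖h z‖ₑ ^ 2 * ENNReal.ofReal ((1 - ‖z‖ ^ 2) / ‖1 - conj ζ * z‖ ^ 2) ∂area ≤
      4 * discNormSq h := by
  obtain ⟨a, ha⟩ := exists_hasCoeff hh
  have hξ : ‖conj ζ‖ ≤ 1 := by rwa [RCLike.norm_conj]
  have hG := ha.mul_geometric hξ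
  have hd : ContinuousOn (fun z => h z * (1 - conj ζ * z)⁻¹) (ball 0 1) := by
    refine hh.continuousOn.mul (ContinuousOn.inv₀ (by fun_prop) fun z hz => ?_)
    exact one_sub_conj_mul_ne_zero hζ (by simpa using hz)
  -- The denominator moves into the holomorphic function, so only the radial weight `1 - |z|²`
  -- remains; the constant 4 is the one in Hardy's inequality.
  calc ∫⁻ z, ‖h z‖ₑ ^ 2 * ENNReal.ofReal ((1 - ‖z‖ ^ 2) / ‖1 - conj ζ * z‖ ^ 2) ∂area
      = ∫⁻ z, ‖h z * (1 - conj ζ * z)⁻¹‖ₑ ^ 2 * ENNReal.ofReal (1 - ‖z‖ ^ 2) ∂area := by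
        refine lintegral_congr_ae ?_
        filter_upwards [ae_area] with z hz
        have h0 := one_sub_conj_mul_ne_zero hζ (z := z) (by simpa using hz)
        have h1 : 0 < ‖1 - conj ζ * z‖ := norm_pos_iff.2 h0
        rw [enorm_mul, mul_pow, mul_assoc, enorm_inv h0]
        congr 1
        rw [div_eq_inv_mul, ENNReal.ofReal_mul (by positivity), ENNReal.ofReal_inv_of_pos
          (by positivity), ENNReal.ofReal_pow (norm_nonneg _), ofReal_norm, ENNReal.inv_pow]
    _ ≤ _ := hG.lintegral_le hd
    _ ≤ ∑' n : ℕ, ((∑ k ∈ Finset.range (n + 1), ‖a k‖ₑ) / (n + 1)) ^ 2 := by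
        refine ENNReal.tsum_le_tsum fun n => ?_
        gcongr
        rw [Finset.Nat.sum_antidiagonal_eq_sum_range_succ_mk]
        refine (enorm_sum_le _ _).trans (Finset.sum_le_sum fun k _ => ?_)
        rw [enorm_mul, enorm_pow]
        have : ‖conj ζ‖ₑ ≤ 1 := by
          rw [← ofReal_norm]
          exact ENNReal.ofReal_le_one.2 hξ
        exact mul_le_of_le_one_right' (pow_le_one' this _)
    _ ≤ 4 * ∑' n, ‖a n‖ₑ ^ 2 := tsum_sq_average_le _
    _ ≤ 4 * discNormSq h := by gcongr; exact ha.tsum_le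

/-! ### The potential is a Carleson weight. -/

/-- This identity extracts the factor `(1 - |ζ|²)(1 - |z|²)` from the logarithm in the kernel; for
`|ζ| = 1` it identifies the two forms of the Poisson denominator. -/
lemma norm_one_sub_conj_mul_sq (ζ z : ℂ) :
    ‖1 - conj ζ * z‖ ^ 2 = ‖z - ζ‖ ^ 2 + (1 - ‖ζ‖ ^ 2) * (1 - ‖z‖ ^ 2) := by
  simp only [← Complex.normSq_eq_norm_sq, Complex.normSq_apply, Complex.sub_re, Complex.sub_im,
    Complex.mul_re, Complex.mul_im, Complex.conj_re, Complex.conj_im, Complex.one_re,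
    Complex.one_im]
  ring

/-- The kernel is dominated by a Poisson kernel away from its pole. -/
lemma potentialKernel_le {ζ z : ℂ} (hζ : ‖ζ‖ ≤ 1) (hz : ‖z‖ < 1) (hne : z ≠ ζ) :
    potentialKernel ζ z ≤ 4 * ENNReal.ofReal ((1 - ‖z‖ ^ 2) / ‖1 - conj ζ * z‖ ^ 2) +
      (closedBall ζ (1 - ‖ζ‖ ^ 2)).indicator
        (fun z => ENNReal.ofReal (4 * (1 - ‖z‖ ^ 2) / ((1 - ‖ζ‖ ^ 2) * ‖z - ζ‖))) z := by
  have hA : 0 < ‖1 - conj ζ * z‖ := norm_pos_iff.2 (one_sub_conj_mul_ne_zero hζ hz)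
  have hB : 0 < ‖z - ζ‖ := norm_pos_iff.2 (sub_ne_zero.2 hne)
  have hAB := norm_one_sub_conj_mul_sq ζ z
  have hz2 : 0 < 1 - ‖z‖ ^ 2 := by nlinarith [norm_nonneg z]
  unfold potentialKernel
  split_ifs with h1
  · have hd : 0 < 1 - ‖ζ‖ ^ 2 := by nlinarith [norm_nonneg ζ]
    have hA2 : ‖1 - conj ζ * z‖ ≤ (1 - ‖ζ‖ ^ 2) + ‖z - ζ‖ := by
      have e : 1 - conj ζ * z = (1 - conj ζ * ζ) - conj ζ * (z - ζ) := by ring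
      rw [e]
      refine (norm_sub_le _ _).trans (add_le_add (le_of_eq ?_) ?_)
      · rw [Complex.conj_mul']
        norm_cast
        exact abs_of_pos hd
      · rw [norm_mul, RCLike.norm_conj]
        exact mul_le_of_le_one_left hB.le hζ
    have hA3 : (1 - ‖ζ‖ ^ 2) / 2 ≤ ‖1 - conj ζ * z‖ := by
      have e : 1 - ‖conj ζ * z‖ ≤ ‖1 - conj ζ * z‖ := by
        simpa using norm_sub_norm_le (1 : ℂ) (conj ζ * z)
      rw [norm_mul, RCLike.norm_conj] at e
      have := mul_le_of_le_one_right (norm_nonneg ζ) hz.le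
      nlinarith [norm_nonneg ζ]
    set A := ‖1 - conj ζ * z‖
    set B := ‖z - ζ‖
    set d := 1 - ‖ζ‖ ^ 2
    set e := 1 - ‖z‖ ^ 2
    -- From `log t ≤ t - 1` at `t = A / B`: since `B ≤ A`, one has `A / B - 1 ≤ (A² - B²) / (A B) =
    -- d e / (A B)`.
    have hlog : Real.log (‖(1 - conj ζ * z) / (z - ζ)‖ ^ 2) / d ≤ 2 * e / (A * B) := by
      have hl : Real.log (A / B) ≤ A / B - 1 := Real.log_le_sub_one_of_pos (by positivity)
      rw [norm_div, Real.log_pow, div_le_iff₀ hd]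
      have h2 : A / B - 1 ≤ e / (A * B) * d := by
        have h3 : e / (A * B) * d - (A / B - 1) = (A * B - B ^ 2) / (A * B) := by
          rw [show A / B = A ^ 2 / (A * B) by field_simp, hAB]
          field_simp
          ring
        have h4 : B ≤ A := by
          refine (pow_le_pow_iff_left₀ hB.le hA.le two_ne_zero).1 ?_
          nlinarith [mul_pos hd hz2]
        have h5 : 0 ≤ (A * B - B ^ 2) / (A * B) := by
          refine div_nonneg ?_ (by positivity)
          nlinarith
        linarith
      calc ((2 : ℕ) : ℝ) * Real.log (A / B) ≤ 2 * (e / (A * B) * d) := by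
            push_cast
            linarith
        _ = 2 * e / (A * B) * d := by ring
    refine (ENNReal.ofReal_le_ofReal hlog).trans ?_
    -- If `B ≥ A / 2`, then `A B ≥ A² / 2` and the Poisson-type term suffices. Otherwise `A ≤ d + B`
    -- forces `B < d`, so `z` lies in the ball about `ζ`, and `A ≥ d / 2` gives the singular term.
    rcases le_or_gt (A / 2) B with hc | hc
    · refine le_add_right ?_
      have e4 : (4 : ℝ≥0∞) = ENNReal.ofReal 4 := by simp
      rw [e4, ← ENNReal.ofReal_mul (by norm_num)]
      refine ENNReal.ofReal_le_ofReal ?_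
      rw [← mul_div_assoc, div_le_div_iff₀ (by positivity) (by positivity)]
      nlinarith [mul_nonneg (mul_nonneg hz2.le hA.le) (sub_nonneg.2 hc)]
    · have hm : z ∈ closedBall ζ d := by
        rw [mem_closedBall, dist_eq_norm]
        change B ≤ d
        linarith
      rw [indicator_of_mem hm]
      refine le_add_left (ENNReal.ofReal_le_ofReal ?_)
      change 2 * e / (A * B) ≤ 4 * e / (d * B)
      rw [div_le_div_iff₀ (by positivity) (by positivity)]
      nlinarith [mul_nonneg (mul_nonneg hz2.le hB.le) (sub_nonneg.2 hA3)]
  · have h2 : ‖ζ‖ = 1 := le_antisymm hζ (not_lt.1 h1)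
    have h3 : ‖ζ - z‖ ^ 2 = ‖1 - conj ζ * z‖ ^ 2 := by
      rw [hAB, h2, norm_sub_rev]
      ring
    rw [h3]
    refine le_add_right (le_mul_of_one_le_left' (by norm_num))

/-- After translation to the origin, the Jacobian `r` cancels the singularity `1 / r`, leaving the
area of a `d` by `2π` rectangle. -/
lemma lintegral_inv_norm_le {d : ℝ} (hd : 0 < d) (ζ : ℂ) :
    ∫⁻ z in closedBall ζ d, ENNReal.ofReal ‖z - ζ‖⁻¹ ≤ ENNReal.ofReal (2 * Real.pi * d) := by
  have h1 : ∫⁻ z in closedBall ζ d, ENNReal.ofReal ‖z - ζ‖⁻¹ =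
      ∫⁻ z : ℂ, (Iic d).indicator (fun t => ENNReal.ofReal t⁻¹) ‖z‖ := by
    rw [← lintegral_indicator measurableSet_closedBall, ← lintegral_add_right_eq_self _ ζ]
    refine lintegral_congr fun z => ?_
    by_cases hz : ‖z‖ ≤ d
    · rw [indicator_of_mem (by simpa using hz), indicator_of_mem (by simpa using hz),
        add_sub_cancel_right]
    · rw [indicator_of_notMem (by simpa using hz), indicator_of_notMem (by simpa using hz)]
  rw [h1, ← Complex.lintegral_comp_polarCoord_symm]
  calc ∫⁻ p in polarCoord.target, ENNReal.ofReal p.1 •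
        (Iic d).indicator (fun t => ENNReal.ofReal t⁻¹) ‖Complex.polarCoord.symm p‖
      ≤ ∫⁻ p in polarCoord.target, (Ioc 0 d ×ˢ Ioo (-Real.pi) Real.pi).indicator 1 p := by
        refine setLIntegral_mono' polarCoord.open_target.measurableSet fun p hp => ?_
        rw [polarCoord_target] at hp
        have hp1 : (0 : ℝ) < p.1 := hp.1
        rw [Complex.norm_polarCoord_symm, abs_of_pos hp1]
        by_cases h : p.1 ≤ d
        · rw [indicator_of_mem (show p.1 ∈ Iic d from h), indicator_of_mem
            (show p ∈ Ioc 0 d ×ˢ Ioo (-Real.pi) Real.pi from ⟨⟨hp1, h⟩, hp.2⟩),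
            smul_eq_mul, ← ENNReal.ofReal_mul hp1.le, mul_inv_cancel₀ hp1.ne']
          simp
        · rw [indicator_of_notMem (show p.1 ∉ Iic d from h)]
          simp
    _ ≤ ∫⁻ p : ℝ × ℝ, (Ioc 0 d ×ˢ Ioo (-Real.pi) Real.pi).indicator 1 p := setLIntegral_le_lintegral _ _
    _ = ENNReal.ofReal (2 * Real.pi * d) := by
        rw [lintegral_indicator_one (measurableSet_Ioc.prod measurableSet_Ioo),
          Measure.volume_eq_prod, Measure.prod_prod, Real.volume_Ioc, Real.volume_Ioo,
          ← ENNReal.ofReal_mul (by linarith)]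
        congr 1
        ring

/-- The kernels are uniformly Carleson weights. -/
lemma lintegral_potentialKernel_le {h : ℂ → ℂ} (hh : DifferentiableOn ℂ h (ball 0 1)) {ζ : ℂ}
    (hζ : ‖ζ‖ ≤ 1) :
    ∫⁻ z, ‖h z‖ₑ ^ 2 * potentialKernel ζ z ∂area ≤ 24 * discNormSq h := by
  have hac : area ≪ volume := (Measure.absolutelyContinuous_of_le Measure.restrict_le_self).smul_left _
  have hne : ∀ᵐ z ∂area, z ≠ ζ := hac.ae_le (compl_mem_ae_iff.2 (measure_singleton ζ))
  have hhm : AEMeasurable h area :=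
    (hh.continuousOn.aemeasurable measurableSet_ball).smul_measure _
  -- The growth estimate cancels `1 - |z|²`. With `d = 1 - |ζ|²`, what remains is `(4 / d) · π⁻¹ ·
  -- 2πd = 8`, independent of `ζ`; together with `4 · 4` from the Poisson term this gives 24.
  have hnear : ∫⁻ z, ‖h z‖ₑ ^ 2 * (closedBall ζ (1 - ‖ζ‖ ^ 2)).indicator
      (fun z => ENNReal.ofReal (4 * (1 - ‖z‖ ^ 2) / ((1 - ‖ζ‖ ^ 2) * ‖z - ζ‖))) z ∂area ≤
      8 * discNormSq h := by
    -- On the unit circle the denominator is zero, so by convention the singular term vanishes.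
    rcases hζ.eq_or_lt with h1 | h1
    · simp [indicator, h1]
    have hd : 0 < 1 - ‖ζ‖ ^ 2 := by nlinarith [norm_nonneg ζ]
    calc _ ≤ ∫⁻ z, discNormSq h * (ENNReal.ofReal (4 / (1 - ‖ζ‖ ^ 2)) *
            (closedBall ζ (1 - ‖ζ‖ ^ 2)).indicator (fun z => ENNReal.ofReal ‖z - ζ‖⁻¹) z) ∂area := by
          refine lintegral_mono_ae ?_
          filter_upwards [ae_area] with z hz
          have hz1 : ‖z‖ < 1 := by simpa using hz
          have hz2 : 0 < 1 - ‖z‖ ^ 2 := by nlinarith [norm_nonneg z]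
          by_cases hm : z ∈ closedBall ζ (1 - ‖ζ‖ ^ 2)
          · rw [indicator_of_mem hm, indicator_of_mem hm]
            calc _ ≤ ENNReal.ofReal (1 - ‖z‖ ^ 2)⁻¹ * discNormSq h *
                  ENNReal.ofReal (4 * (1 - ‖z‖ ^ 2) / ((1 - ‖ζ‖ ^ 2) * ‖z - ζ‖)) := by
                  gcongr
                  exact enorm_sq_le_discNormSq hh hz1
              _ = discNormSq h * (ENNReal.ofReal (1 - ‖z‖ ^ 2)⁻¹ *
                  ENNReal.ofReal (4 * (1 - ‖z‖ ^ 2) / ((1 - ‖ζ‖ ^ 2) * ‖z - ζ‖))) := by ring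
              _ = _ := by
                rw [← ENNReal.ofReal_mul (by positivity), ← ENNReal.ofReal_mul (by positivity)]
                congr 2
                field_simp
          · simp [indicator_of_notMem hm]
      _ = discNormSq h * (ENNReal.ofReal (4 / (1 - ‖ζ‖ ^ 2)) *
            ∫⁻ z, (closedBall ζ (1 - ‖ζ‖ ^ 2)).indicator (fun z => ENNReal.ofReal ‖z - ζ‖⁻¹) z ∂area) := by
          have hm : Measurable ((closedBall ζ (1 - ‖ζ‖ ^ 2)).indicator
              fun z => ENNReal.ofReal ‖z - ζ‖⁻¹) :=
            Measurable.indicator (by fun_prop) measurableSet_closedBall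
          rw [lintegral_const_mul _ (hm.const_mul _), lintegral_const_mul _ hm]
      _ ≤ discNormSq h * (ENNReal.ofReal (4 / (1 - ‖ζ‖ ^ 2)) * ((ENNReal.ofReal Real.pi)⁻¹ *
            ENNReal.ofReal (2 * Real.pi * (1 - ‖ζ‖ ^ 2)))) := by
          gcongr
          rw [area, lintegral_smul_measure, smul_eq_mul]
          gcongr
          refine (setLIntegral_le_lintegral _ _).trans ?_
          rw [lintegral_indicator measurableSet_closedBall]
          exact lintegral_inv_norm_le hd ζ
      _ = 8 * discNormSq h := by
          rw [← ENNReal.ofReal_inv_of_pos Real.pi_pos, ← ENNReal.ofReal_mul (by positivity),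
            ← ENNReal.ofReal_mul (by positivity), mul_comm]
          congr 1
          rw [show 4 / (1 - ‖ζ‖ ^ 2) * (Real.pi⁻¹ * (2 * Real.pi * (1 - ‖ζ‖ ^ 2))) = 8 by
            have := Real.pi_ne_zero
            field_simp
            norm_num]
          simp
  calc ∫⁻ z, ‖h z‖ₑ ^ 2 * potentialKernel ζ z ∂area
      ≤ ∫⁻ z, (4 * (‖h z‖ₑ ^ 2 * ENNReal.ofReal ((1 - ‖z‖ ^ 2) / ‖1 - conj ζ * z‖ ^ 2)) +
          ‖h z‖ₑ ^ 2 * (closedBall ζ (1 - ‖ζ‖ ^ 2)).indicator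
          (fun z => ENNReal.ofReal (4 * (1 - ‖z‖ ^ 2) / ((1 - ‖ζ‖ ^ 2) * ‖z - ζ‖))) z) ∂area := by
        refine lintegral_mono_ae ?_
        filter_upwards [ae_area, hne] with z hz hzn
        refine (mul_le_mul_right (potentialKernel_le hζ (by simpa using hz) hzn) _).trans
          (le_of_eq (by ring))
    _ ≤ 4 * (4 * discNormSq h) + 8 * discNormSq h := by
        have hm : AEMeasurable (fun z => ‖h z‖ₑ ^ 2 *
            ENNReal.ofReal ((1 - ‖z‖ ^ 2) / ‖1 - conj ζ * z‖ ^ 2)) area :=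
          (hhm.enorm.pow_const 2).mul (by fun_prop)
        rw [lintegral_add_left' (hm.const_mul 4), lintegral_const_mul'' _ hm]
        gcongr
        exact lintegral_poisson_le hh hζ
    _ = 24 * discNormSq h := by ring

lemma measurable_potentialKernel :
    Measurable fun p : closedBall (0 : ℂ) 1 × ℂ => potentialKernel p.1 p.2 := by
  unfold potentialKernel
  have h2 : Measurable fun p : closedBall (0 : ℂ) 1 × ℂ => (p.1 : ℂ) :=
    measurable_subtype_coe.comp measurable_fst
  exact Measurable.ite (measurableSet_lt h2.norm measurable_const)
    (Measurable.ite (measurableSet_eq_fun measurable_snd h2) measurable_const (by fun_prop))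
    (by fun_prop)

/-- The weight `U_μ` is a Carleson weight: it embeds the Hardy space of the disc. -/
lemma lintegral_potential_le (μ : Measure (closedBall (0 : ℂ) 1)) [IsFiniteMeasure μ] {h : ℂ → ℂ}
    (hh : DifferentiableOn ℂ h (ball 0 1)) :
    ∫⁻ z, ‖h z‖ₑ ^ 2 * potential μ z ∂area ≤ 24 * μ univ * discNormSq h := by
  have hhm : AEMeasurable h area :=
    (hh.continuousOn.aemeasurable measurableSet_ball).smul_measure _
  calc ∫⁻ z, ‖h z‖ₑ ^ 2 * potential μ z ∂area
      = ∫⁻ z, ∫⁻ ζ, ‖h z‖ₑ ^ 2 * potentialKernel ζ z ∂μ ∂area := by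
        refine lintegral_congr fun z => ?_
        rw [potential, lintegral_const_mul]
        exact measurable_potentialKernel.comp (measurable_id.prodMk measurable_const)
    _ = ∫⁻ ζ : closedBall (0 : ℂ) 1, ∫⁻ z, ‖h z‖ₑ ^ 2 * potentialKernel ζ z ∂area ∂μ := by
        refine lintegral_lintegral_swap ?_
        exact (hhm.comp_fst.enorm.pow_const 2).mul
          (measurable_potentialKernel.comp measurable_swap).aemeasurable
    _ ≤ ∫⁻ _ζ : closedBall (0 : ℂ) 1, 24 * discNormSq h ∂μ :=
        lintegral_mono fun ζ => lintegral_potentialKernel_le hh (mem_closedBall_zero_iff.1 ζ.2)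
    _ = _ := by
        rw [lintegral_const]
        ring

/-- The Cauchy estimate for functions in the Hardy space of the disc. -/
lemma exists_enorm_deriv_sq_le {ρ : ℝ} (hρ0 : 0 ≤ ρ) (hρ : ρ < 1) :
    ∃ K : ℝ≥0∞, K ≠ ⊤ ∧ ∀ h : ℂ → ℂ, DifferentiableOn ℂ h (ball 0 1) → ∀ z : ℂ, ‖z‖ ≤ ρ →
      ‖deriv h z‖ₑ ^ 2 ≤ K * discNormSq h := by
  -- As `ρ + δ = s < 1`, every disc of radius `δ` centred in `‖z‖ ≤ ρ` stays in `‖w‖ ≤ s`, where the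
  -- growth estimate is uniform.
  set s := (1 + ρ) / 2 with hs
  set δ := (1 - ρ) / 2 with hδ
  have hs1 : s < 1 := by linarith
  have hδ0 : 0 < δ := by linarith
  have hs2 : 0 < 1 - s ^ 2 := by nlinarith
  refine ⟨ENNReal.ofReal ((1 - s ^ 2)⁻¹ / δ ^ 2), ENNReal.ofReal_ne_top, fun h hh z hz => ?_⟩
  rcases eq_or_ne (discNormSq h) ⊤ with ht | ht
  · rw [ht, ENNReal.mul_top]
    · exact le_top
    · rw [Ne, ENNReal.ofReal_eq_zero, not_le]
      positivity
  obtain ⟨d, hd⟩ : ∃ d : ℝ≥0, discNormSq h = d := ⟨_, (ENNReal.coe_toNNReal ht).symm⟩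
  have hsub : closedBall z δ ⊆ ball 0 1 := fun w hw => by
    rw [mem_closedBall, dist_eq_norm] at hw
    rw [mem_ball_zero_iff]
    have := norm_le_norm_add_norm_sub' w z
    linarith
  have hbound : ∀ w ∈ sphere z δ, ‖h w‖ ≤ √((1 - s ^ 2)⁻¹ * d) := by
    intro w hw
    have hw1 : ‖w‖ ≤ s := by
      rw [mem_sphere, dist_eq_norm] at hw
      have := norm_le_norm_add_norm_sub' w z
      linarith
    refine Real.le_sqrt_of_sq_le ?_
    have h1 := enorm_sq_le_discNormSq hh (hw1.trans_lt hs1)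
    rw [hd, ← ENNReal.ofReal_coe_nnreal, ← ENNReal.ofReal_mul' d.coe_nonneg, ← ofReal_norm,
      ← ENNReal.ofReal_pow (norm_nonneg _)] at h1
    have hw2 : 1 - s ^ 2 ≤ 1 - ‖w‖ ^ 2 := by nlinarith [norm_nonneg w]
    have h2 := (ENNReal.ofReal_le_ofReal_iff
      (mul_nonneg (inv_nonneg.2 (hs2.le.trans hw2)) d.coe_nonneg)).1 h1
    refine h2.trans ?_
    gcongr
  have h3 := Complex.norm_deriv_le_of_forall_mem_sphere_norm_le hδ0
    ((hh.mono hsub).diffContOnCl_ball subset_rfl) hbound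
  rw [hd, ← ENNReal.ofReal_coe_nnreal, ← ENNReal.ofReal_mul' d.coe_nonneg, ← ofReal_norm,
    ← ENNReal.ofReal_pow (norm_nonneg _)]
  refine ENNReal.ofReal_le_ofReal ?_
  calc ‖deriv h z‖ ^ 2 ≤ (√((1 - s ^ 2)⁻¹ * d) / δ) ^ 2 := by gcongr
    _ = (1 - s ^ 2)⁻¹ / δ ^ 2 * d := by
      rw [div_pow, Real.sq_sqrt (mul_nonneg (inv_nonneg.2 hs2.le) d.coe_nonneg)]
      ring

lemma angle_univ : angle univ = 1 := by
  have h0 : ENNReal.ofReal (2 * Real.pi) ≠ 0 := by simp [Real.pi_pos]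
  simp only [angle, Measure.smul_apply, Measure.restrict_apply_univ, Real.volume_Ioc, sub_zero,
    smul_eq_mul]
  exact ENNReal.inv_mul_cancel h0 ENNReal.ofReal_ne_top

/-- The Carleson embedding applied to the constant function 1. -/
lemma lintegral_potential_le_mass (μ : Measure (closedBall (0 : ℂ) 1)) [IsFiniteMeasure μ] :
    ∫⁻ z, potential μ z ∂area ≤ 24 * μ univ := by
  have h := lintegral_potential_le μ (differentiableOn_const (c := (1 : ℂ)))
  have h1 : discNormSq (fun _ => (1 : ℂ)) = 1 := by
    simp [discNormSq, circleMean, angle_univ]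
  simpa [h1] using h

/-! ### From the disc to the bidisc. -/

section Slices

variable {f : ℂ × ℂ → ℂ}

/-- Square means increase in each radius separately, so both radii can be raised to their maximum.
-/
lemma lintegral_torus_le (hf : DifferentiableOn ℂ f bidisc) {r s : ℝ} (hr : r ∈ Ioo (0 : ℝ) 1)
    (hs : s ∈ Ioo (0 : ℝ) 1) :
    ∫⁻ θ₁, ∫⁻ θ₂, ‖f (circleMap 0 r θ₁, circleMap 0 s θ₂)‖ₑ ^ 2 ∂angle ∂angle ≤ hardyNormSq f := by
  have ht : max r s ∈ Ioo (0 : ℝ) 1 := ⟨hr.1.trans_le (le_max_left _ _), max_lt hr.2 hs.2⟩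
  calc _ ≤ ∫⁻ θ₁, ∫⁻ θ₂, ‖f (circleMap 0 r θ₁, circleMap 0 (max r s) θ₂)‖ₑ ^ 2 ∂angle ∂angle :=
        lintegral_mono fun θ₁ => circle_mean_mono (differentiableOn_slice'
          (F := fun a b => f (a, b)) hf (circleMap_mem hr θ₁)) hs.1 (le_max_right _ _) ht.2
    _ = ∫⁻ θ₂, ∫⁻ θ₁, ‖f (circleMap 0 r θ₁, circleMap 0 (max r s) θ₂)‖ₑ ^ 2 ∂angle ∂angle :=
        lintegral_lintegral_swap
          ((continuous_torus hf hr ht).measurable.enorm.pow_const 2).aemeasurable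
    _ ≤ ∫⁻ θ₂, ∫⁻ θ₁, ‖f (circleMap 0 (max r s) θ₁, circleMap 0 (max r s) θ₂)‖ₑ ^ 2
          ∂angle ∂angle :=
        lintegral_mono fun θ₂ => circle_mean_mono (differentiableOn_slice
          (F := fun a b => f (a, b)) hf (circleMap_mem ht θ₂)) hr.1 (le_max_left _ _) ht.2
    _ = hardyMean f (max r s) := (lintegral_lintegral_swap
          ((continuous_torus hf ht ht).measurable.enorm.pow_const 2).aemeasurable).symm
    _ ≤ hardyNormSq f := le_iSup (fun r : Ioo (0 : ℝ) 1 => hardyMean f r) ⟨_, ht⟩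

lemma hardyNormSq_swap (hf : DifferentiableOn ℂ f bidisc) :
    hardyNormSq (fun p => f (p.2, p.1)) = hardyNormSq f :=
  iSup_congr fun r => lintegral_lintegral_swap (((continuous_torus hf r.2 r.2).comp
    continuous_swap).measurable.enorm.pow_const 2).aemeasurable

lemma measurable_circleMean (hf : DifferentiableOn ℂ f bidisc) {r s : ℝ} (hr : r ∈ Ioo (0 : ℝ) 1)
    (hs : s ∈ Ioo (0 : ℝ) 1) :
    Measurable fun θ => circleMean (fun w => f (w, circleMap 0 r θ)) s :=
  Measurable.lintegral_prod_right' (f := fun p : ℝ × ℝ =>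
    ‖f (circleMap 0 s p.2, circleMap 0 r p.1)‖ₑ ^ 2)
    (((continuous_torus hf hs hr).comp continuous_swap).measurable.enorm.pow_const 2)

lemma measurable_discNormSq (hf : DifferentiableOn ℂ f bidisc) {r : ℝ} (hr : r ∈ Ioo (0 : ℝ) 1) :
    Measurable fun θ => discNormSq fun w => f (w, circleMap 0 r θ) :=
  Measurable.iSup fun n => measurable_circleMean hf hr (radius_mem n)

lemma monotone_circleMean_radius {h : ℂ → ℂ} (hh : DifferentiableOn ℂ h (ball 0 1)) :
    Monotone fun n => circleMean h (radius n) := fun m n hmn =>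
  circleMean_mono hh (radius_mem m).1 (monotone_radius hmn) (radius_mem n).2

/-- Because the disc norm is an increasing limit along a sequence of radii, monotone convergence
moves the supremum outside the angular integral, leaving means over tori with two radii. -/
lemma lintegral_discNormSq_le (hf : DifferentiableOn ℂ f bidisc) {r : ℝ}
    (hr : r ∈ Ioo (0 : ℝ) 1) :
    ∫⁻ θ, discNormSq (fun w => f (w, circleMap 0 r θ)) ∂angle ≤ hardyNormSq f := by
  unfold discNormSq
  rw [lintegral_iSup fun n => measurable_circleMean hf hr (radius_mem n)]
  · refine iSup_le fun n => ?_
    rw [← hardyNormSq_swap hf]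
    exact lintegral_torus_le (differentiableOn_swap hf) hr (radius_mem n)
  · intro m n hmn θ
    exact monotone_circleMean_radius
      (differentiableOn_slice (F := fun a b => f (a, b)) hf (circleMap_mem hr θ)) hmn

/-- The growth estimate for functions in the Hardy space of the bidisc. -/
lemma enorm_sq_le_hardyNormSq (hf : DifferentiableOn ℂ f bidisc) {w : ℂ × ℂ} (hw : w ∈ bidisc) :
    ‖f w‖ₑ ^ 2 ≤ ENNReal.ofReal (1 - ‖w.1‖ ^ 2)⁻¹ * (ENNReal.ofReal (1 - ‖w.2‖ ^ 2)⁻¹ *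
      hardyNormSq f) := by
  refine (enorm_sq_le_discNormSq (h := fun z => f (z, w.2))
    (differentiableOn_slice (F := fun a b => f (a, b)) hf hw.2) hw.1).trans ?_
  gcongr
  refine iSup_le fun n => ?_
  have hn := radius_mem n
  calc circleMean (fun z => f (z, w.2)) (radius n)
      ≤ ∫⁻ θ, ENNReal.ofReal (1 - ‖w.2‖ ^ 2)⁻¹ *
          discNormSq (fun z => f (circleMap 0 (radius n) θ, z)) ∂angle :=
        lintegral_mono fun θ => enorm_sq_le_discNormSq
          (differentiableOn_slice' (F := fun a b => f (a, b)) hf (circleMap_mem hn θ)) hw.2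
    _ = ENNReal.ofReal (1 - ‖w.2‖ ^ 2)⁻¹ *
          ∫⁻ θ, discNormSq (fun z => f (circleMap 0 (radius n) θ, z)) ∂angle :=
        lintegral_const_mul' _ _ ENNReal.ofReal_ne_top
    _ ≤ _ := by
        gcongr
        rw [← hardyNormSq_swap hf]
        exact lintegral_discNormSq_le (differentiableOn_swap hf) hn

end Slices

lemma hardyMean_congr {f g : ℂ × ℂ → ℂ} (h : EqOn f g bidisc) {r : ℝ} (hr : r ∈ Ioo (0 : ℝ) 1) :
    hardyMean f r = hardyMean g r :=
  lintegral_congr fun θ₁ => lintegral_congr fun θ₂ => by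
    rw [h ⟨circleMap_mem hr θ₁, circleMap_mem hr θ₂⟩]

lemma dirichletMean_congr (μ : Measure (closedBall (0 : ℂ) 1)) {F G : ℂ → ℂ → ℂ}
    (h : ∀ z e : ℂ, ‖z‖ < 1 → ‖e‖ < 1 → F z e = G z e) {r : ℝ} (hr : r ∈ Ioo (0 : ℝ) 1) :
    dirichletMean μ F r = dirichletMean μ G r := by
  refine lintegral_congr fun θ => lintegral_congr_ae ?_
  filter_upwards [ae_area] with z hz
  have : (fun w => F w (circleMap 0 r θ)) =ᶠ[𝓝 z] fun w => G w (circleMap 0 r θ) := by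
    filter_upwards [isOpen_ball.mem_nhds hz] with w hw
    exact h w _ (by simpa using hw) (circleMap_mem hr θ)
  rw [this.deriv_eq]

/-- Allows passage between a holomorphic formula and its extension by zero, which is the actual
element of the space. -/
lemma normSq_congr (μ₁ μ₂ : Measure (closedBall (0 : ℂ) 1)) {f g : ℂ × ℂ → ℂ}
    (h : EqOn f g bidisc) : normSq μ₁ μ₂ f = normSq μ₁ μ₂ g := by
  unfold normSq hardyNormSq dirichletIntegral
  congr 1
  · exact iSup_congr fun r => hardyMean_congr h r.2
  · congr 1
    · exact iSup_congr fun r => dirichletMean_congr μ₁ (fun z e hz he => h ⟨hz, he⟩) r.2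
    · exact iSup_congr fun r => dirichletMean_congr μ₂ (fun z e hz he => h ⟨he, hz⟩) r.2

/-- A Dirichlet mean is controlled by a pointwise bound for the derivative. -/
lemma dirichletMean_le (μ : Measure (closedBall (0 : ℂ) 1)) [IsFiniteMeasure μ] {F G : ℂ → ℂ → ℂ}
    (hF : DifferentiableOn ℂ (fun p : ℂ × ℂ => F p.1 p.2) bidisc)
    (hG : DifferentiableOn ℂ (fun p : ℂ × ℂ => G p.1 p.2) bidisc) {a b c : ℝ≥0∞}
    (h : ∀ z e : ℂ, ‖z‖ < 1 → ‖e‖ < 1 → ‖deriv (fun w => G w e) z‖ₑ ^ 2 ≤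
      a * ‖deriv (fun w => F w e) z‖ₑ ^ 2 + b * ‖F z e‖ₑ ^ 2 + c * discNormSq fun w => G w e)
    {r : ℝ} (hr : r ∈ Ioo (0 : ℝ) 1) :
    dirichletMean μ G r ≤ a * dirichletMean μ F r +
      b * (24 * μ univ * hardyNormSq fun p => F p.1 p.2) +
      c * (24 * μ univ * hardyNormSq fun p => G p.1 p.2) := by
  have hU := measurable_potential μ
  have hslice : ∀ θ, ∫⁻ z, ‖deriv (fun w => G w (circleMap 0 r θ)) z‖ₑ ^ 2 * potential μ z ∂area ≤
      a * ∫⁻ z, ‖deriv (fun w => F w (circleMap 0 r θ)) z‖ₑ ^ 2 * potential μ z ∂area +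
      b * (24 * μ univ * discNormSq fun w => F w (circleMap 0 r θ)) +
      c * (24 * μ univ * discNormSq fun w => G w (circleMap 0 r θ)) := by
    intro θ
    have he := circleMap_mem hr θ
    have hFs := differentiableOn_slice hF he
    have m1 : AEMeasurable (fun z => ‖deriv (fun w => F w (circleMap 0 r θ)) z‖ₑ ^ 2 *
        potential μ z) area :=
      ((measurable_deriv _).enorm.pow_const 2).aemeasurable.mul hU.aemeasurable
    have m2 : AEMeasurable (fun z => ‖F z (circleMap 0 r θ)‖ₑ ^ 2 * potential μ z) area :=
      (((hFs.continuousOn.aemeasurable measurableSet_ball).smul_measure _).enorm.pow_const 2).mul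
        hU.aemeasurable
    -- The term in `b` is absorbed by the Carleson embedding of the slice of `F`. The term in `c`
    -- does not depend on `z`, so only the total mass of the weight enters.
    calc _ ≤ ∫⁻ z, (a * (‖deriv (fun w => F w (circleMap 0 r θ)) z‖ₑ ^ 2 * potential μ z) +
          b * (‖F z (circleMap 0 r θ)‖ₑ ^ 2 * potential μ z) +
          c * (discNormSq fun w => G w (circleMap 0 r θ)) * potential μ z) ∂area := by
          refine lintegral_mono_ae ?_
          filter_upwards [ae_area] with z hz
          refine (mul_le_mul_left (h z _ (by simpa using hz) he) _).trans (le_of_eq (by ring))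
      _ = a * ∫⁻ z, ‖deriv (fun w => F w (circleMap 0 r θ)) z‖ₑ ^ 2 * potential μ z ∂area +
          b * ∫⁻ z, ‖F z (circleMap 0 r θ)‖ₑ ^ 2 * potential μ z ∂area +
          c * (discNormSq fun w => G w (circleMap 0 r θ)) * ∫⁻ z, potential μ z ∂area := by
          rw [lintegral_add_right _ (hU.const_mul _),
            lintegral_add_left' (m1.const_mul a), lintegral_const_mul'' _ m1,
            lintegral_const_mul'' _ m2, lintegral_const_mul _ hU]
      _ ≤ a * ∫⁻ z, ‖deriv (fun w => F w (circleMap 0 r θ)) z‖ₑ ^ 2 * potential μ z ∂area +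
          b * (24 * μ univ * discNormSq fun w => F w (circleMap 0 r θ)) +
          c * (discNormSq fun w => G w (circleMap 0 r θ)) * (24 * μ univ) := by
          gcongr
          · exact lintegral_potential_le μ hFs
          · exact lintegral_potential_le_mass μ
      _ = _ := by ring
  have mF := measurable_discNormSq hF hr
  have mG := measurable_discNormSq hG hr
  have mD : AEMeasurable (fun θ => ∫⁻ z, ‖deriv (fun w => F w (circleMap 0 r θ)) z‖ₑ ^ 2 *
      potential μ z ∂area) angle := by
    have h1 : Measurable fun θ => ∫⁻ z, ‖partialExt F (z, circleMap 0 r θ)‖ₑ ^ 2 *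
        potential μ z ∂area :=
      Measurable.lintegral_prod_right' (f := fun p : ℝ × ℂ =>
        ‖partialExt F (p.2, circleMap 0 r p.1)‖ₑ ^ 2 * potential μ p.2)
        (((measurable_energy μ hF r).enorm.pow_const 2).mul (hU.comp measurable_snd))
    convert h1.aemeasurable using 2 with θ
    refine lintegral_congr_ae ?_
    filter_upwards [ae_area] with z hz
    have : (z, circleMap 0 r θ) ∈ bidisc := ⟨by simpa using hz, circleMap_mem hr θ⟩
    rw [partialExt, indicator_of_mem this]
  refine (lintegral_mono hslice).trans ?_
  rw [lintegral_add_right _ ((mG.const_mul _).const_mul _),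
    lintegral_add_right _ ((mF.const_mul _).const_mul _), lintegral_const_mul'' _ mD,
    lintegral_const_mul _ (mF.const_mul _), lintegral_const_mul _ (mG.const_mul _),
    lintegral_const_mul _ mF, lintegral_const_mul _ mG]
  have hFr := lintegral_discNormSq_le hF hr
  have hGr := lintegral_discNormSq_le hG hr
  gcongr
  exact le_rfl

/-! ### Boundedness of multiplication by a coordinate. -/

lemma hardyNormSq_mul_fst_le (f : ℂ × ℂ → ℂ) :
    hardyNormSq (fun z => z.1 * f z) ≤ hardyNormSq f := by
  refine iSup_mono fun r => lintegral_mono fun θ₁ => lintegral_mono fun θ₂ => ?_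
  have h : ‖circleMap 0 r θ₁‖ₑ ≤ 1 := by
    rw [← ofReal_norm]
    exact ENNReal.ofReal_le_one.2 (circleMap_mem r.2 θ₁).le
  simp only [enorm_mul]
  gcongr
  exact mul_le_of_le_one_left' h

/-- Multiplication by the first coordinate is bounded. -/
lemma normSq_mul_fst_le (μ₁ μ₂ : Measure (closedBall (0 : ℂ) 1)) [IsFiniteMeasure μ₁]
    [IsFiniteMeasure μ₂] {f : ℂ × ℂ → ℂ} (hf : DifferentiableOn ℂ f bidisc) :
    normSq μ₁ μ₂ (fun z => z.1 * f z) ≤ (2 + 48 * μ₁ univ) * normSq μ₁ μ₂ f := by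
  have hg : DifferentiableOn ℂ (fun z : ℂ × ℂ => z.1 * f z) bidisc :=
    differentiableOn_fst.mul hf
  have h1 : (⨆ r : Ioo (0 : ℝ) 1, dirichletMean μ₁ (fun z e => z * f (z, e)) r) ≤
      2 * (⨆ r : Ioo (0 : ℝ) 1, dirichletMean μ₁ (fun z e => f (z, e)) r) +
        48 * μ₁ univ * hardyNormSq f := by
    refine iSup_le fun r => ?_
    -- By the product rule `|∂(z f)|² ≤ 2 |∂f|² + 2 |f|²` on the disc; the second term costs `2 ·
    -- 24` through the Carleson embedding.
    refine (dirichletMean_le μ₁ (F := fun z e => f (z, e)) (G := fun z e => z * f (z, e))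
      (a := 2) (b := 2) (c := 0) hf hg (fun z e hz he => ?_) r.2).trans ?_
    · have hd : HasDerivAt (fun w => w * f (w, e))
          (1 * f (z, e) + z * deriv (fun w => f (w, e)) z) z :=
        (hasDerivAt_id z).mul (((differentiableOn_slice (F := fun a b => f (a, b)) hf
          he).differentiableAt (isOpen_ball.mem_nhds (by simpa using hz))).hasDerivAt)
      rw [hd.deriv, one_mul, zero_mul, add_zero, add_comm]
      refine (enorm_add_sq_le _ _ 1 one_ne_zero).trans ?_
      norm_num
      gcongr
      have h : ‖z‖ₑ ≤ 1 := by
        rw [← ofReal_norm]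
        exact ENNReal.ofReal_le_one.2 hz.le
      exact mul_le_of_le_one_left' h
    · rw [zero_mul, add_zero]
      refine add_le_add ?_ (le_of_eq ?_)
      · gcongr
        exact le_iSup (fun r : Ioo (0 : ℝ) 1 => dirichletMean μ₁ (fun z e => f (z, e)) r) r
      · ring
  -- For the other partial derivative the first coordinate is a constant of modulus less than 1.
  have h2 : (⨆ r : Ioo (0 : ℝ) 1, dirichletMean μ₂ (fun z e => e * f (e, z)) r) ≤
      ⨆ r : Ioo (0 : ℝ) 1, dirichletMean μ₂ (fun z e => f (e, z)) r := by
    refine iSup_mono fun r => lintegral_mono fun θ => lintegral_mono fun z => ?_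
    have h : ‖circleMap 0 r θ‖ₑ ≤ 1 := by
      rw [← ofReal_norm]
      exact ENNReal.ofReal_le_one.2 (circleMap_mem r.2 θ).le
    simp only [deriv_const_mul_field, enorm_mul]
    gcongr
    exact mul_le_of_le_one_left' h
  unfold normSq dirichletIntegral
  refine (add_le_add (hardyNormSq_mul_fst_le f) (add_le_add h1 h2)).trans ?_
  set A := hardyNormSq f
  set B := ⨆ r : Ioo (0 : ℝ) 1, dirichletMean μ₁ (fun z e => f (z, e)) r
  set C := ⨆ r : Ioo (0 : ℝ) 1, dirichletMean μ₂ (fun z e => f (e, z)) r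
  calc A + (2 * B + 48 * μ₁ univ * A + C) ≤
        (A + (2 * B + 48 * μ₁ univ * A + C)) + (A + C + 48 * μ₁ univ * (B + C)) := le_self_add
    _ = (2 + 48 * μ₁ univ) * (A + (B + C)) := by ring

lemma normSq_swap (μ₁ μ₂ : Measure (closedBall (0 : ℂ) 1)) {f : ℂ × ℂ → ℂ}
    (hf : DifferentiableOn ℂ f bidisc) :
    normSq μ₂ μ₁ (fun p => f (p.2, p.1)) = normSq μ₁ μ₂ f := by
  unfold normSq dirichletIntegral
  rw [hardyNormSq_swap hf, add_comm (⨆ r : Ioo (0 : ℝ) 1, dirichletMean μ₁ _ _)]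

/-! ### Osgood's lemma, Fatou's lemma and completeness. -/

/-- The first partial derivative of a continuous function on the bidisc which is holomorphic in
the first variable is continuous. -/
lemma continuousOn_partial_of_slice {F : ℂ → ℂ → ℂ}
    (hc : ContinuousOn (fun p : ℂ × ℂ => F p.1 p.2) bidisc)
    (hF : ∀ e : ℂ, ‖e‖ < 1 → DifferentiableOn ℂ (fun w => F w e) (ball 0 1)) :
    ContinuousOn (fun p : ℂ × ℂ => deriv (fun w => F w p.2) p.1) bidisc := by
  intro p hp
  refine ContinuousAt.continuousWithinAt ?_
  have hb : ball (0 : ℂ) 1 ∈ 𝓝 p.2 := isOpen_ball.mem_nhds (by simpa using hp.2)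
  -- Joint continuity makes nearby slices converge locally uniformly, and Weierstrass's theorem
  -- transfers this to their derivatives.
  have h1 : TendstoLocallyUniformlyOn (fun (e : ℂ) (w : ℂ) => F w e) (fun w => F w p.2) (𝓝 p.2)
      (ball 0 1) := by
    rw [tendstoLocallyUniformlyOn_iff_forall_isCompact isOpen_ball]
    intro K hK hKc
    have hc : ContinuousOn (Function.uncurry fun (e : ℂ) (w : ℂ) => F w e) (ball 0 1 ×ˢ K) := by
      refine hc.comp (f := Prod.swap) continuous_swap.continuousOn ?_
      rintro ⟨e, w⟩ ⟨he, hw⟩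
      exact ⟨by simpa using hK hw, by simpa using he⟩
    intro u hu
    obtain ⟨v, hv, hvu⟩ := hKc.mem_uniformity_of_prod hc (mem_of_mem_nhds hb) (symm_le_uniformity hu)
    rw [nhdsWithin_eq_nhds.2 hb] at hv
    filter_upwards [hv] with e he w hw using hvu e he w hw
  have h2 := h1.deriv (by
    filter_upwards [hb] with e he
    exact hF e (by simpa using he)) isOpen_ball
  have hz : ball (0 : ℂ) 1 ∈ 𝓝 p.1 := isOpen_ball.mem_nhds (by simpa using hp.1)
  refine tendsto_comp_of_locally_uniform_limit_within (g := fun q : ℂ × ℂ => q.1)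
    (F := fun (q : ℂ × ℂ) => deriv fun w => F w q.2) (f := deriv fun w => F w p.2)
    (x := p.1) (s := ball 0 1)
    (((hF p.2 hp.2).deriv isOpen_ball).continuousOn p.1 (mem_of_mem_nhds hz))
    (by rw [nhdsWithin_eq_nhds.2 hz]; exact continuous_fst.continuousAt) fun u hu => ?_
  obtain ⟨t, ht, h⟩ := h2 u hu p.1 (mem_of_mem_nhds hz)
  exact ⟨t, ht, continuous_snd.continuousAt.eventually h⟩

/-- Osgood's lemma on the bidisc: a continuous, separately holomorphic function is holomorphic. -/
lemma differentiableOn_of_slices {f : ℂ × ℂ → ℂ} (hc : ContinuousOn f bidisc)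
    (h1 : ∀ e : ℂ, ‖e‖ < 1 → DifferentiableOn ℂ (fun w => f (w, e)) (ball 0 1))
    (h2 : ∀ e : ℂ, ‖e‖ < 1 → DifferentiableOn ℂ (fun w => f (e, w)) (ball 0 1)) :
    DifferentiableOn ℂ f bidisc := by
  have hcs : ContinuousOn (fun p : ℂ × ℂ => f (p.2, p.1)) bidisc :=
    hc.comp continuous_swap.continuousOn fun p hp => ⟨hp.2, hp.1⟩
  have c1 := continuousOn_partial_of_slice (F := fun a b => f (a, b)) hc h1
  have c2' := continuousOn_partial_of_slice (F := fun a b => f (b, a)) hcs h2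
  have c2 : ContinuousOn (fun p : ℂ × ℂ => deriv (fun w => f (p.1, w)) p.2) bidisc :=
    c2'.comp (f := Prod.swap) continuous_swap.continuousOn fun p hp => ⟨hp.2, hp.1⟩
  intro p hp
  have hn := isOpen_bidisc.mem_nhds hp
  -- Both partial derivatives are continuous, which gives joint differentiability.
  have key := hasStrictFDerivAt_uncurry_coprod (𝕜 := ℂ) (u := p) (f := fun a b => f (a, b))
    (f₁ := fun a b => ContinuousLinearMap.toSpanSingleton ℂ (deriv (fun w => f (w, b)) a))
    (f₂ := fun a b => ContinuousLinearMap.toSpanSingleton ℂ (deriv (fun w => f (a, w)) b))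
    (by
      filter_upwards [hn] with q hq
      exact ((h1 q.2 hq.2).differentiableAt
        (isOpen_ball.mem_nhds (by simpa using hq.1))).hasDerivAt.hasFDerivAt)
    (by
      filter_upwards [hn] with q hq
      exact ((h2 q.1 hq.1).differentiableAt
        (isOpen_ball.mem_nhds (by simpa using hq.2))).hasDerivAt.hasFDerivAt)
    ((ContinuousLinearMap.toSpanSingletonCLE (𝕜 := ℂ) (E := ℂ)).continuous.continuousAt.comp
      (c1.continuousAt hn))
    ((ContinuousLinearMap.toSpanSingletonCLE (𝕜 := ℂ) (E := ℂ)).continuous.continuousAt.comp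
      (c2.continuousAt hn))
  exact key.hasFDerivAt.differentiableAt.differentiableWithinAt

/-- Fatou's lemma for weighted square means. -/
lemma lintegral_sq_le_of_tendsto {X : Type*} [MeasurableSpace X] {ν : Measure X} {u : X → ℝ≥0∞}
    {A : ℕ → X → ℂ} {B : X → ℂ} {c : ℝ≥0∞} (hu : Measurable u) (hA : ∀ n, Measurable (A n))
    (h : ∀ x, Tendsto (fun n => A n x) atTop (𝓝 (B x)))
    (hc : ∀ᶠ n in atTop, ∫⁻ x, ‖A n x‖ₑ ^ 2 * u x ∂ν ≤ c) :
    ∫⁻ x, ‖B x‖ₑ ^ 2 * u x ∂ν ≤ c := by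
  calc ∫⁻ x, ‖B x‖ₑ ^ 2 * u x ∂ν
      ≤ ∫⁻ x, liminf (fun n => ‖A n x‖ₑ ^ 2 * u x) atTop ∂ν := by
        refine lintegral_mono fun x => ?_
        -- Where `B x = 0` the weight may be infinite and the products need not converge, but the
        -- left side is zero there.
        rcases eq_or_ne (B x) 0 with h0 | h0
        · simp [h0]
        · have h1 : Tendsto (fun n => ‖A n x‖ₑ ^ 2 * u x) atTop (𝓝 (‖B x‖ₑ ^ 2 * u x)) :=
            ENNReal.Tendsto.mul_const (ENNReal.Tendsto.pow (h x).enorm) (Or.inl (by simpa using h0))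
          exact h1.liminf_eq.ge
    _ ≤ liminf (fun n => ∫⁻ x, ‖A n x‖ₑ ^ 2 * u x ∂ν) atTop :=
        lintegral_liminf_le fun n => ((hA n).enorm.pow_const 2).mul hu
    _ ≤ c := liminf_le_of_frequently_le' hc.frequently

lemma dirichletMean_le_of_tendsto (μ : Measure (closedBall (0 : ℂ) 1)) [IsFiniteMeasure μ]
    {v : ℕ → ℂ → ℂ → ℂ} {V : ℂ → ℂ → ℂ}
    (hv : ∀ n, DifferentiableOn ℂ (fun p : ℂ × ℂ => v n p.1 p.2) bidisc)
    (hV : DifferentiableOn ℂ (fun p : ℂ × ℂ => V p.1 p.2) bidisc)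
    (h : ∀ z e : ℂ, ‖z‖ < 1 → ‖e‖ < 1 →
      Tendsto (fun n => deriv (fun w => v n w e) z) atTop (𝓝 (deriv (fun w => V w e) z)))
    {c : ℝ≥0∞} {r : ℝ} (hr : r ∈ Ioo (0 : ℝ) 1) (hc : ∀ᶠ n in atTop, dirichletMean μ (v n) r ≤ c) :
    dirichletMean μ V r ≤ c := by
  rw [dirichletMean_eq μ hV hr]
  refine lintegral_sq_le_of_tendsto ((measurable_potential μ).comp measurable_snd)
    (fun n => measurable_energy μ (hv n) r) (fun p => ?_) (hc.mono fun n hn => ?_)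
  · by_cases hp : (p.2, circleMap 0 r p.1) ∈ bidisc
    · simp only [partialExt, indicator_of_mem hp]
      exact h _ _ hp.1 hp.2
    · simp only [partialExt, indicator_of_notMem hp]
      exact tendsto_const_nhds
  · rwa [dirichletMean_eq μ (hv n) hr] at hn

/-- Lower semicontinuity of the norm, up to a constant. -/
lemma normSq_le_of_tendsto (μ₁ μ₂ : Measure (closedBall (0 : ℂ) 1)) [IsFiniteMeasure μ₁]
    [IsFiniteMeasure μ₂] {v : ℕ → ℂ × ℂ → ℂ} {V : ℂ × ℂ → ℂ}
    (hv : ∀ n, DifferentiableOn ℂ (v n) bidisc)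
    (h : TendstoLocallyUniformlyOn v V atTop bidisc) (hV : DifferentiableOn ℂ V bidisc) {c : ℝ≥0∞}
    (hc : ∀ᶠ n in atTop, normSq μ₁ μ₂ (v n) ≤ c) : normSq μ₁ μ₂ V ≤ 3 * c := by
  have hslice1 : ∀ z e : ℂ, ‖z‖ < 1 → ‖e‖ < 1 → Tendsto (fun n => deriv (fun w => v n (w, e)) z)
      atTop (𝓝 (deriv (fun w => V (w, e)) z)) := by
    intro z e hz he
    have h1 : TendstoLocallyUniformlyOn (fun n w => v n (w, e)) (fun w => V (w, e)) atTop
        (ball 0 1) :=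
      h.comp (fun w : ℂ => (w, e)) (fun w hw => ⟨by simpa using hw, he⟩) (by fun_prop)
    exact (h1.deriv (Eventually.of_forall fun n => differentiableOn_slice
      (F := fun a b => v n (a, b)) (hv n) he) isOpen_ball).tendsto_at (by simpa using hz)
  have hslice2 : ∀ z e : ℂ, ‖z‖ < 1 → ‖e‖ < 1 → Tendsto (fun n => deriv (fun w => v n (e, w)) z)
      atTop (𝓝 (deriv (fun w => V (e, w)) z)) := by
    intro z e hz he
    have h1 : TendstoLocallyUniformlyOn (fun n w => v n (e, w)) (fun w => V (e, w)) atTop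
        (ball 0 1) :=
      h.comp (fun w : ℂ => (e, w)) (fun w hw => ⟨he, by simpa using hw⟩) (by fun_prop)
    exact (h1.deriv (Eventually.of_forall fun n => differentiableOn_slice'
      (F := fun a b => v n (a, b)) (hv n) he) isOpen_ball).tendsto_at (by simpa using hz)
  -- Each of the three suprema in the norm is bounded by `c` separately, whence the factor 3.
  have a1 : hardyNormSq V ≤ c := by
    refine iSup_le fun r => ?_
    rw [hardyMean_eq hV r.2]
    refine lintegral_sq_le_of_tendsto measurable_const
      (fun n => (continuous_torus (hv n) r.2 r.2).measurable)
      (fun p => h.tendsto_at ⟨circleMap_mem r.2 p.1, circleMap_mem r.2 p.2⟩)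
      (hc.mono fun n hn => ?_)
    rw [← hardyMean_eq (hv n) r.2]
    exact ((le_iSup (fun r : Ioo (0 : ℝ) 1 => hardyMean (v n) r) r).trans le_self_add).trans hn
  have a2 : (⨆ r : Ioo (0 : ℝ) 1, dirichletMean μ₁ (fun z e => V (z, e)) r) ≤ c := by
    refine iSup_le fun r => ?_
    refine dirichletMean_le_of_tendsto μ₁ (v := fun n z e => v n (z, e)) hv hV hslice1 r.2
      (hc.mono fun n hn => ?_)
    exact (((le_iSup (fun r : Ioo (0 : ℝ) 1 => dirichletMean μ₁ (fun z e => v n (z, e)) r) r).trans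
      le_self_add).trans le_add_self).trans hn
  have a3 : (⨆ r : Ioo (0 : ℝ) 1, dirichletMean μ₂ (fun z e => V (e, z)) r) ≤ c := by
    refine iSup_le fun r => ?_
    refine dirichletMean_le_of_tendsto μ₂ (v := fun n z e => v n (e, z))
      (fun n => differentiableOn_swap (hv n)) (differentiableOn_swap hV) hslice2 r.2
      (hc.mono fun n hn => ?_)
    exact (((le_iSup (fun r : Ioo (0 : ℝ) 1 => dirichletMean μ₂ (fun z e => v n (e, z)) r) r).trans
      le_add_self).trans le_add_self).trans hn
  refine (add_le_add a1 (add_le_add a2 a3)).trans (le_of_eq ?_)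
  ring

namespace DirichletSpace

variable {μ₁ μ₂ : Measure (closedBall (0 : ℂ) 1)} [IsFiniteMeasure μ₁] [IsFiniteMeasure μ₂]

lemma ofReal_norm_sq (f : DirichletSpace μ₁ μ₂) :
    ENNReal.ofReal (‖f‖ ^ 2) = normSq μ₁ μ₂ f := by
  rw [norm_sq, ENNReal.ofReal_toReal (normSq_ne_top f)]

@[ext]
lemma ext {f g : DirichletSpace μ₁ μ₂} (h : ∀ z ∈ bidisc, f z = g z) : f = g := by
  refine Subtype.ext (funext fun z => ?_)
  by_cases hz : z ∈ bidisc
  · exact h z hz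
  · exact (f.2.2.1 z hz).trans (g.2.2.1 z hz).symm

lemma sub_apply (f g : DirichletSpace μ₁ μ₂) (z : ℂ × ℂ) : (f - g) z = f z - g z := rfl

lemma smul_apply (c : ℂ) (f : DirichletSpace μ₁ μ₂) (z : ℂ × ℂ) : (c • f) z = c * f z := rfl

/-- The element of the space given by a holomorphic function on the bidisc of finite norm. -/
def mk (f : ℂ × ℂ → ℂ) (hf : DifferentiableOn ℂ f bidisc) (h : normSq μ₁ μ₂ f < ⊤) :
    DirichletSpace μ₁ μ₂ :=
  ⟨bidisc.indicator f, by
    have he : EqOn (bidisc.indicator f) f bidisc := eqOn_indicator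
    have h1 : normSq μ₁ μ₂ (bidisc.indicator f) < ⊤ := by rwa [normSq_congr μ₁ μ₂ he]
    have h2 := ENNReal.add_lt_top.1 h1
    exact ⟨hf.congr he, fun z hz => indicator_of_notMem hz f, h2.1, h2.2⟩⟩

lemma mk_apply {f : ℂ × ℂ → ℂ} (hf : DifferentiableOn ℂ f bidisc) (h : normSq μ₁ μ₂ f < ⊤)
    {z : ℂ × ℂ} (hz : z ∈ bidisc) : mk f hf h z = f z := indicator_of_mem hz f

/-- Point evaluations are locally uniformly bounded. -/
lemma norm_apply_le {s : ℝ} (hs0 : 0 ≤ s) (hs : s < 1) (f : DirichletSpace μ₁ μ₂) {z : ℂ × ℂ}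
    (h1 : ‖z.1‖ ≤ s) (h2 : ‖z.2‖ ≤ s) : ‖f z‖ ≤ (1 - s ^ 2)⁻¹ * ‖f‖ := by
  have hs2 : 0 < 1 - s ^ 2 := by nlinarith
  have h := enorm_sq_le_hardyNormSq f.2.1 (w := z) ⟨h1.trans_lt hs, h2.trans_lt hs⟩
  have e1 : ENNReal.ofReal (1 - ‖z.1‖ ^ 2)⁻¹ ≤ ENNReal.ofReal (1 - s ^ 2)⁻¹ := by gcongr
  have e2 : ENNReal.ofReal (1 - ‖z.2‖ ^ 2)⁻¹ ≤ ENNReal.ofReal (1 - s ^ 2)⁻¹ := by gcongr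
  have e3 : hardyNormSq f ≤ ENNReal.ofReal (‖f‖ ^ 2) := by
    rw [ofReal_norm_sq]
    exact le_self_add
  have h3 := h.trans (mul_le_mul' e1 (mul_le_mul' e2 e3))
  rw [← ofReal_norm, ← ENNReal.ofReal_pow (norm_nonneg _), ← ENNReal.ofReal_mul (by positivity),
    ← ENNReal.ofReal_mul (by positivity), ENNReal.ofReal_le_ofReal_iff (by positivity)] at h3
  refine (pow_le_pow_iff_left₀ (norm_nonneg _) (by positivity) two_ne_zero).1 (h3.trans_eq ?_)
  ring

/-- Point evaluations are uniformly bounded on each smaller closed polydisc, so a norm-Cauchy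
sequence is uniformly Cauchy there. The values of `V` off the bidisc are irrelevant. -/
lemma tendstoLocallyUniformlyOn_of_cauchySeq {u : ℕ → DirichletSpace μ₁ μ₂} (hu : CauchySeq u) :
    ∃ V : ℂ × ℂ → ℂ, TendstoLocallyUniformlyOn (fun n => (u n : ℂ × ℂ → ℂ)) V atTop bidisc := by
  have hunif : ∀ s : ℝ, 0 ≤ s → s < 1 →
      UniformCauchySeqOn (fun n => (u n : ℂ × ℂ → ℂ)) atTop {z | ‖z.1‖ ≤ s ∧ ‖z.2‖ ≤ s} := by
    intro s hs0 hs
    have hs2 : 0 < 1 - s ^ 2 := by nlinarith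
    rw [Metric.uniformCauchySeqOn_iff]
    intro ε hε
    obtain ⟨N, hN⟩ := Metric.cauchySeq_iff.1 hu ((1 - s ^ 2) * ε) (by positivity)
    refine ⟨N, fun m hm n hn z hz => ?_⟩
    have h1 := norm_apply_le hs0 hs (u m - u n) hz.1 hz.2
    have h2 := hN m hm n hn
    rw [dist_eq_norm] at h2 ⊢
    calc ‖u m z - u n z‖ ≤ (1 - s ^ 2)⁻¹ * ‖u m - u n‖ := h1
      _ < (1 - s ^ 2)⁻¹ * ((1 - s ^ 2) * ε) := by gcongr
      _ = ε := by field_simp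
  have hlim : ∀ z : ℂ × ℂ, ∃ a, z ∈ bidisc → Tendsto (fun n => u n z) atTop (𝓝 a) := by
    intro z
    by_cases hz : z ∈ bidisc
    · obtain ⟨a, ha⟩ := cauchySeq_tendsto_of_complete
        ((hunif (max ‖z.1‖ ‖z.2‖) (le_max_of_le_left (norm_nonneg _)) (max_lt hz.1 hz.2)).cauchySeq
          (x := z) ⟨le_max_left _ _, le_max_right _ _⟩)
      exact ⟨a, fun _ => ha⟩
    · exact ⟨0, fun h => absurd h hz⟩
  choose V hV using hlim
  refine ⟨V, fun U hU z hz => ?_⟩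
  obtain ⟨s, hs, hs1⟩ := exists_between (max_lt hz.1 hz.2)
  have hs0 : 0 ≤ s := (le_max_of_le_left (norm_nonneg _)).trans hs.le
  have h1 := (hunif s hs0 hs1).tendstoUniformlyOn_of_tendsto fun w hw =>
    hV w ⟨hw.1.trans_lt hs1, hw.2.trans_lt hs1⟩
  refine ⟨{z | ‖z.1‖ ≤ s ∧ ‖z.2‖ ≤ s}, mem_nhdsWithin_of_mem_nhds ?_, h1 U hU⟩
  have h2 : {z : ℂ × ℂ | ‖z.1‖ < s ∧ ‖z.2‖ < s} ∈ 𝓝 z :=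
    ((isOpen_lt continuous_fst.norm continuous_const).inter
      (isOpen_lt continuous_snd.norm continuous_const)).mem_nhds
      ⟨(le_max_left _ _).trans_lt hs, (le_max_right _ _).trans_lt hs⟩
  exact mem_of_superset h2 fun w hw => ⟨hw.1.le, hw.2.le⟩

/-- The locally uniform limit is holomorphic on slices, hence holomorphic by Osgood's lemma. Lower
semicontinuity of the norm, applied to `u n - u m` as `n → ∞`, gives both finiteness of the limit's
norm and convergence. -/
instance : CompleteSpace (DirichletSpace μ₁ μ₂) := by
  refine Metric.complete_of_cauchySeq_tendsto fun u hu => ?_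
  obtain ⟨V, hV⟩ := tendstoLocallyUniformlyOn_of_cauchySeq hu
  have hVd : DifferentiableOn ℂ V bidisc := by
    refine differentiableOn_of_slices (hV.continuousOn
      (Frequently.of_forall fun n => (u n).2.1.continuousOn)) (fun e he => ?_) fun e he => ?_
    · have h1 : TendstoLocallyUniformlyOn (fun n w => u n (w, e)) (fun w => V (w, e)) atTop
          (ball 0 1) :=
        hV.comp (fun w : ℂ => (w, e)) (fun w hw => ⟨by simpa using hw, he⟩) (by fun_prop)
      exact h1.differentiableOn (Eventually.of_forall fun n => differentiableOn_slice
        (F := fun a b => u n (a, b)) (u n).2.1 he) isOpen_ball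
    · have h1 : TendstoLocallyUniformlyOn (fun n w => u n (e, w)) (fun w => V (e, w)) atTop
          (ball 0 1) :=
        hV.comp (fun w : ℂ => (e, w)) (fun w hw => ⟨he, by simpa using hw⟩) (by fun_prop)
      exact h1.differentiableOn (Eventually.of_forall fun n => differentiableOn_slice'
        (F := fun a b => u n (a, b)) (u n).2.1 he) isOpen_ball
  have hle : ∀ (c : ℝ) (m : ℕ), (∀ᶠ n in atTop, ‖u n - u m‖ ^ 2 ≤ c) →
      normSq μ₁ μ₂ (fun z => V z - u m z) ≤ 3 * ENNReal.ofReal c := by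
    intro c m hc
    refine normSq_le_of_tendsto μ₁ μ₂ (v := fun n z => u n z - u m z)
      (fun n => (u n).2.1.sub (u m).2.1) ?_ (hVd.sub (u m).2.1) (hc.mono fun n hn => ?_)
    · intro U hU z hz
      obtain ⟨δ, hδ, hδU⟩ := Metric.mem_uniformity_dist.1 hU
      obtain ⟨t, ht, h⟩ := hV _ (Metric.dist_mem_uniformity hδ) z hz
      refine ⟨t, ht, h.mono fun n hn w hw => hδU ?_⟩
      exact (dist_sub_right (V w) (u n w) (u m w)).trans_lt (hn w hw)
    · exact (ofReal_norm_sq (u n - u m)).symm.le.trans (ENNReal.ofReal_le_ofReal hn)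
  have hev : ∀ ε > (0 : ℝ), ∀ᶠ m in atTop, ∀ᶠ n in atTop, ‖u n - u m‖ ^ 2 ≤ ε := by
    intro ε hε
    obtain ⟨N, hN⟩ := Metric.cauchySeq_iff.1 hu (√ε) (Real.sqrt_pos.2 hε)
    filter_upwards [eventually_ge_atTop N] with m hm
    filter_upwards [eventually_ge_atTop N] with n hn
    have := hN n hn m hm
    rw [dist_eq_norm] at this
    calc ‖u n - u m‖ ^ 2 ≤ √ε ^ 2 := by gcongr
      _ = ε := Real.sq_sqrt hε.le
  obtain ⟨m₀, hm₀⟩ := (hev 1 one_pos).exists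
  have hVfin : normSq μ₁ μ₂ V < ⊤ := by
    have h1 := normSq_add_le μ₁ μ₂ (hVd.sub (u m₀).2.1) (u m₀).2.1 1 one_ne_zero
    rw [sub_add_cancel] at h1
    refine h1.trans_lt (ENNReal.add_lt_top.2 ⟨ENNReal.mul_lt_top ENNReal.coe_lt_top
      ((hle 1 m₀ hm₀).trans_lt (ENNReal.mul_lt_top (by simp) (by simp))),
      ENNReal.mul_lt_top ENNReal.coe_lt_top (normSq_ne_top (u m₀)).lt_top⟩)
  refine ⟨mk V hVd hVfin, ?_⟩
  rw [Metric.tendsto_nhds]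
  intro ε hε
  -- The loss of a factor 3 turns `ε² / 6` into `ε² / 2 < ε²`.
  filter_upwards [hev (ε ^ 2 / 6) (by positivity)] with m hm
  have h1 : normSq μ₁ μ₂ (mk V hVd hVfin - u m : DirichletSpace μ₁ μ₂) ≤
      3 * ENNReal.ofReal (ε ^ 2 / 6) := by
    refine le_of_eq_of_le (normSq_congr μ₁ μ₂ fun z hz => ?_) (hle _ m hm)
    rw [sub_apply, mk_apply hVd hVfin hz]
  rw [← ofReal_norm_sq, show (3 : ℝ≥0∞) = ENNReal.ofReal 3 by simp,
    ← ENNReal.ofReal_mul (by norm_num), ENNReal.ofReal_le_ofReal_iff (by positivity)] at h1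
  rw [dist_comm, dist_eq_norm]
  refine (pow_lt_pow_iff_left₀ (norm_nonneg _) hε.le two_ne_zero).1 (h1.trans_lt ?_)
  nlinarith [pow_pos hε 2]

end DirichletSpace

/-! ### Freezing a variable and dividing by a coordinate factor. -/

/-- Only radii near 1 matter, so circles near a pole inside the disc can be ignored. -/
lemma iSup_le_of_monotone {a : Ioo (0 : ℝ) 1 → ℝ≥0∞} (ha : Monotone a) {ρ : ℝ}
    (hρ : ρ ∈ Ioo (0 : ℝ) 1) {c : ℝ≥0∞} (h : ∀ r : Ioo (0 : ℝ) 1, ρ ≤ r → a r ≤ c) :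
    iSup a ≤ c :=
  iSup_le fun r => (ha (le_max_left r ⟨ρ, hρ⟩)).trans (h _ (le_max_right r (⟨ρ, hρ⟩ : Ioo (0 : ℝ) 1)))

/-- For fixed `z` the derivative `∂₁F(z, ·)` is holomorphic, so the growth estimate bounds its value
at `ξ` by its means over circles. Monotone convergence and Tonelli turn these into Dirichlet means.
-/
lemma lintegral_partial_le (μ : Measure (closedBall (0 : ℂ) 1)) [IsFiniteMeasure μ]
    {F : ℂ → ℂ → ℂ} (hF : DifferentiableOn ℂ (fun p : ℂ × ℂ => F p.1 p.2) bidisc) {ξ : ℂ}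
    (hξ : ‖ξ‖ < 1) :
    ∫⁻ z, ‖deriv (fun w => F w ξ) z‖ₑ ^ 2 * potential μ z ∂area ≤
      ENNReal.ofReal (1 - ‖ξ‖ ^ 2)⁻¹ * ⨆ r : Ioo (0 : ℝ) 1, dirichletMean μ F r := by
  have hU := measurable_potential μ
  have hcirc : ∀ z : ℂ, ‖z‖ < 1 → ∀ n, circleMean (fun e => deriv (fun w => F w e) z) (radius n) =
      ∫⁻ θ, ‖partialExt F (z, circleMap 0 (radius n) θ)‖ₑ ^ 2 ∂angle := by
    intro z hz n
    refine lintegral_congr fun θ => ?_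
    have : (z, circleMap 0 (radius n) θ) ∈ bidisc := ⟨hz, circleMap_mem (radius_mem n) θ⟩
    rw [partialExt, indicator_of_mem this]
  have hm : ∀ n, Measurable fun z =>
      ∫⁻ θ, ‖partialExt F (z, circleMap 0 (radius n) θ)‖ₑ ^ 2 ∂angle := fun n =>
    Measurable.lintegral_prod_right' (f := fun p : ℂ × ℝ =>
      ‖partialExt F (p.1, circleMap 0 (radius n) p.2)‖ₑ ^ 2)
      (((measurable_energy μ hF (radius n)).comp measurable_swap).enorm.pow_const 2)
  calc ∫⁻ z, ‖deriv (fun w => F w ξ) z‖ₑ ^ 2 * potential μ z ∂area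
      ≤ ∫⁻ z, ENNReal.ofReal (1 - ‖ξ‖ ^ 2)⁻¹ * ⨆ n, (∫⁻ θ,
          ‖partialExt F (z, circleMap 0 (radius n) θ)‖ₑ ^ 2 ∂angle) * potential μ z ∂area := by
        refine lintegral_mono_ae ?_
        filter_upwards [ae_area] with z hz
        have hz1 : ‖z‖ < 1 := by simpa using hz
        have h := enorm_sq_le_discNormSq (differentiableOn_partial hF hz1) hξ
        simp only [discNormSq, hcirc z hz1] at h
        rw [← ENNReal.iSup_mul, ← mul_assoc]
        gcongr
    _ = ENNReal.ofReal (1 - ‖ξ‖ ^ 2)⁻¹ * ⨆ n, ∫⁻ z, (∫⁻ θ,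
          ‖partialExt F (z, circleMap 0 (radius n) θ)‖ₑ ^ 2 ∂angle) * potential μ z ∂area := by
        rw [lintegral_const_mul' _ _ ENNReal.ofReal_ne_top,
          lintegral_iSup' fun n => by exact ((hm n).mul hU).aemeasurable]
        filter_upwards [ae_area] with z hz
        have hz1 : ‖z‖ < 1 := by simpa using hz
        intro m n hmn
        simp only [← hcirc z hz1]
        gcongr ?_ * _
        exact monotone_circleMean_radius (differentiableOn_partial hF hz1) hmn
    _ ≤ _ := by
        gcongr
        refine iSup_le fun n => le_trans (le_of_eq ?_)
          (le_iSup (fun r : Ioo (0 : ℝ) 1 => dirichletMean μ F r) ⟨_, radius_mem n⟩)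
        rw [dirichletMean_eq_iterated μ (radius_mem n), lintegral_lintegral_swap]
        · refine lintegral_congr fun z => ?_
          rw [lintegral_mul_const]
          exact ((measurable_partialExt hF).comp
            (measurable_const.prodMk (measurable_circle _))).enorm.pow_const 2
        · exact (((measurable_energy μ hF _).enorm.pow_const 2).mul
            (hU.comp measurable_snd)).aemeasurable

/-- Freezing the first variable is bounded. -/
lemma normSq_freeze_fst_le (μ₁ μ₂ : Measure (closedBall (0 : ℂ) 1)) [IsFiniteMeasure μ₁]
    [IsFiniteMeasure μ₂] {f : ℂ × ℂ → ℂ} (hf : DifferentiableOn ℂ f bidisc) {ξ : ℂ}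
    (hξ : ‖ξ‖ < 1) :
    normSq μ₁ μ₂ (fun z => f (ξ, z.2)) ≤ ENNReal.ofReal (1 - ‖ξ‖ ^ 2)⁻¹ * normSq μ₁ μ₂ f := by
  have h1 : hardyNormSq (fun z => f (ξ, z.2)) ≤
      ENNReal.ofReal (1 - ‖ξ‖ ^ 2)⁻¹ * hardyNormSq f := by
    refine iSup_le fun r => ?_
    simp only [hardyMean, lintegral_const, angle_univ, mul_one]
    calc ∫⁻ θ, ‖f (ξ, circleMap 0 r θ)‖ₑ ^ 2 ∂angle
        ≤ ∫⁻ θ, ENNReal.ofReal (1 - ‖ξ‖ ^ 2)⁻¹ *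
            discNormSq (fun w => f (w, circleMap 0 r θ)) ∂angle :=
          lintegral_mono fun θ => enorm_sq_le_discNormSq (h := fun w => f (w, circleMap 0 r θ))
            (differentiableOn_slice (F := fun a b => f (a, b)) hf (circleMap_mem r.2 θ)) hξ
      _ ≤ _ := by
          rw [lintegral_const_mul' _ _ ENNReal.ofReal_ne_top]
          gcongr
          exact lintegral_discNormSq_le hf r.2
  have h2 : (⨆ r : Ioo (0 : ℝ) 1, dirichletMean μ₁ (fun _ e => f (ξ, e)) r) = 0 := by
    simp [dirichletMean]
  have h3 : (⨆ r : Ioo (0 : ℝ) 1, dirichletMean μ₂ (fun z _ => f (ξ, z)) r) ≤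
      ENNReal.ofReal (1 - ‖ξ‖ ^ 2)⁻¹ *
        ⨆ r : Ioo (0 : ℝ) 1, dirichletMean μ₂ (fun z e => f (e, z)) r := by
    refine iSup_le fun r => ?_
    simp only [dirichletMean, lintegral_const, angle_univ, mul_one]
    exact lintegral_partial_le μ₂ (F := fun z e => f (e, z)) (differentiableOn_swap hf) hξ
  unfold normSq dirichletIntegral
  rw [h2, zero_add]
  refine (add_le_add h1 h3).trans ?_
  rw [← mul_add]
  gcongr
  exact le_add_self

/-- The difference quotient `(f(z₁, z₂) - f(ξ, z₂)) / (z₁ - ξ)`. -/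
def quotientFst (f : ℂ × ℂ → ℂ) (ξ : ℂ) (p : ℂ × ℂ) : ℂ := dslope (fun w => f (w, p.2)) ξ p.1

lemma sub_mul_quotientFst (f : ℂ × ℂ → ℂ) (ξ : ℂ) (p : ℂ × ℂ) :
    (p.1 - ξ) * quotientFst f ξ p = f p - f (ξ, p.2) :=
  sub_smul_dslope (fun w => f (w, p.2)) ξ p.1

lemma quotientFst_of_ne (f : ℂ × ℂ → ℂ) {ξ : ℂ} {p : ℂ × ℂ} (h : p.1 ≠ ξ) :
    quotientFst f ξ p = (p.1 - ξ)⁻¹ * (f p - f (ξ, p.2)) := by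
  rw [← sub_mul_quotientFst f, inv_mul_cancel_left₀ (sub_ne_zero.2 h)]

/-- Only points with `z₁ = ξ` need care. There the quotient is an average of `∂₁f` in spirit, and
the joint continuity of `∂₁f` controls it through the mean value inequality. -/
lemma continuousOn_quotientFst {f : ℂ × ℂ → ℂ} (hf : DifferentiableOn ℂ f bidisc) {ξ : ℂ}
    (hξ : ‖ξ‖ < 1) : ContinuousOn (quotientFst f ξ) bidisc := by
  intro p hp
  refine ContinuousAt.continuousWithinAt ?_
  by_cases hpξ : p.1 = ξ
  · have hmem : (ξ, p.2) ∈ bidisc := ⟨hξ, hp.2⟩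
    have hp' : p = (ξ, p.2) := Prod.ext hpξ rfl
    have hc := (continuousOn_partial (F := fun a b => f (a, b)) hf).continuousAt
      (isOpen_bidisc.mem_nhds hp)
    have hval : quotientFst f ξ p = deriv (fun w => f (w, p.2)) p.1 := by
      rw [quotientFst, hpξ, dslope_same]
    rw [Metric.continuousAt_iff'] at hc ⊢
    intro ε hε
    obtain ⟨δ, hδ, hball⟩ := Metric.mem_nhds_iff.1
      (inter_mem (hc (ε / 2) (half_pos hε)) (isOpen_bidisc.mem_nhds hp))
    filter_upwards [ball_mem_nhds p hδ] with q hq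
    rw [hval]
    set c := deriv (fun w => f (w, p.2)) p.1
    have hq2 : dist q.2 p.2 < δ := (le_max_right _ _).trans_lt hq
    have hin : ∀ x ∈ ball ξ δ, (x, q.2) ∈ ball p δ := fun x hx => by
      rw [mem_ball, Prod.dist_eq, hpξ]
      exact max_lt hx hq2
    have hder : ∀ x ∈ ball ξ δ, dist (deriv (fun w => f (w, q.2)) x) c ≤ ε / 2 := fun x hx =>
      le_of_lt (hball (hin x hx)).1
    by_cases hqξ : q.1 = ξ
    · rw [quotientFst, hqξ, dslope_same]
      exact (hder ξ (mem_ball_self hδ)).trans_lt (half_lt_self hε)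
    have hd : ∀ x ∈ ball ξ δ, DifferentiableAt ℂ (fun w => f (w, q.2)) x := fun x hx => by
      have hx2 := (hball (hin x hx)).2
      exact (differentiableOn_slice (F := fun a b => f (a, b)) hf hx2.2).differentiableAt
        (isOpen_ball.mem_nhds (by simpa using hx2.1))
    -- Subtracting `w * c` leaves a function with derivative at most `ε / 2`, so its difference
    -- quotient, which is `quotientFst f ξ q - c`, is at most `ε / 2`.
    have key := Convex.norm_image_sub_le_of_norm_deriv_le (𝕜 := ℂ) (s := ball ξ δ)
      (f := fun w => f (w, q.2) - w * c) (x := ξ) (y := q.1) (C := ε / 2)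
      (fun x hx => (hd x hx).sub (differentiableAt_id.mul_const _))
      (fun x hx => by
        have h : HasDerivAt (fun w => f (w, q.2) - w * c)
            (deriv (fun w => f (w, q.2)) x - 1 * c) x :=
          (hd x hx).hasDerivAt.sub ((hasDerivAt_id x).mul_const _)
        rw [h.deriv, one_mul, ← dist_eq_norm]
        exact hder x hx)
      (convex_ball ξ δ) (mem_ball_self hδ)
      (by rw [mem_ball, ← hpξ]; exact (le_max_left _ _).trans_lt hq)
    have h0 : 0 < ‖q.1 - ξ‖ := norm_pos_iff.2 (sub_ne_zero.2 hqξ)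
    have e : quotientFst f ξ q - c =
        (q.1 - ξ)⁻¹ * (f (q.1, q.2) - q.1 * c - (f (ξ, q.2) - ξ * c)) := by
      rw [quotientFst_of_ne f hqξ]
      have := sub_ne_zero.2 hqξ
      field_simp
      ring
    rw [dist_eq_norm, e, norm_mul, norm_inv]
    calc _ ≤ ‖q.1 - ξ‖⁻¹ * (ε / 2 * ‖q.1 - ξ‖) := by gcongr
      _ = ε / 2 := by field_simp
      _ < ε := half_lt_self hε
  · have h1 : ContinuousAt (fun q : ℂ × ℂ => (q.1 - ξ)⁻¹ * (f q - f (ξ, q.2))) p := by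
      refine ContinuousAt.mul (ContinuousAt.inv₀ (by fun_prop) (sub_ne_zero.2 hpξ))
        ((hf.continuousOn.continuousAt (isOpen_bidisc.mem_nhds hp)).sub ?_)
      exact ContinuousAt.comp (f := fun q : ℂ × ℂ => (ξ, q.2)) (g := f)
        (hf.continuousOn.continuousAt (isOpen_bidisc.mem_nhds ⟨hξ, hp.2⟩)) (by fun_prop)
    refine h1.congr ?_
    filter_upwards [continuous_fst.continuousAt.eventually_ne hpξ] with q hq
    exact (quotientFst_of_ne f hq).symm

/-- Osgood's lemma again: slices in `z₁` have a removable singularity, and the slice at `z₁ = ξ` is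
`∂₁f(ξ, ·)`. -/
lemma differentiableOn_quotientFst {f : ℂ × ℂ → ℂ} (hf : DifferentiableOn ℂ f bidisc) {ξ : ℂ}
    (hξ : ‖ξ‖ < 1) : DifferentiableOn ℂ (quotientFst f ξ) bidisc := by
  refine differentiableOn_of_slices (continuousOn_quotientFst hf hξ) (fun e he => ?_) fun e he => ?_
  · exact (Complex.differentiableOn_dslope (isOpen_ball.mem_nhds (by simpa using hξ))).2
      (differentiableOn_slice (F := fun a b => f (a, b)) hf he)
  · by_cases h : e = ξ
    · subst h
      refine (differentiableOn_partial (F := fun a b => f (a, b)) hf hξ).congr fun w _ => ?_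
      rw [quotientFst, dslope_same]
    · refine (((differentiableOn_slice' (F := fun a b => f (a, b)) hf he).sub
        (differentiableOn_slice' (F := fun a b => f (a, b)) hf hξ)).const_mul (e - ξ)⁻¹).congr
        fun w _ => ?_
      exact quotientFst_of_ne f (p := (e, w)) h

/-- Functions of finite norm that vanish on `{z₁ = ξ}` are divisible by `z₁ - ξ`. -/
lemma normSq_quotientFst_lt_top (μ₁ μ₂ : Measure (closedBall (0 : ℂ) 1)) [IsFiniteMeasure μ₁]
    [IsFiniteMeasure μ₂] {f : ℂ × ℂ → ℂ} (hf : DifferentiableOn ℂ f bidisc)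
    (hfin : normSq μ₁ μ₂ f < ⊤) {ξ : ℂ} (hξ : ‖ξ‖ < 1)
    (h0 : ∀ e : ℂ, ‖e‖ < 1 → f (ξ, e) = 0) : normSq μ₁ μ₂ (quotientFst f ξ) < ⊤ := by
  have hQ := differentiableOn_quotientFst hf hξ
  obtain ⟨hf1, hf23⟩ := ENNReal.add_lt_top.1 hfin
  obtain ⟨hf2, hf3⟩ := ENNReal.add_lt_top.1 hf23
  -- The midpoint between `‖ξ‖` and 1: beyond radius `ρ` the factor `z - ξ` has modulus at least `ρ
  -- - ‖ξ‖ = δ`.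
  set ρ := (1 + ‖ξ‖) / 2 with hρ
  set δ := (1 - ‖ξ‖) / 2 with hδ
  have hδ0 : 0 < δ := by linarith
  have hρm : ρ ∈ Ioo (0 : ℝ) 1 := ⟨by positivity, by linarith⟩
  set K : ℝ≥0∞ := ENNReal.ofReal (δ⁻¹ ^ 2) with hK
  have hfar : ∀ z : ℂ, ρ ≤ ‖z‖ → z ≠ ξ ∧ ‖(z - ξ)⁻¹‖ₑ ^ 2 ≤ K := by
    intro z hz
    have h1 : δ ≤ ‖z - ξ‖ := by
      have := norm_sub_norm_le z ξ
      linarith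
    refine ⟨fun h => ?_, ?_⟩
    · rw [h, sub_self, norm_zero] at h1
      linarith
    · rw [hK, ENNReal.ofReal_pow (by positivity), ← ofReal_norm, norm_inv]
      gcongr
  have hdiv : ∀ z e : ℂ, ρ ≤ ‖z‖ → ‖e‖ < 1 → quotientFst f ξ (z, e) = (z - ξ)⁻¹ * f (z, e) := by
    intro z e hz he
    rw [quotientFst_of_ne f (hfar z hz).1, h0 e he, sub_zero]
  have hcirc : ∀ r : Ioo (0 : ℝ) 1, ρ ≤ r → ∀ θ, ρ ≤ ‖circleMap 0 r θ‖ := fun r hr θ => by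
    rwa [norm_circleMap_zero, abs_of_pos r.2.1]
  have q1 : hardyNormSq (quotientFst f ξ) ≤ K * hardyNormSq f := by
    refine iSup_le_of_monotone (hardyMean_mono hQ) hρm fun r hr => ?_
    calc hardyMean (quotientFst f ξ) r ≤ K * hardyMean f r := by
          unfold hardyMean
          rw [← lintegral_const_mul' _ _ ENNReal.ofReal_ne_top]
          refine lintegral_mono fun θ₁ => ?_
          rw [← lintegral_const_mul' _ _ ENNReal.ofReal_ne_top]
          refine lintegral_mono fun θ₂ => ?_
          simp only [hdiv _ _ (hcirc r hr θ₁) (circleMap_mem r.2 θ₂), enorm_mul, mul_pow]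
          gcongr
          exact (hfar _ (hcirc r hr θ₁)).2
      _ ≤ _ := by gcongr; exact le_iSup (fun r : Ioo (0 : ℝ) 1 => hardyMean f r) r
  have q1' : hardyNormSq (quotientFst f ξ) < ⊤ :=
    q1.trans_lt (ENNReal.mul_lt_top ENNReal.ofReal_lt_top hf1)
  have q3 : (⨆ r : Ioo (0 : ℝ) 1, dirichletMean μ₂ (fun z e => quotientFst f ξ (e, z)) r) ≤
      K * ⨆ r : Ioo (0 : ℝ) 1, dirichletMean μ₂ (fun z e => f (e, z)) r := by
    refine iSup_le_of_monotone (dirichletMean_mono μ₂ (F := fun z e => quotientFst f ξ (e, z))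
      (differentiableOn_swap hQ)) hρm fun r hr => ?_
    calc _ ≤ K * dirichletMean μ₂ (fun z e => f (e, z)) r := by
          unfold dirichletMean
          rw [← lintegral_const_mul' _ _ ENNReal.ofReal_ne_top]
          refine lintegral_mono fun θ => ?_
          simp only
          rw [← lintegral_const_mul' _ _ ENNReal.ofReal_ne_top]
          refine lintegral_mono_ae ?_
          filter_upwards [ae_area] with z hz
          have he : (fun w => quotientFst f ξ (circleMap 0 r θ, w)) =ᶠ[𝓝 z]
              fun w => (circleMap 0 r θ - ξ)⁻¹ * f (circleMap 0 r θ, w) := by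
            filter_upwards [isOpen_ball.mem_nhds hz] with w hw
            exact hdiv _ _ (hcirc r hr θ) (by simpa using hw)
          rw [he.deriv_eq, deriv_const_mul_field, enorm_mul, mul_pow, mul_assoc]
          gcongr
          exact (hfar _ (hcirc r hr θ)).2
      _ ≤ _ := by
          gcongr
          exact le_iSup (fun r : Ioo (0 : ℝ) 1 => dirichletMean μ₂ (fun z e => f (e, z)) r) r
  -- This Dirichlet integral runs over the whole disc in `z₁`, including the pole. For `‖z‖ ≤ ρ` the
  -- derivative of the quotient is bounded by the quotient's own Hardy norm on slices, already
  -- controlled by `q1`; for `‖z‖ ≥ ρ` the quotient rule applies.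
  obtain ⟨K', hK', hCauchy⟩ := exists_enorm_deriv_sq_le hρm.1.le hρm.2
  have q2 : ∀ r : Ioo (0 : ℝ) 1, dirichletMean μ₁ (fun z e => quotientFst f ξ (z, e)) r ≤
      (2 * K) * (⨆ r : Ioo (0 : ℝ) 1, dirichletMean μ₁ (fun z e => f (z, e)) r) +
        (2 * K ^ 2) * (24 * μ₁ univ * hardyNormSq f) +
        K' * (24 * μ₁ univ * hardyNormSq (quotientFst f ξ)) := by
    intro r
    refine (dirichletMean_le μ₁ (F := fun z e => f (z, e)) (G := fun z e => quotientFst f ξ (z, e))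
      (a := 2 * K) (b := 2 * K ^ 2) (c := K') hf hQ (fun z e hz he => ?_) r.2).trans ?_
    · have hQs := differentiableOn_slice (F := fun a b => quotientFst f ξ (a, b)) hQ he
      rcases le_or_gt ρ ‖z‖ with hρz | hρz
      · refine le_add_right ?_
        have hb : ball (0 : ℂ) 1 ∈ 𝓝 z := isOpen_ball.mem_nhds (by simpa using hz)
        have hprod : HasDerivAt (fun w => (w - ξ) * quotientFst f ξ (w, e))
            (1 * quotientFst f ξ (z, e) + (z - ξ) * deriv (fun w => quotientFst f ξ (w, e)) z) z :=
          ((hasDerivAt_id z).sub_const ξ).mul (hQs.differentiableAt hb).hasDerivAt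
        have heq : (fun w => (w - ξ) * quotientFst f ξ (w, e)) = fun w => f (w, e) := by
          funext w
          rw [sub_mul_quotientFst f ξ (w, e), h0 e he, sub_zero]
        rw [heq] at hprod
        have hne := sub_ne_zero.2 (hfar z hρz).1
        have hd : deriv (fun w => quotientFst f ξ (w, e)) z =
            (z - ξ)⁻¹ * (deriv (fun w => f (w, e)) z + -((z - ξ)⁻¹ * f (z, e))) := by
          rw [hprod.deriv, hdiv z e hρz he]
          field_simp
          ring
        rw [hd, enorm_mul, mul_pow]
        have hk := (hfar z hρz).2
        calc _ ≤ K * (2 * ‖deriv (fun w => f (w, e)) z‖ₑ ^ 2 + 2 * (K * ‖f (z, e)‖ₑ ^ 2)) := by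
              gcongr
              refine (enorm_add_sq_le _ _ 1 one_ne_zero).trans ?_
              norm_num
              rw [mul_pow]
              gcongr
          _ = _ := by ring
      · exact le_add_left (hCauchy _ hQs z hρz.le)
    · gcongr
      exact le_iSup (fun r : Ioo (0 : ℝ) 1 => dirichletMean μ₁ (fun z e => f (z, e)) r) r
  have hμ : 24 * μ₁ univ < ⊤ := ENNReal.mul_lt_top (by simp) (measure_lt_top _ _)
  refine ENNReal.add_lt_top.2 ⟨q1', ENNReal.add_lt_top.2 ⟨(iSup_le q2).trans_lt ?_,
    q3.trans_lt (ENNReal.mul_lt_top ENNReal.ofReal_lt_top hf3)⟩⟩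
  have hK2 : 2 * K < ⊤ := ENNReal.mul_lt_top (by simp) ENNReal.ofReal_lt_top
  have hK3 : 2 * K ^ 2 < ⊤ :=
    ENNReal.mul_lt_top (by simp) (ENNReal.pow_lt_top ENNReal.ofReal_lt_top)
  exact ENNReal.add_lt_top.2 ⟨ENNReal.add_lt_top.2 ⟨ENNReal.mul_lt_top hK2 hf2,
    ENNReal.mul_lt_top hK3 (ENNReal.mul_lt_top hμ hf1)⟩,
    ENNReal.mul_lt_top hK'.lt_top (ENNReal.mul_lt_top hμ q1')⟩

/-! ### The operators, the reproducing kernel and the joint kernels. -/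

namespace DirichletSpace

variable {μ₁ μ₂ : Measure (closedBall (0 : ℂ) 1)} [IsFiniteMeasure μ₁] [IsFiniteMeasure μ₂]

/-- The interchange of the two variables. -/
def swap : DirichletSpace μ₁ μ₂ →L[ℂ] DirichletSpace μ₂ μ₁ :=
  LinearMap.mkContinuous
    { toFun := fun f => ⟨fun p => f (p.2, p.1), by
        have h : normSq μ₂ μ₁ (fun p => f (p.2, p.1)) < ⊤ := by
          rw [normSq_swap μ₁ μ₂ f.2.1]
          exact (normSq_ne_top f).lt_top
        have h2 := ENNReal.add_lt_top.1 h
        exact ⟨differentiableOn_swap f.2.1, fun z hz => f.2.2.1 _ fun h => hz ⟨h.2, h.1⟩,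
          h2.1, h2.2⟩⟩
      map_add' := fun _ _ => rfl
      map_smul' := fun _ _ => rfl } 1 fun f => by
    rw [one_mul]
    refine (pow_le_pow_iff_left₀ (norm_nonneg _) (norm_nonneg _) two_ne_zero).1 (le_of_eq ?_)
    rw [norm_sq, norm_sq]
    exact congrArg ENNReal.toReal (normSq_swap μ₁ μ₂ f.2.1)

/-- Multiplication by the first coordinate. -/
def mulFst : DirichletSpace μ₁ μ₂ →L[ℂ] DirichletSpace μ₁ μ₂ :=
  LinearMap.mkContinuous
    { toFun := fun f => ⟨fun z => z.1 * f z, by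
        have h := (normSq_mul_fst_le μ₁ μ₂ f.2.1).trans_lt (ENNReal.mul_lt_top
          (ENNReal.add_lt_top.2 ⟨by simp, ENNReal.mul_lt_top (by simp) (measure_lt_top μ₁ univ)⟩)
          (normSq_ne_top f).lt_top)
        have h2 := ENNReal.add_lt_top.1 h
        exact ⟨differentiableOn_fst.mul f.2.1, fun z hz => by simp [f.2.2.1 z hz], h2.1, h2.2⟩⟩
      map_add' := fun f g => Subtype.ext (funext fun z => mul_add z.1 (f z) (g z))
      map_smul' := fun c f => Subtype.ext (funext fun z => mul_left_comm z.1 c (f z)) }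
    (√(2 + 48 * μ₁.real univ)) fun f => by
    refine (pow_le_pow_iff_left₀ (norm_nonneg _) (by positivity) two_ne_zero).1 ?_
    rw [mul_pow, Real.sq_sqrt (by positivity), norm_sq, norm_sq]
    have hc : 2 + 48 * μ₁ univ ≠ ⊤ :=
      ENNReal.add_ne_top.2 ⟨by simp, ENNReal.mul_ne_top (by simp) (measure_ne_top μ₁ univ)⟩
    refine (ENNReal.toReal_mono (ENNReal.mul_ne_top hc (normSq_ne_top f))
      (normSq_mul_fst_le μ₁ μ₂ f.2.1)).trans_eq ?_
    rw [ENNReal.toReal_mul, ENNReal.toReal_add (by simp)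
      (ENNReal.mul_ne_top (by simp) (measure_ne_top μ₁ univ)), ENNReal.toReal_mul]
    rfl

lemma mulFst_apply (f : DirichletSpace μ₁ μ₂) (z : ℂ × ℂ) : mulFst f z = z.1 * f z := rfl

/-- Multiplication by the second coordinate. -/
def mulSnd : DirichletSpace μ₁ μ₂ →L[ℂ] DirichletSpace μ₁ μ₂ := swap.comp (mulFst.comp swap)

lemma mulSnd_apply (f : DirichletSpace μ₁ μ₂) (z : ℂ × ℂ) : mulSnd f z = z.2 * f z := rfl

/-- Evaluation at a point of `ℂ²`. -/
def eval (w : ℂ × ℂ) : DirichletSpace μ₁ μ₂ →L[ℂ] ℂ :=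
  LinearMap.mkContinuousOfExistsBound
    { toFun := fun f => f w
      map_add' := fun _ _ => rfl
      map_smul' := fun _ _ => rfl } <| by
    by_cases hw : w ∈ bidisc
    · exact ⟨_, fun f => norm_apply_le (le_max_of_le_left (norm_nonneg _)) (max_lt hw.1 hw.2) f
        (le_max_left _ _) (le_max_right _ _)⟩
    · exact ⟨0, fun f => by
        rw [zero_mul]
        exact (norm_eq_zero.2 (f.2.2.1 w hw)).le⟩

/-- The reproducing kernel `κ(·, w)`. -/
def kernel (w : ℂ × ℂ) : DirichletSpace μ₁ μ₂ := (InnerProductSpace.toDual ℂ _).symm (eval w)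

lemma inner_kernel (w : ℂ × ℂ) (f : DirichletSpace μ₁ μ₂) : inner ℂ (kernel w) f = f w :=
  InnerProductSpace.toDual_symm_apply

lemma exists_one : ∃ e : DirichletSpace μ₁ μ₂, ∀ z ∈ bidisc, e z = 1 := by
  have h : normSq μ₁ μ₂ (fun _ => 1) < ⊤ := by
    simp [normSq, dirichletIntegral, dirichletMean, hardyNormSq, hardyMean, angle_univ]
    exact (iSup_le fun _ => le_rfl).trans_lt ENNReal.one_lt_top
  exact ⟨mk _ (differentiableOn_const 1) h, fun z hz => mk_apply _ h hz⟩

lemma exists_freeze_fst (f : DirichletSpace μ₁ μ₂) {ξ : ℂ} (hξ : ‖ξ‖ < 1) :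
    ∃ g : DirichletSpace μ₁ μ₂, ∀ z ∈ bidisc, g z = f (ξ, z.2) := by
  have hd : DifferentiableOn ℂ (fun z : ℂ × ℂ => f (ξ, z.2)) bidisc :=
    f.2.1.comp (f := fun z : ℂ × ℂ => (ξ, z.2)) (by fun_prop) fun z hz => ⟨hξ, hz.2⟩
  have h := (normSq_freeze_fst_le μ₁ μ₂ f.2.1 hξ).trans_lt
    (ENNReal.mul_lt_top ENNReal.ofReal_lt_top (normSq_ne_top f).lt_top)
  exact ⟨mk _ hd h, fun z hz => mk_apply hd h hz⟩

lemma exists_div_fst (f : DirichletSpace μ₁ μ₂) {ξ : ℂ} (hξ : ‖ξ‖ < 1)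
    (h0 : ∀ e : ℂ, ‖e‖ < 1 → f (ξ, e) = 0) :
    ∃ q : DirichletSpace μ₁ μ₂, f = mulFst q - ξ • q := by
  have h := normSq_quotientFst_lt_top μ₁ μ₂ f.2.1 (normSq_ne_top f).lt_top hξ h0
  refine ⟨mk _ (differentiableOn_quotientFst f.2.1 hξ) h, DirichletSpace.ext fun z hz => ?_⟩
  rw [sub_apply, mulFst_apply, smul_apply, mk_apply _ h hz, ← sub_mul, sub_mul_quotientFst,
    h0 z.2 hz.2, sub_zero]

lemma exists_div_snd (f : DirichletSpace μ₁ μ₂) {ξ : ℂ} (hξ : ‖ξ‖ < 1)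
    (h0 : ∀ e : ℂ, ‖e‖ < 1 → f (e, ξ) = 0) :
    ∃ q : DirichletSpace μ₁ μ₂, f = mulSnd q - ξ • q := by
  obtain ⟨q, hq⟩ := exists_div_fst (swap f) hξ h0
  refine ⟨swap q, DirichletSpace.ext fun z _ => ?_⟩
  exact congrArg (fun g : DirichletSpace μ₂ μ₁ => g (z.2, z.1)) hq

/-- Gleason's problem is solvable in the space. -/
lemma exists_gleason {l : ℂ × ℂ} (hl : l ∈ bidisc) {e : DirichletSpace μ₁ μ₂}
    (he : ∀ z ∈ bidisc, e z = 1) (f : DirichletSpace μ₁ μ₂) :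
    ∃ p q : DirichletSpace μ₁ μ₂,
      f = f l • e + ((mulFst p - l.1 • p) + (mulSnd q - l.2 • q)) := by
  -- Telescoping with `g(z) = f(l₁, z₂)`: the difference `f - g` vanishes on `z₁ = l₁`, and `g -
  -- f(l)` vanishes on `z₂ = l₂`.
  obtain ⟨g, hg⟩ := exists_freeze_fst f hl.1
  obtain ⟨p, hp⟩ := exists_div_fst (f - g) hl.1 fun w hw => by
    rw [sub_apply, hg (l.1, w) ⟨hl.1, hw⟩, sub_self]
  obtain ⟨q, hq⟩ := exists_div_snd (g - f l • e) hl.2 fun w hw => by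
    rw [sub_apply, smul_apply, hg (w, l.2) ⟨hw, hl.2⟩, he (w, l.2) ⟨hw, hl.2⟩, mul_one, sub_self]
  refine ⟨p, q, ?_⟩
  rw [← hp, ← hq]
  abel

lemma mem_jointKer {E : Type*} [NormedAddCommGroup E] [InnerProductSpace ℂ E] {T₁ T₂ : E →L[ℂ] E}
    {w : ℂ × ℂ} {x : E} : x ∈ jointKer T₁ T₂ w ↔ T₁ x = w.1 • x ∧ T₂ x = w.2 • x := by
  simp [jointKer, Submodule.mem_inf, sub_eq_zero]

/-- The eigenvalue equation for the first coordinate alone gives `f = 0` off `z₁ = w₁`, and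
continuity in `z₁` extends this across. -/
lemma jointKer_mul_eq_bot (w : ℂ × ℂ) :
    jointKer (mulFst (μ₁ := μ₁) (μ₂ := μ₂)) mulSnd w = ⊥ := by
  refine (Submodule.eq_bot_iff _).2 fun f hf => DirichletSpace.ext fun z hz => ?_
  have h1 := (mem_jointKer.1 hf).1
  have hzero : ∀ a : ℂ, a ≠ w.1 → f (a, z.2) = 0 := by
    intro a ha
    have h2 : a * f (a, z.2) = w.1 * f (a, z.2) :=
      congrArg (fun g : DirichletSpace μ₁ μ₂ => g (a, z.2)) h1
    rw [← sub_eq_zero, ← sub_mul] at h2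
    exact (mul_eq_zero.1 h2).resolve_left (sub_ne_zero.2 ha)
  have hcont : ContinuousAt (fun a => f (a, z.2)) z.1 :=
    ((differentiableOn_slice (F := fun a b => f (a, b)) f.2.1 hz.2).continuousOn.continuousAt
      (isOpen_ball.mem_nhds (by simpa using hz.1)))
  by_cases hzw : z.1 = w.1
  · have h3 : Tendsto (fun a => f (a, z.2)) (𝓝[≠] z.1) (𝓝 (f z)) :=
      hcont.tendsto.mono_left nhdsWithin_le_nhds
    refine tendsto_nhds_unique h3 (tendsto_const_nhds.congr' ?_)
    filter_upwards [self_mem_nhdsWithin] with a ha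
    exact (hzero a fun h => ha (h.trans hzw.symm)).symm
  · exact hzero z.1 hzw

/-- The kernel reproduces the value 1 of the constant function, so it cannot vanish; this makes the
adjoint eigenspace exactly one-dimensional. -/
lemma kernel_ne_zero {l : ℂ × ℂ} (hl : l ∈ bidisc) :
    (kernel l : DirichletSpace μ₁ μ₂) ≠ 0 := by
  obtain ⟨e, he⟩ := exists_one (μ₁ := μ₁) (μ₂ := μ₂)
  intro h
  have h1 := inner_kernel l e
  rw [h, inner_zero_left, he l hl] at h1
  exact zero_ne_one h1

/-- The joint eigenspaces of the adjoints are spanned by the reproducing kernels. -/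
lemma jointKer_adjoint_eq_span {w : ℂ × ℂ} (hw : w ∈ bidisc) :
    jointKer (ContinuousLinearMap.adjoint (mulFst (μ₁ := μ₁) (μ₂ := μ₂)))
      (ContinuousLinearMap.adjoint mulSnd) w = Submodule.span ℂ {kernel (conj w.1, conj w.2)} := by
  have hl : (conj w.1, conj w.2) ∈ bidisc := by
    constructor
    · simpa using hw.1
    · simpa using hw.2
  set l : ℂ × ℂ := (conj w.1, conj w.2) with hldef
  refine le_antisymm (fun g hg => ?_) ?_
  · obtain ⟨h1, h2⟩ := mem_jointKer.1 hg
    obtain ⟨e, he⟩ := exists_one (μ₁ := μ₁) (μ₂ := μ₂)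
    -- The coefficient is forced by testing against the constant function `e`, since `⟨e, κ(·, l)⟩ =
    -- 1`.
    refine Submodule.mem_span_singleton.2 ⟨inner ℂ e g, ?_⟩
    refine ext_inner_right ℂ fun f => ?_
    obtain ⟨p, q, hf⟩ := exists_gleason hl he f
    -- An eigenvector of the adjoint for `w₁` is orthogonal to the range of `M₁ - conj w₁`; so only
    -- the term `f(l) e` of the Gleason decomposition survives.
    have e1 : inner ℂ g (mulFst p - l.1 • p) = 0 := by
      rw [inner_sub_right, ← ContinuousLinearMap.adjoint_inner_left, h1, inner_smul_left,
        inner_smul_right, sub_self]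
    have e2 : inner ℂ g (mulSnd q - l.2 • q) = 0 := by
      rw [inner_sub_right, ← ContinuousLinearMap.adjoint_inner_left, h2, inner_smul_left,
        inner_smul_right, sub_self]
    have e3 : inner ℂ g f = f l * inner ℂ g e := by
      conv_lhs => rw [hf]
      rw [inner_add_right, inner_add_right, e1, e2, inner_smul_right, add_zero, add_zero]
    rw [inner_smul_left, inner_conj_symm, inner_kernel, e3, mul_comm]
  -- Conversely, both sides of each eigenvalue equation pair with `f` to `lᵢ f(l)`, by the
  -- reproducing property.
  · rw [Submodule.span_singleton_le_iff_mem, mem_jointKer]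
    constructor
    · refine ext_inner_right ℂ fun f => ?_
      rw [ContinuousLinearMap.adjoint_inner_left, inner_smul_left, inner_kernel, inner_kernel,
        mulFst_apply]
    · refine ext_inner_right ℂ fun f => ?_
      rw [ContinuousLinearMap.adjoint_inner_left, inner_smul_left, inner_kernel, inner_kernel,
        mulSnd_apply]

end DirichletSpace

end Bidisc

end

theorem mainTheorem10
    (μ₁ μ₂ : MeasureTheory.Measure (Metric.closedBall (0 : ℂ) 1))
    [MeasureTheory.IsFiniteMeasure μ₁] [MeasureTheory.IsFiniteMeasure μ₂] :
    ∃ (_ : CompleteSpace (Bidisc.DirichletSpace μ₁ μ₂))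
      (κ : ℂ × ℂ → Bidisc.DirichletSpace μ₁ μ₂)
      (M₁ M₂ : Bidisc.DirichletSpace μ₁ μ₂ →L[ℂ] Bidisc.DirichletSpace μ₁ μ₂),
      (∀ w ∈ Bidisc.bidisc, ∀ f : Bidisc.DirichletSpace μ₁ μ₂, inner ℂ (κ w) f = f w) ∧
      (∀ (f : Bidisc.DirichletSpace μ₁ μ₂) (z : ℂ × ℂ), M₁ f z = z.1 * f z) ∧
      (∀ (f : Bidisc.DirichletSpace μ₁ μ₂) (z : ℂ × ℂ), M₂ f z = z.2 * f z) ∧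
      ∀ w ∈ Bidisc.bidisc,
        Bidisc.jointKer M₁ M₂ w = ⊥ ∧
        Bidisc.jointKer (ContinuousLinearMap.adjoint M₁) (ContinuousLinearMap.adjoint M₂) w =
          Submodule.span ℂ {κ (starRingEnd ℂ w.1, starRingEnd ℂ w.2)} ∧
        Module.finrank ℂ (Bidisc.jointKer (ContinuousLinearMap.adjoint M₁)
          (ContinuousLinearMap.adjoint M₂) w) = 1 := by
  refine ⟨inferInstance, Bidisc.DirichletSpace.kernel, Bidisc.DirichletSpace.mulFst,
    Bidisc.DirichletSpace.mulSnd, fun w _ => Bidisc.DirichletSpace.inner_kernel w,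
    Bidisc.DirichletSpace.mulFst_apply, Bidisc.DirichletSpace.mulSnd_apply, fun w hw => ?_⟩
  refine ⟨Bidisc.DirichletSpace.jointKer_mul_eq_bot w,
    Bidisc.DirichletSpace.jointKer_adjoint_eq_span hw, ?_⟩
  rw [Bidisc.DirichletSpace.jointKer_adjoint_eq_span hw]
  refine finrank_span_singleton (Bidisc.DirichletSpace.kernel_ne_zero ⟨?_, ?_⟩)
  · simpa using hw.1
  · simpa using hw.2
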